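/- Let $\mathbb T_1\subset\mathbb T_2\subset\cdots$ be a refining sequence of partitions of $[0,1]$: each $\mathbb T_n$ is a finite subset of $[0,1]$ containing $0$ and $1$, and the mesh of $\mathbb T_n$ tends to zero. For $s\in\mathbb T_n$ let $s'$ be the successor of $s$ in $\mathbb T_n$ (with $1'=1$). Let $x\in C[0,1]$ satisfy $x(0)=0$ and admit a continuous quadratic variation along $(\mathbb T_n)$, i.e. for all $t\in[0,1]$ the limit $$\langle x\rangle_t=\lim_{n\to\infty}\sum_{s\in\mathbb T_n,\,s\le t}(x(s')-x(s))^2$$ exists, and $t\mapsto\langle x\rangle_t$ is continuous. Let $A$ be continuous and of bounded variation on $[0,1]$ ($A\in CBV[0,1]$). Let $b:[0,1]\times\mathbb R\to\mathbb R$ be continuous such that for every $p>0$ there is $L_p\ge 0$ with $|b(t,\xi)-b(t,\zeta)|\le L_p|\xi-\zeta|$ for all $t\in[0,1]$ and $\xi,\zeta\in[-p,p]$, and such that for some $c\ge0$ one has $|b(t,\xi)|\le c(1+|\xi|)$ for all $t\in[0,1]$, $\xi\in\mathbb R$. Let $I\supset[0,1]$ be an open interval and let $\sigma\in C^2(I\times\mathbb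 R)$ have bounded first partial derivatives in $t$ and $\xi$ on $I\times\mathbb R$. **Definitions.** Integrals with respect to $A$, $\langle x\rangle$ and $ds$ are Riemann–Stieltjes integrals. The Föllmer integral of $\eta$ is $\int_0^t\eta(s)\,dx(s)=\lim_{n}\sum_{s\in\mathbb T_n,\,s\le t}\eta(s)(x(s')-x(s))$, if the limit exists. A function $\eta$ on $[0,1]$ is an *admissible integrand for $x$* if there are $k\in\mathbb N$, a function $\mathbf A:[0,1]\to\mathbb R^k$ with components in $CBV[0,1]$, an open set $U\subset\mathbb R^k\times\mathbb R$ with $(\mathbf A(t),x(t))\in U$ for all $t\in[0,1]$, and a function $f:U\to\mathbb R$ of class $C^{1,2}$ (that is, $f$ is continuously differentiable, each $\xi\mapsto f(\mathbf a,\xi)$ is twice continuously differentiable on its domain, and $\partial^2 f/\partial\xi^2$ is continuous on $U$) such that $\eta(t)=\frac{\partial f}{\partial\xi}(\mathbf A(t),x(t))$ for all $t\in[0,1]$. A function $z\in C[0,1]$ is a *solution* of $$dz(t)=\sigma(t,z(t))\,dx(t)+b(t,z(t))\,dA(t),\qquad z(0)=z_0, \tag{1}$$ if $t\mapsto\sigma(t,z(t))$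 is an admissible integrand for $x$ and, for all $t\in[0,1]$, the following integrals exist and $$z(t)=z_0+\int_0^t\sigma(s,z(s))\,dx(s)+\int_0^tb(s,z(s))\,dA(s).$$ **Theorem.** (i) For all $\tau\in I$ and $\xi\in\mathbb R$ the ordinary differential equation $\dot u(t)=\sigma(\tau,u(t))$, $u(0)=\xi$, has exactly one solution $u:\mathbb R\to\mathbb R$; write $\phi(\tau,\xi,t):=u(t)$. The functions $\phi$ and $\phi_t=\partial\phi/\partial t$ are twice continuously differentiable on $I\times\mathbb R\times\mathbb R$. (ii) For every $z_0\in\mathbb R$ the Stieltjes integral equation, for $t\in[0,1]$, $$B(t)=z_0+\int_0^t\frac{b(s,\phi(s,B(s),x(s)))}{\phi_\xi(s,B(s),x(s))}\,dA(s)-\int_0^t\frac{\phi_\tau(s,B(s),x(s))}{\phi_\xi(s,B(s),x(s))}\,ds-\frac12\int_0^t\frac{\phi_{tt}(s,B(s),x(s))}{\phi_\xi(s,B(s),x(s))}\,d\langle x\rangle_s$$ has exactly one solution $B\in C[0,1]$, and this solution belongs to $CBV[0,1]$. (iii) For every $z_0\in\mathbb R$, with $B$ as in (ii), the function $z(t):=\phi(t,B(t),x(t))$,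 $t\in[0,1]$, is a solution of (1), and it is the only one. -/

import Mathlib

open Set Filter Topology

/-- A partition of `[0,1]`: a finite set with `0, 1 ∈ P ⊆ [0,1]`. -/
def IsPartition (P : Finset ℝ) : Prop :=
  (0 : ℝ) ∈ P ∧ (1 : ℝ) ∈ P ∧ ∀ s ∈ P, s ∈ Icc (0 : ℝ) 1

/-- The successor `s'` of `s` in `P`: the least element of `P` greater than `s`, and `s` itself if
there is none (so that `1' = 1`). -/
noncomputable def partSucc (P : Finset ℝ) (s : ℝ) : ℝ :=
  if h : (P.filter (fun t => s < t)).Nonempty then (P.filter (fun t => s < t)).min' h else s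

/-- A refining sequence of partitions: increasing, with mesh tending to zero. -/
def IsRefining (T : ℕ → Finset ℝ) : Prop :=
  (∀ n, IsPartition (T n)) ∧ (∀ n, T n ⊆ T (n + 1)) ∧
    ∀ ε > 0, ∀ᶠ n in atTop, ∀ s ∈ T n, partSucc (T n) s - s < ε

/-- `⟨x⟩ⁿ_t`, the approximate quadratic variation along the partition `P`. -/
noncomputable def quadVarSum (P : Finset ℝ) (x : ℝ → ℝ) (t : ℝ) : ℝ :=
  ∑ s ∈ P.filter (fun s => s ≤ t), (x (partSucc P s) - x s) ^ 2

/-- `x` admits the continuous quadratic variation `Q = ⟨x⟩` along `T`. -/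
def HasContinuousQuadVar (T : ℕ → Finset ℝ) (x Q : ℝ → ℝ) : Prop :=
  ContinuousOn Q (Icc 0 1) ∧
    ∀ t ∈ Icc (0 : ℝ) 1, Tendsto (fun n => quadVarSum (T n) x t) atTop (𝓝 (Q t))

/-- The class of continuous functions of bounded variation on `[0,1]`. -/
def IsCBV (A : ℝ → ℝ) : Prop :=
  ContinuousOn A (Icc 0 1) ∧ BoundedVariationOn A (Icc 0 1)

/-- `J` is the Riemann–Stieltjes integral `∫_a^c g dA`: the limit of the Riemann–Stieltjes sums
over tagged partitions of `[a,c]` as the mesh tends to zero. -/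
def HasRSIntegral (g A : ℝ → ℝ) (a c J : ℝ) : Prop :=
  ∀ ε > 0, ∃ δ > 0, ∀ (m : ℕ) (p tag : ℕ → ℝ), p 0 = a → p m = c →
    (∀ i < m, p i ≤ p (i + 1)) → (∀ i < m, p (i + 1) - p i < δ) →
    (∀ i < m, tag i ∈ Icc (p i) (p (i + 1))) →
    |∑ i ∈ Finset.range m, g (tag i) * (A (p (i + 1)) - A (p i)) - J| < ε

/-- `J` is the Föllmer integral `∫_0^t η dx` along `T`: the limit of non-anticipative Riemann
sums. -/
def HasFollmerIntegral (T : ℕ → Finset ℝ) (η x : ℝ → ℝ) (t J : ℝ) : Prop :=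
  Tendsto (fun n => ∑ s ∈ (T n).filter (fun s => s ≤ t), η s * (x (partSucc (T n) s) - x s))
    atTop (𝓝 J)

/-- Admissible integrands for `x`: `η(t) = ∂f/∂ξ (𝐀(t), x(t))` with `𝐀` an `ℝᵏ`-valued function with
components in `CBV[0,1]` and `f` of class `C^{1,2}` on an open set `U` around the path of
`(𝐀, x)`, that is, `f` is `C¹` on `U`, each `f(a, ·)` is `C²`, and `∂²f/∂ξ²` is continuous
on `U`. -/
def IsAdmissible (x η : ℝ → ℝ) : Prop :=
  ∃ (k : ℕ) (A : ℝ → Fin k → ℝ) (U : Set ((Fin k → ℝ) × ℝ)) (f : (Fin k → ℝ) × ℝ → ℝ),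
    (∀ i, IsCBV (fun t => A t i)) ∧ IsOpen U ∧ (∀ t ∈ Icc (0 : ℝ) 1, (A t, x t) ∈ U) ∧
    ContDiffOn ℝ 1 f U ∧
    (∀ a, ContDiffOn ℝ 2 (fun ξ => f (a, ξ)) {ξ | (a, ξ) ∈ U}) ∧
    ContinuousOn (fun q : (Fin k → ℝ) × ℝ => iteratedDeriv 2 (fun ξ => f (q.1, ξ)) q.2) U ∧
    ∀ t ∈ Icc (0 : ℝ) 1, η t = deriv (fun ξ => f (A t, ξ)) (x t)

/-- `z` is a solution of `dz(t) = σ(t,z(t)) dx(t) + b(t,z(t)) dA(t)`, `z(0) = z₀`, on `[0,1]`. -/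
def IsItoSolution (T : ℕ → Finset ℝ) (x A : ℝ → ℝ) (σ b : ℝ → ℝ → ℝ) (z₀ : ℝ) (z : ℝ → ℝ) :
    Prop :=
  ContinuousOn z (Icc 0 1) ∧ IsAdmissible x (fun t => σ t (z t)) ∧
    ∀ t ∈ Icc (0 : ℝ) 1, ∃ J₁ J₂ : ℝ,
      HasFollmerIntegral T (fun s => σ s (z s)) x t J₁ ∧
      HasRSIntegral (fun s => b s (z s)) A 0 t J₂ ∧
      z t = z₀ + J₁ + J₂

/-- `u` is a solution, on all of `ℝ`, of `u' = σ(τ, u)`, `u(0) = ξ`. -/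
def IsFlowLine (σ : ℝ → ℝ → ℝ) (τ ξ : ℝ) (u : ℝ → ℝ) : Prop :=
  u 0 = ξ ∧ ∀ t, HasDerivAt u (σ τ (u t)) t

/-- The partial derivatives of `φ(τ, ξ, t)`. -/
noncomputable def partialTau (φ : ℝ → ℝ → ℝ → ℝ) (τ ξ t : ℝ) : ℝ := deriv (fun r => φ r ξ t) τ

noncomputable def partialXi (φ : ℝ → ℝ → ℝ → ℝ) (τ ξ t : ℝ) : ℝ := deriv (fun y => φ τ y t) ξ

noncomputable def partialT (φ : ℝ → ℝ → ℝ → ℝ) (τ ξ t : ℝ) : ℝ := deriv (fun r => φ τ ξ r) t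

/-- `B` is a solution in `C[0,1]` of the Stieltjes integral equation
`B(t) = z₀ + ∫_0^t b(s,φ(s,B,x))/φ_ξ(s,B,x) dA(s) - ∫_0^t φ_τ(s,B,x)/φ_ξ(s,B,x) ds
  - 1/2 ∫_0^t φ_tt(s,B,x)/φ_ξ(s,B,x) dQ(s)`. -/
def IsDossSussmannSolution (x Q A : ℝ → ℝ) (b : ℝ → ℝ → ℝ) (φ : ℝ → ℝ → ℝ → ℝ) (z₀ : ℝ)
    (B : ℝ → ℝ) : Prop :=
  ContinuousOn B (Icc 0 1) ∧ ∀ t ∈ Icc (0 : ℝ) 1, ∃ J₁ J₂ J₃ : ℝ,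
    HasRSIntegral (fun s => b s (φ s (B s) (x s)) / partialXi φ s (B s) (x s)) A 0 t J₁ ∧
    HasRSIntegral (fun s => partialTau φ s (B s) (x s) / partialXi φ s (B s) (x s))
      (fun s => s) 0 t J₂ ∧
    HasRSIntegral (fun s => partialT (partialT φ) s (B s) (x s) / partialXi φ s (B s) (x s))
      Q 0 t J₃ ∧
    B t = z₀ + J₁ - J₂ - 1 / 2 * J₃

/-- Local Lipschitz condition in the second argument, uniformly in `t ∈ [0,1]`. -/
def LocalLipschitzCond (f : ℝ → ℝ → ℝ) : Prop :=
  ∀ p > 0, ∃ L ≥ 0, ∀ t ∈ Icc (0 : ℝ) 1, ∀ ξ ∈ Icc (-p) p, ∀ ζ ∈ Icc (-p) p,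
    |f t ξ - f t ζ| ≤ L * |ξ - ζ|

/-- Linear growth condition in the second argument, uniformly in `t ∈ [0,1]`. -/
def LinearGrowthCond (f : ℝ → ℝ → ℝ) : Prop :=
  ∃ c ≥ 0, ∀ t ∈ Icc (0 : ℝ) 1, ∀ ξ : ℝ, |f t ξ| ≤ c * (1 + |ξ|)

/-! Everything is reduced to a calculus of increments over pairs `0 ≤ s ≤ t ≤ 1` with `t - s → 0`,
measured against a nondecreasing control `w` that dominates the increments of `A`, of time and of
`⟨x⟩`. Errors `o(dw)` telescope to nothing (`Controls.of_isLittleO`), so a Stieltjes equation is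
equivalent to its infinitesimal form `dB = ∑ βᵢ(t, B) dAᵢ + o(dw)` (`solvesStieltjes_iff`). Errors
`o(dw + dx²)` vanish when summed along the partitions, because the sums of `dw` stay bounded and
those of `dx²` converge. As moreover `∑ γ dx² → ∫ γ d⟨x⟩`, any expansion `dz = α dx + ½ γ dx² + dC +
o(dw + dx²)` produces the Föllmer integral of `α` (`HasContinuousQuadVar.hasFollmerIntegral`).
Taylor's formula (`incr_comp_isLittleO`) supplies such expansions; together these are Föllmer's Itô
formula.

The flow: the difference of two flow lines solves an exact linear equation whose coefficients are
means of the partial derivatives of `σ`. Variation of constants then writes `φ(q') - φ(q)` as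
`L(q')(q' - q)` with `L` continuous (`flow_sub_eq_flowDeriv`). So `φ` is `C¹` with an explicit
derivative, and that formula bootstraps to `C²`; since `φ_t = σ(τ, φ)`, the same holds for `φ_t`.
Running the flow backwards bounds `1/φ_ξ`. Hence the coefficients of the equation for `B` are
locally Lipschitz and of linear growth, and Picard iteration, truncation and Grönwall's inequality
solve it (`exists_solvesStieltjes`, `SolvesStieltjes.eqOn`).

Existence for (1): with `z = φ(t, B, x)` one has `dz = σ dx + ½ φ_tt dx² + φ_τ dt + φ_ξ dB` up to
negligible errors, and the equation for `B` says exactly that the last two terms amount to `b dA - ½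
φ_tt d⟨x⟩`.

Uniqueness for (1): given any solution `z`, set `B = φ(t, z, -x)`, so that `z = φ(t, B, x)`.
Admissibility yields `dz = σ dx + ½ γ (dx² - d⟨x⟩) + b dA` with some unknown `γ`
(`IsItoSolution.exists_expansion`). The first-order terms in `dx` cancel in `dB`, which is therefore
`O(dw + dx²)` (`FlowCoeff.incr_pullback_isBigO`); this is enough to expand `φ(t, B, x)`. Comparing
the two expansions expresses `dB` through `dx²` and Stieltjes differentials. There `dx²` may be
replaced by `d⟨x⟩`, whereupon `γ` drops out, and `B` solves the Stieltjes equation, whose solution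
is unique. -/

open Asymptotics MeasureTheory

/-! ### Calculus of small increments and controls -/

/-- The filter of pairs `(s, t)` with `0 ≤ s ≤ t ≤ 1` and `t - s → 0`. -/
def mesh : Filter (ℝ × ℝ) :=
  comap (fun p => p.2 - p.1) (𝓝 0) ⊓ 𝓟 {p | 0 ≤ p.1 ∧ p.1 ≤ p.2 ∧ p.2 ≤ 1}

/-- The increment of `f` over a pair of times. -/
def incr (f : ℝ → ℝ) (p : ℝ × ℝ) : ℝ := f p.2 - f p.1

lemma eventually_mesh_iff {P : ℝ × ℝ → Prop} :
    (∀ᶠ p in mesh, P p) ↔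
      ∃ δ > 0, ∀ s t, 0 ≤ s → s ≤ t → t ≤ 1 → t - s < δ → P (s, t) := by
  have hb := ((Metric.nhds_basis_ball (x := (0 : ℝ))).comap
    (fun p : ℝ × ℝ => p.2 - p.1)).inf_principal {p | 0 ≤ p.1 ∧ p.1 ≤ p.2 ∧ p.2 ≤ 1}
  rw [mesh, hb.eventually_iff]
  constructor
  · rintro ⟨δ, hδ, h⟩
    refine ⟨δ, hδ, fun s t h0 hst h1 hd => h ⟨?_, h0, hst, h1⟩⟩
    simp only [mem_preimage, Metric.mem_ball, dist_zero_right, Real.norm_eq_abs]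
    rwa [abs_of_nonneg (by linarith)]
  · rintro ⟨δ, hδ, h⟩
    refine ⟨δ, hδ, ?_⟩
    rintro ⟨s, t⟩ ⟨h1, h2, h3, h4⟩
    simp only [mem_preimage, Metric.mem_ball, dist_zero_right, Real.norm_eq_abs] at h1
    exact h s t h2 h3 h4 (lt_of_abs_lt h1)

lemma eventually_mesh_mem : ∀ᶠ p in mesh, 0 ≤ p.1 ∧ p.1 ≤ p.2 ∧ p.2 ≤ 1 :=
  eventually_mesh_iff.2 ⟨1, one_pos, fun _ _ h0 h1 h2 _ => ⟨h0, h1, h2⟩⟩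

lemma exists_fine_chain {a b δ : ℝ} (hab : a ≤ b) (hδ : 0 < δ) :
    ∃ (m : ℕ) (p : ℕ → ℝ), p 0 = a ∧ p m = b ∧ Monotone p ∧ ∀ i, p (i + 1) - p i < δ := by
  obtain ⟨n, hn⟩ := exists_nat_gt ((b - a) / δ)
  have hn' : 0 < (n : ℝ) + 1 := by positivity
  refine ⟨n + 1, fun i => a + i * ((b - a) / (n + 1)), by simp, ?_, ?_, ?_⟩
  · push_cast; field_simp; ring
  · refine monotone_nat_of_le_succ fun i => ?_
    have : 0 ≤ (b - a) / (n + 1) := div_nonneg (by linarith) hn'.le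
    push_cast; nlinarith
  · intro i
    have : (b - a) / (n + 1) < δ := by
      rw [div_lt_iff₀ hδ] at hn
      rw [div_lt_iff₀ hn']; nlinarith
    push_cast; linarith

/-- Induction along a chain of small steps. -/
lemma mesh_induction {P : ℝ × ℝ → Prop} (hP : ∀ᶠ p in mesh, P p) {C : ℝ → Prop} {a b : ℝ}
    (h0 : 0 ≤ a) (hab : a ≤ b) (h1 : b ≤ 1) (ha : C a)
    (step : ∀ s t, a ≤ s → s ≤ t → t ≤ b → P (s, t) → C s → C t) : C b := by
  obtain ⟨δ, hδ, h⟩ := eventually_mesh_iff.1 hP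
  obtain ⟨m, p, p0, pm, hp, hs⟩ := exists_fine_chain hab hδ
  have key : ∀ i, i ≤ m → C (p i) := by
    intro i
    induction i with
    | zero => intro _; rwa [p0]
    | succ i ih =>
      intro hi
      have e1 : a ≤ p i := p0 ▸ hp (Nat.zero_le i)
      have e2 : p (i + 1) ≤ b := pm ▸ hp hi
      have e3 := hp (Nat.le_succ i)
      exact step _ _ e1 e3 e2 (h _ _ (h0.trans e1) e3 (e2.trans h1) (hs i)) (ih (by omega))
  exact pm ▸ key m le_rfl

/-- `w` controls the increments of `f` on `[0,1]`. -/
def Controls (w f : ℝ → ℝ) : Prop :=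
  ∀ s t, 0 ≤ s → s ≤ t → t ≤ 1 → |f t - f s| ≤ w t - w s

lemma Controls.mono {w f : ℝ → ℝ} (h : Controls w f) {s t : ℝ} (h0 : 0 ≤ s) (hst : s ≤ t)
    (h1 : t ≤ 1) : w s ≤ w t := by
  have := (abs_nonneg _).trans (h s t h0 hst h1); linarith

lemma Controls.self {w f : ℝ → ℝ} (h : Controls w f) : Controls w w := fun s t h0 hst h1 => by
  rw [abs_of_nonneg]; have := h.mono h0 hst h1; linarith

lemma Controls.add_right {w f v g : ℝ → ℝ} (h : Controls w f) (hv : Controls v g) :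
    Controls (fun t => w t + v t) f := fun s t h0 hst h1 => by
  have := h s t h0 hst h1; have := hv.mono h0 hst h1; linarith

lemma Controls.add_left {w f v g : ℝ → ℝ} (h : Controls w f) (hv : Controls v g) :
    Controls (fun t => v t + w t) f := fun s t h0 hst h1 => by
  have := h s t h0 hst h1; have := hv.mono h0 hst h1; linarith

lemma controls_self_of_monotoneOn {w : ℝ → ℝ} (h : MonotoneOn w (Icc 0 1)) : Controls w w :=
  fun s t h0 hst h1 => by
    have := h ⟨h0, hst.trans h1⟩ ⟨h0.trans hst, h1⟩ hst
    rw [abs_of_nonneg (by linarith)]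

lemma Controls.incr_isBigO {w f : ℝ → ℝ} (h : Controls w f) : incr f =O[mesh] incr w := by
  refine IsBigO.of_bound 1 (eventually_mesh_mem.mono ?_)
  rintro ⟨s, t⟩ ⟨h0, hst, h1⟩
  have := h s t h0 hst h1
  simpa [incr] using this.trans (le_abs_self _)

lemma Controls.incr_nonneg {w f : ℝ → ℝ} (h : Controls w f) : ∀ᶠ p in mesh, 0 ≤ incr w p :=
  eventually_mesh_mem.mono fun p hp => by
    have := h.mono hp.1 hp.2.1 hp.2.2; simpa [incr] using this

/-- Heine–Cantor: on a compact interval continuity is uniform, hence a statement about small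
increments alone. -/
lemma isLittleO_one_incr_iff {f : ℝ → ℝ} :
    incr f =o[mesh] (fun _ => (1 : ℝ)) ↔ ContinuousOn f (Icc 0 1) := by
  constructor
  · intro h
    rw [Metric.continuousOn_iff]
    intro b hb ε hε
    obtain ⟨δ, hδ, H⟩ := eventually_mesh_iff.1 ((isLittleO_iff.1 h) (half_pos hε))
    refine ⟨δ, hδ, fun a ha hab => ?_⟩
    rw [Real.dist_eq] at hab ⊢
    rcases le_total a b with hle | hle
    · have := H a b ha.1 hle hb.2 (by rw [abs_sub_comm] at hab; exact lt_of_abs_lt hab)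
      simp only [incr, Real.norm_eq_abs, abs_one, mul_one] at this
      rw [abs_sub_comm]; linarith
    · have := H b a hb.1 hle ha.2 (lt_of_abs_lt hab)
      simp only [incr, Real.norm_eq_abs, abs_one, mul_one] at this
      linarith
  · intro h
    have hu := isCompact_Icc.uniformContinuousOn_of_continuous h
    rw [Metric.uniformContinuousOn_iff] at hu
    rw [isLittleO_iff]
    intro ε hε
    obtain ⟨δ, hδ, H⟩ := hu ε hε
    refine eventually_mesh_iff.2 ⟨δ, hδ, fun s t h0 hst h1 hd => ?_⟩
    have := H t ⟨h0.trans hst, h1⟩ s ⟨h0, hst.trans h1⟩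
      (by rw [Real.dist_eq, abs_of_nonneg (by linarith)]; exact hd)
    rw [Real.dist_eq] at this
    simpa [incr] using this.le

lemma ContinuousOn.left_isBigO {f : ℝ → ℝ} (h : ContinuousOn f (Icc 0 1)) :
    (fun p : ℝ × ℝ => f p.1) =O[mesh] (fun _ => (1 : ℝ)) := by
  obtain ⟨C, hC⟩ := isCompact_Icc.exists_bound_of_continuousOn h
  exact IsBigO.of_bound C (eventually_mesh_mem.mono fun p hp => by
    simpa using hC p.1 ⟨hp.1, hp.2.1.trans hp.2.2⟩)

/-- The telescoped form of an infinitesimal inequality. -/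
lemma incr_le_of_forall_eventually {D v w : ℝ → ℝ}
    (h : ∀ ε > 0, ∀ᶠ p in mesh, incr D p ≤ incr v p + ε * incr w p) {a b : ℝ}
    (h0 : 0 ≤ a) (hab : a ≤ b) (h1 : b ≤ 1) : D b - D a ≤ v b - v a := by
  have key : ∀ ε > 0, D b - D a ≤ v b - v a + ε * (w b - w a) := by
    intro ε hε
    refine mesh_induction (h ε hε) (C := fun t => D t - D a ≤ v t - v a + ε * (w t - w a))
      h0 hab h1 (by simp) ?_
    intro s t _ _ _ hP hs
    simp only [incr] at hP
    linarith
  have ht : Tendsto (fun ε : ℝ => v b - v a + ε * (w b - w a)) (𝓝[>] 0) (𝓝 (v b - v a)) := by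
    have : Tendsto (fun ε : ℝ => v b - v a + ε * (w b - w a)) (𝓝 0)
        (𝓝 (v b - v a + 0 * (w b - w a))) := by
      apply Continuous.tendsto; fun_prop
    simpa using this.mono_left nhdsWithin_le_nhds
  exact ge_of_tendsto ht (eventually_mem_nhdsWithin.mono fun ε hε => key ε hε)

/-- The device for integrating infinitesimal inequalities: along a fine chain the errors `R` sum to
at most `ε (w t - w s)` for every `ε > 0`, so they leave no trace after telescoping. Both signs of
`D` are treated. -/
lemma Controls.of_isLittleO {D v w : ℝ → ℝ} (hw : Controls w w)
    (h : ∃ R : ℝ × ℝ → ℝ, R =o[mesh] incr w ∧ ∀ᶠ p in mesh, |incr D p| ≤ incr v p + |R p|) :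
    Controls v D := by
  obtain ⟨R, hR, h⟩ := h
  intro s t h0 hst h1
  have hb : ∀ ε > 0, ∀ᶠ p in mesh, |R p| ≤ ε * incr w p := fun ε hε => by
    filter_upwards [isLittleO_iff.1 hR hε, hw.incr_nonneg] with p hp hn
    rwa [Real.norm_eq_abs, Real.norm_eq_abs, abs_of_nonneg hn] at hp
  refine abs_le.2 ⟨?_, incr_le_of_forall_eventually (w := w) ?_ h0 hst h1⟩
  · have := incr_le_of_forall_eventually (D := fun t => - D t) (v := v) (w := w) ?_ h0 hst h1
    · linarith
    · intro ε hε
      filter_upwards [h, hb ε hε] with p hp hq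
      have := neg_abs_le (incr D p)
      simp only [incr] at *; linarith
  · intro ε hε
    filter_upwards [h, hb ε hε] with p hp hq
    have := le_abs_self (incr D p)
    linarith

lemma eq_of_incr_isLittleO {D w : ℝ → ℝ} (hw : Controls w w) (h : incr D =o[mesh] incr w)
    {a b : ℝ} (h0 : 0 ≤ a) (hab : a ≤ b) (h1 : b ≤ 1) : D b = D a := by
  have := Controls.of_isLittleO (D := D) (v := fun _ => 0) hw
    ⟨_, h, .of_forall fun p => by simp [incr]⟩ a b h0 hab h1
  simp only [sub_self, abs_nonpos_iff] at this
  linarith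

/-! ### Indefinite Stieltjes integrals as infinitesimal expansions -/

/-- `G` is an indefinite Stieltjes integral of `g` against `A`, with errors controlled by `w`. -/
def IsIndefIntegral (w g A G : ℝ → ℝ) : Prop :=
  (fun p : ℝ × ℝ => incr G p - g p.1 * incr A p) =o[mesh] incr w

lemma IsIndefIntegral.continuousOn {w g A G : ℝ → ℝ} (h : IsIndefIntegral w g A G)
    (hw : Controls w w) (hg : ContinuousOn g (Icc 0 1)) (hA : ContinuousOn A (Icc 0 1)) :
    ContinuousOn G (Icc 0 1) := by
  rw [← isLittleO_one_incr_iff] at hA ⊢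
  have h1 : incr w =O[mesh] (fun _ => (1 : ℝ)) := by
    refine IsBigO.of_bound (w 1 - w 0) (eventually_mesh_mem.mono ?_)
    rintro ⟨s, t⟩ ⟨h0, hst, h1⟩
    have e1 := hw.mono h0 hst h1
    have e2 := hw.mono le_rfl h0 (hst.trans h1)
    have e3 := hw.mono (h0.trans hst) h1 le_rfl
    simp only [incr, Real.norm_eq_abs]
    rw [abs_of_nonneg (by simpa using e1), abs_one]; simp only at *; linarith
  have h2 : (fun p : ℝ × ℝ => g p.1 * incr A p) =o[mesh] (fun _ => (1 : ℝ)) := by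
    simpa using hg.left_isBigO.mul_isLittleO hA
  simpa using (h.trans_isBigO h1).add h2

lemma chain_mem {p : ℕ → ℝ} {m : ℕ} (hp : ∀ i < m, p i ≤ p (i + 1)) {i : ℕ} (hi : i ≤ m) :
    p i ∈ Icc (p 0) (p m) := by
  constructor
  · induction i with
    | zero => rfl
    | succ i ih => exact (ih (by omega)).trans (hp i (by omega))
  · obtain ⟨k, rfl⟩ := Nat.exists_eq_add_of_le hi
    clear hi
    induction k with
    | zero => rfl
    | succ k ih => exact (ih fun j hj => hp j (by omega)).trans (hp (i + k) (by omega))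

/-- Moving a tag to the left endpoint costs the oscillation of `g` times `dw`, and replacing `g dA`
by `dG` costs `o(dw)`; both errors sum to a small multiple of the total mass of `w`. -/
lemma IsIndefIntegral.hasRSIntegral {w g A G : ℝ → ℝ} (h : IsIndefIntegral w g A G)
    (hA : Controls w A) (hg : ContinuousOn g (Icc 0 1)) {t : ℝ} (ht : t ∈ Icc (0 : ℝ) 1) :
    HasRSIntegral g A 0 t (G t - G 0) := by
  intro ε hε
  have hw : 0 ≤ w 1 - w 0 := by have := hA.mono le_rfl zero_le_one le_rfl; linarith
  -- The factor `2` accounts for the two errors; `+ 1` keeps the denominator positive and the final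
  -- inequality strict when `w` is constant.
  set η := ε / (2 * (w 1 - w 0) + 1) with hη
  have hηp : 0 < η := by positivity
  obtain ⟨δ₁, hδ₁, H₁⟩ := eventually_mesh_iff.1 (isLittleO_iff.1 h hηp)
  obtain ⟨δ₂, hδ₂, H₂⟩ := eventually_mesh_iff.1
    (isLittleO_iff.1 (isLittleO_one_incr_iff.2 hg) hηp)
  refine ⟨min δ₁ δ₂, by positivity, fun m p tag p0 pm hp hm htag => ?_⟩
  have hmem : ∀ i ≤ m, 0 ≤ p i ∧ p i ≤ 1 := fun i hi => by
    have := chain_mem hp hi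
    rw [p0, pm] at this
    exact ⟨this.1, this.2.trans ht.2⟩
  have term : ∀ i < m, |g (tag i) * (A (p (i + 1)) - A (p i)) - (G (p (i + 1)) - G (p i))| ≤
      2 * η * (w (p (i + 1)) - w (p i)) := by
    intro i hi
    have a1 := (hmem i hi.le).1
    have a2 := (hmem (i + 1) hi).2
    have a3 := hp i hi
    have a4 := hm i hi
    have a5 := htag i hi
    have b1 := H₁ _ _ a1 a3 a2 (a4.trans_le (min_le_left _ _))
    have b2 := H₂ _ _ a1 a5.1 (a5.2.trans a2)
      ((by linarith [a5.2] : tag i - p i < min δ₁ δ₂).trans_le (min_le_right _ _))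
    have b3 := hA _ _ a1 a3 a2
    have b4 := hA.mono a1 a3 a2
    simp only [incr, Real.norm_eq_abs, abs_one, mul_one] at b1 b2
    rw [abs_of_nonneg (by linarith : 0 ≤ w (p (i + 1)) - w (p i))] at b1
    have b5 : |(g (tag i) - g (p i)) * (A (p (i + 1)) - A (p i))| ≤
        η * (w (p (i + 1)) - w (p i)) := by
      rw [abs_mul]; exact mul_le_mul b2 b3 (abs_nonneg _) hηp.le
    have : g (tag i) * (A (p (i + 1)) - A (p i)) - (G (p (i + 1)) - G (p i)) =
      (g (tag i) - g (p i)) * (A (p (i + 1)) - A (p i)) -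
        (G (p (i + 1)) - G (p i) - g (p i) * (A (p (i + 1)) - A (p i))) := by ring
    rw [this]
    refine (abs_sub _ _).trans ?_
    linarith
  have e1 : ∑ i ∈ Finset.range m, (G (p (i + 1)) - G (p i)) = G t - G 0 := by
    rw [Finset.sum_range_sub (fun i => G (p i)), p0, pm]
  have e2 : ∑ i ∈ Finset.range m, (w (p (i + 1)) - w (p i)) = w t - w 0 := by
    rw [Finset.sum_range_sub (fun i => w (p i)), p0, pm]
  rw [← e1, ← Finset.sum_sub_distrib]
  refine (Finset.abs_sum_le_sum_abs _ _).trans_lt ?_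
  refine (Finset.sum_le_sum fun i hi => term i (Finset.mem_range.1 hi)).trans_lt ?_
  rw [← Finset.mul_sum, e2]
  have e3 := hA.mono ht.1 ht.2 le_rfl
  have e4 := hA.mono le_rfl ht.1 ht.2
  calc 2 * η * (w t - w 0) ≤ 2 * η * (w 1 - w 0) := by
        apply mul_le_mul_of_nonneg_left _ (by positivity); linarith
    _ < η * (2 * (w 1 - w 0) + 1) := by nlinarith
    _ = ε := by rw [hη]; field_simp

lemma HasRSIntegral.unique {g A : ℝ → ℝ} {a c J J' : ℝ} (hac : a ≤ c)
    (h : HasRSIntegral g A a c J) (h' : HasRSIntegral g A a c J') : J = J' := by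
  by_contra hne
  have hε : 0 < |J - J'| / 2 := half_pos (abs_pos.2 (sub_ne_zero.2 hne))
  obtain ⟨δ, hδ, H⟩ := h _ hε
  obtain ⟨δ', hδ', H'⟩ := h' _ hε
  obtain ⟨m, p, p0, pm, hp, hs⟩ := exists_fine_chain hac (lt_min hδ hδ')
  have b1 := H m p p p0 pm (fun i _ => hp (Nat.le_succ i))
    (fun i _ => (hs i).trans_le (min_le_left _ _)) (fun i _ => ⟨le_rfl, hp (Nat.le_succ i)⟩)
  have b2 := H' m p p p0 pm (fun i _ => hp (Nat.le_succ i))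
    (fun i _ => (hs i).trans_le (min_le_right _ _)) (fun i _ => ⟨le_rfl, hp (Nat.le_succ i)⟩)
  rw [abs_sub_comm] at b1
  have := abs_sub_le J (∑ i ∈ Finset.range m, g (p i) * (A (p (i + 1)) - A (p i))) J'
  linarith

/-- The candidate is the integral against the Lebesgue–Stieltjes measure of `M`. The interval `(s,
t]` has mass `dM`, so freezing the integrand at `s` errs by at most its oscillation times `dM`. -/
lemma exists_isIndefIntegral_of_monotoneOn {M g : ℝ → ℝ} (hM : MonotoneOn M (Icc 0 1))
    (hMc : ContinuousOn M (Icc 0 1)) (hg : ContinuousOn g (Icc 0 1)) :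
    ∃ G, IsIndefIntegral M g M G := by
  have hproj : ∀ t : ℝ, max 0 (min 1 t) ∈ Icc (0 : ℝ) 1 := fun t =>
    ⟨le_max_left _ _, max_le zero_le_one (min_le_left _ _)⟩
  have hpid : ∀ t ∈ Icc (0 : ℝ) 1, max 0 (min 1 t) = t := fun t ht => by
    rw [min_eq_right ht.2, max_eq_right ht.1]
  have hpc : Continuous fun t : ℝ => max 0 (min 1 t) := by fun_prop
  -- Clamping the argument extends `M` by constants to the whole line, and `g` likewise below.
  let F : StieltjesFunction ℝ :=
    { toFun := fun t => M (max 0 (min 1 t))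
      mono' := fun s t hst => hM (hproj s) (hproj t)
        (max_le_max le_rfl (min_le_min le_rfl hst))
      right_continuous' := fun t =>
        (hMc.comp_continuous hpc hproj).continuousAt.continuousWithinAt }
  let γ : ℝ → ℝ := fun t => g (max 0 (min 1 t))
  have hγ : Continuous γ := hg.comp_continuous hpc hproj
  refine ⟨fun t => ∫ u in Ioc 0 t, γ u ∂F.measure, ?_⟩
  refine isLittleO_iff.2 fun ε hε => ?_
  obtain ⟨δ, hδ, H⟩ := eventually_mesh_iff.1 (isLittleO_iff.1 (isLittleO_one_incr_iff.2 hg) hε)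
  refine eventually_mesh_iff.2 ⟨δ, hδ, fun s t h0 hst h1 hd => ?_⟩
  have hint : ∀ a b, IntegrableOn γ (Ioc a b) F.measure := fun a b =>
    (hγ.integrableOn_Icc).mono_set Ioc_subset_Icc_self
  have hsplit : ∫ u in Ioc 0 t, γ u ∂F.measure =
      (∫ u in Ioc 0 s, γ u ∂F.measure) + ∫ u in Ioc s t, γ u ∂F.measure := by
    rw [← setIntegral_union (Ioc_disjoint_Ioc_of_le le_rfl) measurableSet_Ioc (hint _ _) (hint _ _),
      Ioc_union_Ioc_eq_Ioc h0 hst]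
  have hs := hpid s ⟨h0, hst.trans h1⟩
  have ht := hpid t ⟨h0.trans hst, h1⟩
  have hMst : M s ≤ M t := hM ⟨h0, hst.trans h1⟩ ⟨h0.trans hst, h1⟩ hst
  have hmeas : F.measure.real (Ioc s t) = M t - M s := by
    rw [measureReal_def, F.measure_Ioc]
    change (ENNReal.ofReal (M (max 0 (min 1 t)) - M (max 0 (min 1 s)))).toReal = _
    rw [hs, ht, ENNReal.toReal_ofReal (by linarith)]
  have hconst : ∫ u in Ioc s t, (fun _ => g s) u ∂F.measure = g s * (M t - M s) := by
    rw [setIntegral_const, hmeas, smul_eq_mul, mul_comm]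
  have hfin : F.measure (Ioc s t) < ⊤ := by rw [F.measure_Ioc]; exact ENNReal.ofReal_lt_top
  have hdiff : (∫ u in Ioc s t, γ u ∂F.measure) - g s * (M t - M s) =
      ∫ u in Ioc s t, (γ u - g s) ∂F.measure := by
    rw [← hconst, ← integral_sub (hint _ _) (integrableOn_const hfin.ne)]
  have hbd := norm_setIntegral_le_of_norm_le_const (μ := F.measure) (s := Ioc s t)
    (f := fun u => γ u - g s) (C := ε) hfin (fun u hu => by
      have hu1 : u ∈ Icc (0 : ℝ) 1 := ⟨h0.trans hu.1.le, hu.2.trans h1⟩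
      have := H s u h0 hu.1.le hu1.2 (by linarith [hu.2])
      simp only [γ, hpid u hu1]
      simpa [incr] using this)
  simp only [incr, hsplit, add_sub_cancel_left]
  rw [hdiff, Real.norm_eq_abs (M t - M s), abs_of_nonneg (by linarith), ← hmeas]
  exact hbd

/-! ### Total variation as the smallest control -/

/-- The variation of `A` over `[0, t]`. -/
noncomputable def cumVariation (A : ℝ → ℝ) (t : ℝ) : ℝ := variationOnFromTo A (Icc 0 1) 0 t

lemma IsCBV.controls {A : ℝ → ℝ} (h : IsCBV A) : Controls (cumVariation A) A :=
  fun _ _ h0 hst h1 => variationOnFromTo.abs_sub_le_sub_of_le h.2.locallyBoundedVariationOn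
    ⟨le_rfl, zero_le_one⟩ ⟨h0, hst.trans h1⟩ ⟨h0.trans hst, h1⟩ hst

lemma IsCBV.continuousOn_cumVariation {A : ℝ → ℝ} (h : IsCBV A) :
    ContinuousOn (cumVariation A) (Icc 0 1) := by
  intro t ht
  have h0 : (0 : ℝ) ∈ Icc (0 : ℝ) 1 := ⟨le_rfl, zero_le_one⟩
  have hl := variationOnFromTo.tendsto_left h0 ht h.2.locallyBoundedVariationOn
    ((h.1 t ht).mono inter_subset_left)
  have hr := variationOnFromTo.tendsto_right h0 ht h.2.locallyBoundedVariationOn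
    ((h.1 t ht).mono inter_subset_left)
  simp only [dist_self, sub_zero, add_zero] at hl hr
  exact continuousWithinAt_iff_continuous_left'_right'.2 ⟨hl, hr⟩

lemma eVariationOn_le_of_controls {w A : ℝ → ℝ} (h : Controls w A) {s t : ℝ} (h0 : 0 ≤ s)
    (h1 : t ≤ 1) :
    eVariationOn A (Icc s t) ≤ ENNReal.ofReal (w t - w s) := by
  refine iSup_le ?_
  rintro ⟨n, u, hu, hmem⟩
  have hb : ∀ i, 0 ≤ u i ∧ u i ≤ 1 := fun i => ⟨h0.trans (hmem i).1, (hmem i).2.trans h1⟩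
  have hw : ∀ i, w (u i) ≤ w (u (i + 1)) := fun i =>
    h.mono (hb i).1 (hu (Nat.le_succ i)) (hb (i + 1)).2
  calc ∑ i ∈ Finset.range n, edist (A (u (i + 1))) (A (u i))
      ≤ ∑ i ∈ Finset.range n, ENNReal.ofReal (w (u (i + 1)) - w (u i)) := by
        refine Finset.sum_le_sum fun i _ => ?_
        rw [edist_dist, Real.dist_eq]
        exact ENNReal.ofReal_le_ofReal (h _ _ (hb i).1 (hu (Nat.le_succ i)) (hb (i + 1)).2)
    _ = ENNReal.ofReal (w (u n) - w (u 0)) := by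
        rw [← ENNReal.ofReal_sum_of_nonneg fun i _ => sub_nonneg.2 (hw i),
          Finset.sum_range_sub (fun i => w (u i))]
    _ ≤ _ := by
        apply ENNReal.ofReal_le_ofReal
        have := h.mono h0 (hmem 0).1 (hb 0).2
        have := h.mono (hb n).1 (hmem n).2 h1
        linarith

lemma Controls.boundedVariationOn {w A : ℝ → ℝ} (h : Controls w A) :
    BoundedVariationOn A (Icc 0 1) :=
  ((eVariationOn_le_of_controls h le_rfl le_rfl).trans_lt ENNReal.ofReal_lt_top).ne

/-- Variation is the least control, so errors measured against it are also errors measured against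
any other control of `A`. -/
lemma Controls.cumVariation {w A : ℝ → ℝ} (h : Controls w A) : Controls w (cumVariation A) := by
  intro s t h0 hst h1
  have hb := h.boundedVariationOn.locallyBoundedVariationOn
  have i0 : (0 : ℝ) ∈ Icc (0 : ℝ) 1 := ⟨le_rfl, zero_le_one⟩
  have is : s ∈ Icc (0 : ℝ) 1 := ⟨h0, hst.trans h1⟩
  have it : t ∈ Icc (0 : ℝ) 1 := ⟨h0.trans hst, h1⟩
  rw [_root_.cumVariation, _root_.cumVariation, variationOnFromTo.sub_right hb i0 it is,
    variationOnFromTo.eq_of_le _ _ hst, ENNReal.abs_toReal]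
  have : Icc (0 : ℝ) 1 ∩ Icc s t = Icc s t := inter_eq_right.2 (Icc_subset_Icc h0 h1)
  rw [this]
  refine ENNReal.toReal_le_of_le_ofReal ?_ (eVariationOn_le_of_controls h h0 h1)
  have := h.mono h0 hst h1; linarith

/-- Jordan decomposition `A = V - (V - A)` into nondecreasing continuous parts, each having
increments `O(dw)`. -/
lemma exists_isIndefIntegral {w A g : ℝ → ℝ} (hA : ContinuousOn A (Icc 0 1)) (hw : Controls w A)
    (hg : ContinuousOn g (Icc 0 1)) : ∃ G, G 0 = 0 ∧ IsIndefIntegral w g A G := by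
  have hcbv : IsCBV A := ⟨hA, hw.boundedVariationOn⟩
  have hlb := hcbv.2.locallyBoundedVariationOn
  have i0 : (0 : ℝ) ∈ Icc (0 : ℝ) 1 := ⟨le_rfl, zero_le_one⟩
  have hVc := hcbv.continuousOn_cumVariation
  obtain ⟨G₁, h₁⟩ := exists_isIndefIntegral_of_monotoneOn
    (M := cumVariation A) (variationOnFromTo.monotoneOn hlb i0) hVc hg
  obtain ⟨G₂, h₂⟩ := exists_isIndefIntegral_of_monotoneOn
    (M := cumVariation A - A) (variationOnFromTo.sub_self_monotoneOn hlb i0) (hVc.sub hA) hg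
  have o₁ : incr (cumVariation A) =O[mesh] incr w := hw.cumVariation.incr_isBigO
  have o₂ : incr (cumVariation A - A) =O[mesh] incr w := by
    refine (o₁.sub hw.incr_isBigO).congr_left fun p => ?_
    simp only [incr, Pi.sub_apply]; ring
  refine ⟨fun t => (G₁ t - G₂ t) - (G₁ 0 - G₂ 0), by simp, ?_⟩
  refine ((IsLittleO.trans_isBigO h₁ o₁).sub (IsLittleO.trans_isBigO h₂ o₂)).congr_left fun p => ?_
  simp only [incr, Pi.sub_apply]; ring

/-! ### Successors and telescoping sums in one partition -/

lemma lt_partSucc_of_exists {P : Finset ℝ} {s : ℝ} (h : ∃ t ∈ P, s < t) :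
    partSucc P s ∈ P ∧ s < partSucc P s ∧ ∀ t ∈ P, s < t → partSucc P s ≤ t := by
  have hne : (P.filter (fun t => s < t)).Nonempty := by
    obtain ⟨t, ht, hst⟩ := h
    exact ⟨t, Finset.mem_filter.2 ⟨ht, hst⟩⟩
  rw [partSucc, dif_pos hne]
  have := Finset.mem_filter.1 (Finset.min'_mem _ hne)
  exact ⟨this.1, this.2, fun t ht hst => Finset.min'_le _ _ (Finset.mem_filter.2 ⟨ht, hst⟩)⟩

lemma partSucc_of_forall_le {P : Finset ℝ} {s : ℝ} (h : ∀ t ∈ P, t ≤ s) : partSucc P s = s := by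
  rw [partSucc, dif_neg]
  rintro ⟨t, ht⟩
  have := Finset.mem_filter.1 ht
  exact absurd this.2 (not_lt.2 (h t this.1))

lemma le_partSucc (P : Finset ℝ) (s : ℝ) : s ≤ partSucc P s := by
  by_cases h : ∃ t ∈ P, s < t
  · exact (lt_partSucc_of_exists h).2.1.le
  · push Not at h
    exact (partSucc_of_forall_le h).ge

lemma partSucc_mem {P : Finset ℝ} {s : ℝ} (hs : s ∈ P) : partSucc P s ∈ P := by
  by_cases h : ∃ t ∈ P, s < t
  · exact (lt_partSucc_of_exists h).1
  · push Not at h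
    rwa [partSucc_of_forall_le h]

/-- The largest partition point below `u` has successor `u`. Peeling it off gives the induction, on
the number of points below `u`. -/
lemma IsPartition.sum_lt {P : Finset ℝ} (hP : IsPartition P) (G : ℝ → ℝ) {u : ℝ} (hu : u ∈ P) :
    ∑ s ∈ P.filter (fun s => s < u), (G (partSucc P s) - G s) = G u - G 0 := by
  induction hn : (P.filter (fun s => s < u)).card using Nat.strong_induction_on generalizing u with
  | _ n ih =>
    rcases (P.filter (fun s => s < u)).eq_empty_or_nonempty with he | hne
    · have : u = 0 := by
        by_contra h0
        have : (0 : ℝ) ∈ P.filter (fun s => s < u) :=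
          Finset.mem_filter.2 ⟨hP.1, lt_of_le_of_ne (hP.2.2 u hu).1 (Ne.symm h0)⟩
        simp [he] at this
      rw [he, this]; simp
    · set v := (P.filter (fun s => s < u)).max' hne with hv
      have hvm := Finset.mem_filter.1 (Finset.max'_mem _ hne)
      rw [← hv] at hvm
      have hmax : ∀ s ∈ P, s < u → s ≤ v := fun s hs hsu =>
        Finset.le_max' _ _ (Finset.mem_filter.2 ⟨hs, hsu⟩)
      have hsucc := lt_partSucc_of_exists ⟨u, hu, hvm.2⟩
      have hvu : partSucc P v = u := by
        refine le_antisymm (hsucc.2.2 u hu hvm.2) ?_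
        by_contra hlt
        push Not at hlt
        exact absurd hsucc.2.1 (not_lt.2 (hmax _ hsucc.1 hlt))
      have hins : P.filter (fun s => s < u) = insert v (P.filter (fun s => s < v)) := by
        ext s
        simp only [Finset.mem_filter, Finset.mem_insert]
        constructor
        · rintro ⟨hs, hsu⟩
          rcases (hmax s hs hsu).eq_or_lt with h | h
          · exact Or.inl h
          · exact Or.inr ⟨hs, h⟩
        · rintro (rfl | ⟨hs, hsv⟩)
          · exact hvm
          · exact ⟨hs, hsv.trans hvm.2⟩
      have hnot : v ∉ P.filter (fun s => s < v) := by simp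
      have hcard : (P.filter (fun s => s < v)).card < n := by
        rw [← hn, hins, Finset.card_insert_of_notMem hnot]; omega
      rw [hins, Finset.sum_insert hnot, ih _ hcard hvm.1 rfl, hvu]; ring

/-- The endpoint of the last partition interval that starts at or before `t`. -/
lemma IsPartition.exists_sum_le {P : Finset ℝ} (hP : IsPartition P) {t : ℝ}
    (ht : t ∈ Icc (0 : ℝ) 1) :
    ∃ v ∈ P, v ≤ t ∧ t ≤ partSucc P v ∧ partSucc P v ≤ 1 ∧ ∀ G : ℝ → ℝ,
      ∑ s ∈ P.filter (fun s => s ≤ t), (G (partSucc P s) - G s) = G (partSucc P v) - G 0 := by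
  have hne : (P.filter (fun s => s ≤ t)).Nonempty := ⟨0, Finset.mem_filter.2 ⟨hP.1, ht.1⟩⟩
  set v := (P.filter (fun s => s ≤ t)).max' hne with hv
  have hvm := Finset.mem_filter.1 (Finset.max'_mem _ hne)
  rw [← hv] at hvm
  have hmax : ∀ s ∈ P, s ≤ t → s ≤ v := fun s hs hsu =>
    Finset.le_max' _ _ (Finset.mem_filter.2 ⟨hs, hsu⟩)
  refine ⟨v, hvm.1, hvm.2, ?_, (hP.2.2 _ (partSucc_mem hvm.1)).2, fun G => ?_⟩
  · by_cases h : ∃ r ∈ P, v < r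
    · have hsucc := lt_partSucc_of_exists h
      by_contra hlt
      push Not at hlt
      exact absurd hsucc.2.1 (not_lt.2 (hmax _ hsucc.1 hlt.le))
    · push Not at h
      rw [partSucc_of_forall_le h]
      exact ht.2.trans (h 1 hP.2.1)
  · have hins : P.filter (fun s => s ≤ t) = insert v (P.filter (fun s => s < v)) := by
      ext s
      simp only [Finset.mem_filter, Finset.mem_insert]
      constructor
      · rintro ⟨hs, hsu⟩
        rcases (hmax s hs hsu).eq_or_lt with h | h
        · exact Or.inl h
        · exact Or.inr ⟨hs, h⟩
      · rintro (rfl | ⟨hs, hsv⟩)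
        · exact hvm
        · exact ⟨hs, hsv.le.trans hvm.2⟩
    have hnot : v ∉ P.filter (fun s => s < v) := by simp
    rw [hins, Finset.sum_insert hnot, hP.sum_lt G hvm.1]; ring

/-- The sum of `R s s'` over the points of the partition up to `t`. -/
noncomputable def partSum (P : Finset ℝ) (R : ℝ × ℝ → ℝ) (t : ℝ) : ℝ :=
  ∑ s ∈ P.filter (fun s => s ≤ t), R (s, partSucc P s)

lemma partSum_add (P : Finset ℝ) (R R' : ℝ × ℝ → ℝ) (t : ℝ) :
    partSum P (fun p => R p + R' p) t = partSum P R t + partSum P R' t :=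
  Finset.sum_add_distrib

lemma partSum_const_mul (P : Finset ℝ) (c : ℝ) (R : ℝ × ℝ → ℝ) (t : ℝ) :
    partSum P (fun p => c * R p) t = c * partSum P R t :=
  (Finset.mul_sum ..).symm

lemma quadVarSum_eq_partSum (P : Finset ℝ) (x : ℝ → ℝ) (t : ℝ) :
    quadVarSum P x t = partSum P (fun p => incr x p ^ 2) t := rfl

lemma partSum_nonneg (P : Finset ℝ) {R : ℝ × ℝ → ℝ} (h : ∀ p, 0 ≤ R p) (t : ℝ) :
    0 ≤ partSum P R t := Finset.sum_nonneg fun _ _ => h _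

lemma partSum_sub_eq_sum (P : Finset ℝ) (R : ℝ × ℝ → ℝ) {s t : ℝ} (hst : s ≤ t) :
    partSum P R t - partSum P R s =
      ∑ r ∈ P.filter (fun r => s < r ∧ r ≤ t), R (r, partSucc P r) := by
  have : P.filter (fun r => r ≤ t) =
      P.filter (fun r => r ≤ s) ∪ P.filter (fun r => s < r ∧ r ≤ t) := by
    ext r
    simp only [Finset.mem_filter, Finset.mem_union]
    constructor
    · rintro ⟨h, h'⟩
      rcases le_or_gt r s with h2 | h2
      · exact Or.inl ⟨h, h2⟩
      · exact Or.inr ⟨h, h2, h'⟩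
    · rintro (⟨h, h'⟩ | ⟨h, _, h'⟩)
      · exact ⟨h, h'.trans hst⟩
      · exact ⟨h, h'⟩
  rw [partSum, this, Finset.sum_union]
  · rw [partSum]; ring
  · rw [Finset.disjoint_left]
    intro r h h'
    exact absurd (Finset.mem_filter.1 h).2 (not_le.2 (Finset.mem_filter.1 h').2.1)

/-! ### Limits of sums along the refining sequence -/

variable {T : ℕ → Finset ℝ}

lemma IsRefining.eventually_forall (hT : IsRefining T) {P : ℝ × ℝ → Prop}
    (hP : ∀ᶠ p in mesh, P p) : ∀ᶠ n in atTop, ∀ s ∈ T n, P (s, partSucc (T n) s) := by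
  obtain ⟨δ, hδ, h⟩ := eventually_mesh_iff.1 hP
  filter_upwards [hT.2.2 δ hδ] with n hn s hs
  exact h _ _ ((hT.1 n).2.2 s hs).1 (le_partSucc _ _) ((hT.1 n).2.2 _ (partSucc_mem hs)).2 (hn s hs)

/-- The sum telescopes to the right end of the last interval started by time `t`; the overshoot
beyond `t` is at most the mesh. -/
lemma IsRefining.tendsto_partSum_incr (hT : IsRefining T) {G : ℝ → ℝ}
    (hG : ContinuousOn G (Icc 0 1)) {t : ℝ} (ht : t ∈ Icc (0 : ℝ) 1) :
    Tendsto (fun n => partSum (T n) (incr G) t) atTop (𝓝 (G t - G 0)) := by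
  choose v hv hvt htv hv1 hsum using fun n => (hT.1 n).exists_sum_le ht
  have e : (fun n => partSum (T n) (incr G) t) = fun n => G (partSucc (T n) (v n)) - G 0 :=
    funext fun n => hsum n G
  rw [e]
  refine Tendsto.sub_const ?_ _
  have hlim : Tendsto (fun n => partSucc (T n) (v n)) atTop (𝓝[Icc 0 1] t) := by
    refine tendsto_nhdsWithin_iff.2 ⟨?_, .of_forall fun n => ⟨ht.1.trans (htv n), hv1 n⟩⟩
    rw [Metric.tendsto_atTop']
    intro ε hε
    obtain ⟨N, hN⟩ := eventually_atTop.1 (hT.2.2 ε hε)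
    refine ⟨N, fun n hn => ?_⟩
    have := hN n hn.le _ (hv n)
    rw [Real.dist_eq, abs_of_nonneg (by linarith [htv n])]
    linarith [hvt n]
  exact (hG t ht).tendsto.comp hlim

lemma IsRefining.partSum_incr_le (hT : IsRefining T) {w : ℝ → ℝ} (hw : Controls w w) (n : ℕ)
    {t : ℝ} (ht : t ∈ Icc (0 : ℝ) 1) : partSum (T n) (incr w) t ≤ w 1 - w 0 := by
  obtain ⟨v, hv, hvt, htv, hv1, hsum⟩ := (hT.1 n).exists_sum_le ht
  have e : partSum (T n) (incr w) t = w (partSucc (T n) v) - w 0 := hsum w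
  rw [e]
  have := hw.mono (ht.1.trans htv) hv1 le_rfl
  linarith

/-- The sums of `dw` are at most `w 1 - w 0` and those of `dx²` are eventually below `Q t + 1`, so a
small multiple of `dw + dx²` has a small sum. -/
lemma HasContinuousQuadVar.tendsto_partSum_zero {x Q : ℝ → ℝ} (hQ : HasContinuousQuadVar T x Q)
    (hT : IsRefining T) {w : ℝ → ℝ} (hw : Controls w w) {R : ℝ × ℝ → ℝ}
    (hR : R =o[mesh] (fun p => incr w p + incr x p ^ 2)) {t : ℝ} (ht : t ∈ Icc (0 : ℝ) 1) :
    Tendsto (fun n => partSum (T n) R t) atTop (𝓝 0) := by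
  rw [Metric.tendsto_nhds]
  intro ε hε
  have hw0 := hw.mono le_rfl zero_le_one le_rfl
  have hQt := hQ.2 t ht
  have hQ0 : 0 ≤ Q t := ge_of_tendsto' hQt fun n =>
    partSum_nonneg (T n) (R := fun p => incr x p ^ 2) (fun p => sq_nonneg _) t
  set C := w 1 - w 0 + (Q t + 1) with hC
  have hCp : 0 < C := by rw [hC]; linarith
  have h1 := hT.eventually_forall ((isLittleO_iff.1 hR (c := ε / (2 * C)) (by positivity)).and
    hw.incr_nonneg)
  filter_upwards [h1, hQt.eventually_lt_const (lt_add_one (Q t))] with n hn hq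
  rw [Real.dist_eq, sub_zero]
  calc |partSum (T n) R t| ≤ ∑ s ∈ (T n).filter (fun s => s ≤ t), |R (s, partSucc (T n) s)| :=
        Finset.abs_sum_le_sum_abs _ _
    _ ≤ partSum (T n) (fun p => ε / (2 * C) * (incr w p + incr x p ^ 2)) t := by
        refine Finset.sum_le_sum fun s hs => ?_
        obtain ⟨a1, a2⟩ := hn s (Finset.mem_filter.1 hs).1
        rwa [Real.norm_eq_abs, Real.norm_eq_abs,
          abs_of_nonneg (add_nonneg a2 (sq_nonneg _))] at a1
    _ = ε / (2 * C) * (partSum (T n) (incr w) t + quadVarSum (T n) x t) := by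
        rw [partSum_const_mul, partSum_add]; rfl
    _ ≤ ε / (2 * C) * C := by
        apply mul_le_mul_of_nonneg_left _ (by positivity)
        have := hT.partSum_incr_le hw n ht
        linarith
    _ < ε := by field_simp; linarith

/-- The approximating sums only gain squares as `t` grows, and monotonicity passes to the limit. -/
lemma HasContinuousQuadVar.controls {x Q : ℝ → ℝ} (hQ : HasContinuousQuadVar T x Q) :
    Controls Q Q := by
  refine controls_self_of_monotoneOn fun s hs t ht hst => ?_
  refine le_of_tendsto_of_tendsto' (hQ.2 s hs) (hQ.2 t ht) fun n => ?_
  have := partSum_sub_eq_sum (T n) (fun p => incr x p ^ 2) hst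
  rw [quadVarSum_eq_partSum, quadVarSum_eq_partSum]
  have h2 : 0 ≤ ∑ r ∈ (T n).filter (fun r => s < r ∧ r ≤ t), incr x (r, partSucc (T n) r) ^ 2 :=
    Finset.sum_nonneg fun _ _ => sq_nonneg _
  linarith

lemma HasContinuousQuadVar.zero {x Q : ℝ → ℝ} (hQ : HasContinuousQuadVar T x Q)
    (hT : IsRefining T) (hx : ContinuousOn x (Icc 0 1)) : Q 0 = 0 := by
  have h0 : (0 : ℝ) ∈ Icc (0 : ℝ) 1 := ⟨le_rfl, zero_le_one⟩
  refine tendsto_nhds_unique (hQ.2 0 h0) ?_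
  have := (hT.tendsto_partSum_incr hx h0).pow 2
  simp only [sub_self, ne_eq, OfNat.ofNat_ne_zero, not_false_eq_true, zero_pow] at this
  refine this.congr fun n => ?_
  have e : (T n).filter (fun s => s ≤ 0) = {0} := by
    ext s
    simp only [Finset.mem_filter, Finset.mem_singleton]
    constructor
    · rintro ⟨h, h'⟩
      exact le_antisymm h' ((hT.1 n).2.2 s h).1
    · rintro rfl
      exact ⟨(hT.1 n).1, le_rfl⟩
  rw [quadVarSum, partSum, e]
  simp [incr]

/-- Weak convergence of the measures `∑ dx²` to `dQ`, proved by hand. On a short interval `γ` is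
frozen at the left end, which costs `ε dQ` once in the sum and once in `Γ`; convergence of the
quadratic variation at the two ends does the rest. The errors are added up by `mesh_induction`. -/
lemma HasContinuousQuadVar.tendsto_partSum_sq {x Q : ℝ → ℝ} (hQ : HasContinuousQuadVar T x Q)
    (hT : IsRefining T) (hx : ContinuousOn x (Icc 0 1)) {γ Γ : ℝ → ℝ}
    (hγ : ContinuousOn γ (Icc 0 1)) (hΓ : IsIndefIntegral Q γ Q Γ) {t : ℝ}
    (ht : t ∈ Icc (0 : ℝ) 1) :
    Tendsto (fun n => partSum (T n) (fun p => γ p.1 * incr x p ^ 2) t) atTop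
      (𝓝 (Γ t - Γ 0)) := by
  set H : ℕ → ℝ → ℝ := fun n => partSum (T n) (fun p => γ p.1 * incr x p ^ 2) with hH
  set q : ℕ → ℝ → ℝ := fun n => quadVarSum (T n) x with hq
  have h0 : (0 : ℝ) ∈ Icc (0 : ℝ) 1 := ⟨le_rfl, zero_le_one⟩
  have hstart : Tendsto (fun n => H n 0) atTop (𝓝 0) := by
    have : Tendsto (fun n => γ 0 * q n 0) atTop (𝓝 0) := by
      simpa [hQ.zero hT hx] using (hQ.2 0 h0).const_mul (γ 0)
    refine this.congr fun n => ?_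
    simp only [hH, hq, quadVarSum_eq_partSum, partSum, Finset.mul_sum]
    refine Finset.sum_congr rfl fun s hs => ?_
    have : s = 0 := le_antisymm (Finset.mem_filter.1 hs).2
      ((hT.1 n).2.2 s (Finset.mem_filter.1 hs).1).1
    rw [this]
  have key : ∀ ε > 0, ∀ η > 0, ∀ᶠ n in atTop,
      |H n t - (Γ t - Γ 0)| ≤ 2 * ε * (Q t - Q 0) + η := by
    intro ε hε
    have hP := (isLittleO_iff.1 (isLittleO_one_incr_iff.2 hγ) hε)
    -- The step over `[s, u]` needs the oscillation of `γ` at every partition point inside it, so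
    -- the predicate carries a whole modulus `δ > u - s` rather than a bound for the single pair.
    have hP2 : ∀ᶠ p in mesh, ∃ δ > p.2 - p.1, ∀ s t, 0 ≤ s → s ≤ t → t ≤ 1 → t - s < δ →
        |γ t - γ s| ≤ ε := by
      obtain ⟨δ, hδ, h⟩ := eventually_mesh_iff.1 hP
      refine eventually_mesh_iff.2 ⟨δ, hδ, fun s t _ _ _ hd => ⟨δ, hd, fun s t h0 hst h1 hd => ?_⟩⟩
      simpa [incr] using h s t h0 hst h1 hd
    refine mesh_induction (hP2.and (isLittleO_iff.1 hΓ hε))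
      (C := fun t => ∀ η > 0, ∀ᶠ n in atTop, |H n t - (Γ t - Γ 0)| ≤ 2 * ε * (Q t - Q 0) + η)
      le_rfl ht.1 ht.2 ?_ ?_
    · intro η hη
      filter_upwards [(Metric.tendsto_nhds.1 hstart) η hη] with n hn
      simp only [sub_self, mul_zero, zero_add, sub_zero]
      rw [Real.dist_eq, sub_zero] at hn
      exact hn.le
    · intro s u hs0 hsu hut hP hs η hη
      obtain ⟨⟨δ, hδ, hγδ⟩, hΓε⟩ := hP
      have hs' : s ∈ Icc (0 : ℝ) 1 := ⟨hs0, (hsu.trans hut).trans ht.2⟩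
      have hu' : u ∈ Icc (0 : ℝ) 1 := ⟨hs0.trans hsu, hut.trans ht.2⟩
      have hdq : Tendsto (fun n => q n u - q n s) atTop (𝓝 (Q u - Q s)) :=
        (hQ.2 u hu').sub (hQ.2 s hs')
      have hlim : Tendsto (fun n => ε * (q n u - q n s) + |γ s| * |(q n u - q n s) - (Q u - Q s)|)
          atTop (𝓝 (ε * (Q u - Q s) + |γ s| * |(Q u - Q s) - (Q u - Q s)|)) :=
        (hdq.const_mul ε).add (((hdq.sub_const _).abs).const_mul _)
      rw [sub_self, abs_zero, mul_zero, add_zero] at hlim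
      filter_upwards [hs (η / 2) (by positivity),
        hlim.eventually_lt_const (show _ < ε * (Q u - Q s) + η / 2 by linarith)] with n hn hl
      have hbound : |(H n u - H n s) - γ s * (q n u - q n s)| ≤ ε * (q n u - q n s) := by
        simp only [hH, hq, quadVarSum_eq_partSum]
        rw [partSum_sub_eq_sum _ _ hsu, partSum_sub_eq_sum _ _ hsu, Finset.mul_sum,
          ← Finset.sum_sub_distrib, Finset.mul_sum]
        refine (Finset.abs_sum_le_sum_abs _ _).trans (Finset.sum_le_sum fun r hr => ?_)
        obtain ⟨hr1, hr2, hr3⟩ := Finset.mem_filter.1 hr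
        rw [← sub_mul, abs_mul, abs_of_nonneg (sq_nonneg (incr x _))]
        refine mul_le_mul_of_nonneg_right ?_ (sq_nonneg _)
        simp only at hδ
        exact hγδ s r hs0 hr2.le (hr3.trans hu'.2) (by linarith)
      have hQm := hQ.controls.mono hs0 hsu hu'.2
      simp only [incr, Real.norm_eq_abs] at hΓε
      rw [abs_of_nonneg (by linarith : 0 ≤ Q u - Q s)] at hΓε
      have hmid : |γ s * (q n u - q n s) - γ s * (Q u - Q s)| =
          |γ s| * |(q n u - q n s) - (Q u - Q s)| := by
        rw [← mul_sub, abs_mul]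
      rw [abs_le] at hn hbound hΓε ⊢
      have hm1 := neg_abs_le (γ s * (q n u - q n s) - γ s * (Q u - Q s))
      have hm2 := le_abs_self (γ s * (q n u - q n s) - γ s * (Q u - Q s))
      rw [hmid] at hm1 hm2
      constructor <;> linarith
  rw [Metric.tendsto_nhds]
  intro ε hε
  have hQ0 := hQ.controls.mono le_rfl ht.1 ht.2
  have := key (ε / (4 * (Q t - Q 0 + 1))) (by have : 0 < Q t - Q 0 + 1 := by linarith
                                              positivity) (ε / 4) (by positivity)
  filter_upwards [this] with n hn
  rw [Real.dist_eq]
  refine hn.trans_lt ?_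
  have h1 : 2 * (ε / (4 * (Q t - Q 0 + 1))) * (Q t - Q 0) ≤ ε / 2 := by
    rw [show 2 * (ε / (4 * (Q t - Q 0 + 1))) * (Q t - Q 0) =
      ε / 2 * ((Q t - Q 0) / (Q t - Q 0 + 1)) by
        have : Q t - Q 0 + 1 ≠ 0 := by linarith
        field_simp; ring]
    have : (Q t - Q 0) / (Q t - Q 0 + 1) ≤ 1 := (div_le_one (by linarith)).2 (by linarith)
    nlinarith
  linarith

/-- The pathwise Itô formula in incremental form: an expansion of the increments of `z` yields the
Föllmer integral of its leading coefficient. -/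
lemma HasContinuousQuadVar.hasFollmerIntegral {x Q : ℝ → ℝ} (hQ : HasContinuousQuadVar T x Q)
    (hT : IsRefining T) (hx : ContinuousOn x (Icc 0 1)) {w : ℝ → ℝ} (hw : Controls w w)
    {z α γ Γ C : ℝ → ℝ} (hz : ContinuousOn z (Icc 0 1)) (hγ : ContinuousOn γ (Icc 0 1))
    (hC : ContinuousOn C (Icc 0 1)) (hΓ : IsIndefIntegral Q γ Q Γ)
    (h : (fun p : ℝ × ℝ => incr z p -
      (α p.1 * incr x p + 1 / 2 * (γ p.1 * incr x p ^ 2) + incr C p)) =o[mesh]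
      (fun p => incr w p + incr x p ^ 2)) {t : ℝ} (ht : t ∈ Icc (0 : ℝ) 1) :
    HasFollmerIntegral T α x t (z t - z 0 - 1 / 2 * (Γ t - Γ 0) - (C t - C 0)) := by
  have h1 := hQ.tendsto_partSum_zero hT hw h ht
  have h2 := hT.tendsto_partSum_incr hz ht
  have h3 := hT.tendsto_partSum_incr hC ht
  have h4 := hQ.tendsto_partSum_sq hT hx hγ hΓ ht
  have h5 := ((h2.sub (h4.const_mul (1 / 2))).sub h3).sub h1
  rw [sub_zero] at h5
  refine h5.congr fun n => ?_
  simp only [partSum, Finset.mul_sum, ← Finset.sum_sub_distrib]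
  refine Finset.sum_congr rfl fun s _ => ?_
  simp only [incr]; ring

lemma HasFollmerIntegral.unique {η x : ℝ → ℝ} {t J J' : ℝ} (h : HasFollmerIntegral T η x t J)
    (h' : HasFollmerIntegral T η x t J') : J = J' := tendsto_nhds_unique h h'

/-! ### Second-order Taylor expansion along a path -/

lemma eventually_mesh_dist_lt {E : Type*} [PseudoMetricSpace E] {y : ℝ → E}
    (hy : ContinuousOn y (Icc 0 1)) {δ : ℝ} (hδ : 0 < δ) :
    ∀ᶠ p in mesh, dist (y p.2) (y p.1) < δ := by
  have hu := isCompact_Icc.uniformContinuousOn_of_continuous hy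
  rw [Metric.uniformContinuousOn_iff] at hu
  obtain ⟨η, hη, H⟩ := hu δ hδ
  refine eventually_mesh_iff.2 ⟨η, hη, fun s t h0 hst h1 hd => ?_⟩
  exact H t ⟨h0.trans hst, h1⟩ s ⟨h0, hst.trans h1⟩
    (by rw [Real.dist_eq, abs_of_nonneg (by linarith)]; exact hd)

/-- Uniform continuity reaching beyond `K`: intermediate points of Taylor's formula lie near the
path but not on it, and must stay in `U`. -/
lemma IsCompact.exists_ball_dist_lt {E F : Type*} [PseudoMetricSpace E] [PseudoMetricSpace F]
    {K U : Set E} (hK : IsCompact K) (hU : IsOpen U) (hKU : K ⊆ U) {g : E → F}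
    (hg : ContinuousOn g U) {ε : ℝ} (hε : 0 < ε) :
    ∃ δ > 0, ∀ p ∈ K, ∀ q ∈ Metric.ball p δ, q ∈ U ∧ dist (g q) (g p) < ε := by
  obtain ⟨δ₁, hδ₁, h₁⟩ := hK.exists_thickening_subset_open hU hKU
  have h := hK.uniformContinuousAt_of_continuousAt g
    (fun a ha => (hg a (hKU ha)).continuousAt (hU.mem_nhds (hKU ha)))
    (Metric.dist_mem_uniformity hε)
  obtain ⟨δ₂, hδ₂, h₂⟩ := Metric.mem_uniformity_dist.1 h
  refine ⟨min δ₁ δ₂, lt_min hδ₁ hδ₂, fun p hp q hq => ⟨h₁ ?_, ?_⟩⟩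
  · exact Metric.mem_thickening_iff.2 ⟨p, hp, (Metric.mem_ball.1 hq).trans_le (min_le_left _ _)⟩
  · rw [dist_comm]
    refine h₂ ?_ hp
    rw [dist_comm]; exact (Metric.mem_ball.1 hq).trans_le (min_le_right _ _)

/-- The mean value inequality applied twice: first to `g₁` minus its linear part, then to `g` minus
its quadratic polynomial. -/
lemma abs_sub_taylor_two_le {g g₁ g₂ : ℝ → ℝ} {x x' ε : ℝ}
    (h₁ : ∀ ξ ∈ uIcc x x', HasDerivAt g (g₁ ξ) ξ) (h₂ : ∀ ξ ∈ uIcc x x', HasDerivAt g₁ (g₂ ξ) ξ)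
    (hε : ∀ ξ ∈ uIcc x x', |g₂ ξ - g₂ x| ≤ ε) :
    |g x' - g x - (g₁ x * (x' - x) + 1 / 2 * (g₂ x * (x' - x) ^ 2))| ≤ ε * (x' - x) ^ 2 := by
  have hε0 : 0 ≤ ε := (abs_nonneg _).trans (hε x left_mem_uIcc)
  have hconv : Convex ℝ (uIcc x x') := convex_uIcc _ _
  have e1 : ∀ ξ ∈ uIcc x x', |g₁ ξ - g₁ x - g₂ x * (ξ - x)| ≤ ε * |ξ - x| := by
    intro ξ hξ
    have := hconv.norm_image_sub_le_of_norm_hasDerivWithin_le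
      (f := fun η => g₁ η - g₂ x * η) (f' := fun η => g₂ η - g₂ x * 1) (C := ε)
      (fun η hη => ((h₂ η hη).sub ((hasDerivAt_id η).const_mul (g₂ x))).hasDerivWithinAt)
      (fun η hη => by simpa using hε η hη) left_mem_uIcc hξ
    simp only [Real.norm_eq_abs] at this
    convert this using 2
    ring
  have := hconv.norm_image_sub_le_of_norm_hasDerivWithin_le
    (f := fun η => g η - (g₁ x * (η - x) + 1 / 2 * (g₂ x * (η - x) ^ 2)))
    (f' := fun η => g₁ η - (g₁ x * 1 + 1 / 2 * (g₂ x * (2 * (η - x) ^ (2 - 1) * 1))))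
    (C := ε * |x' - x|)
    (fun η hη => ((h₁ η hη).sub ((((hasDerivAt_id η).sub_const x).const_mul (g₁ x)).add
      (((((hasDerivAt_id η).sub_const x).pow 2).const_mul (g₂ x)).const_mul
        (1 / 2)))).hasDerivWithinAt)
    (fun η hη => by
      have hle : |η - x| ≤ |x' - x| := abs_sub_left_of_mem_uIcc hη
      refine le_trans ?_ ((e1 η hη).trans (mul_le_mul_of_nonneg_left hle hε0))
      rw [Real.norm_eq_abs]
      apply le_of_eq
      congr 1
      simp; ring) left_mem_uIcc right_mem_uIcc
  simp only [Real.norm_eq_abs, mul_assoc, abs_mul_abs_self] at this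
  rw [← sq] at this
  convert this using 2
  ring

section Taylor

variable {k : ℕ} {A : ℝ → Fin k → ℝ} {U : Set ((Fin k → ℝ) × ℝ)} {f : (Fin k → ℝ) × ℝ → ℝ}
  {x w : ℝ → ℝ}

lemma continuousOn_path (hA : ∀ i, ContinuousOn (fun t => A t i) (Icc 0 1))
    (hx : ContinuousOn x (Icc 0 1)) : ContinuousOn (fun t => (A t, x t)) (Icc 0 1) :=
  (continuousOn_pi.2 hA).prodMk hx

lemma continuousOn_fderiv_path (hA : ∀ i, ContinuousOn (fun t => A t i) (Icc 0 1))
    (hx : ContinuousOn x (Icc 0 1)) (hU : IsOpen U) (hAU : ∀ t ∈ Icc (0 : ℝ) 1, (A t, x t) ∈ U)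
    (hf : ContDiffOn ℝ 1 f U) (v : (Fin k → ℝ) × ℝ) :
    ContinuousOn (fun t => fderiv ℝ f (A t, x t) v) (Icc 0 1) :=
  ((hf.continuousOn_fderiv_of_isOpen hU le_rfl).comp (continuousOn_path hA hx) hAU).clm_apply
    continuousOn_const

/-- Second order expansion of `t ↦ f (A t, x t)` for `f` of class `C^{1,2}`. -/
lemma incr_comp_isLittleO
    (hA' : ∀ i, incr (fun t => A t i) =O[mesh] (fun p => incr w p + incr x p ^ 2))
    (hw : Controls w w)
    (hA : ∀ i, ContinuousOn (fun t => A t i) (Icc 0 1))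
    (hx : ContinuousOn x (Icc 0 1)) (hU : IsOpen U) (hAU : ∀ t ∈ Icc (0 : ℝ) 1, (A t, x t) ∈ U)
    (hf : ContDiffOn ℝ 1 f U)
    (hf₂ : ∀ a, ContDiffOn ℝ 2 (fun ξ => f (a, ξ)) {ξ | (a, ξ) ∈ U})
    (hf₃ : ContinuousOn (fun q : (Fin k → ℝ) × ℝ => iteratedDeriv 2 (fun ξ => f (q.1, ξ)) q.2) U) :
    (fun p : ℝ × ℝ => incr (fun t => f (A t, x t)) p -
      (deriv (fun ξ => f (A p.1, ξ)) (x p.1) * incr x p +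
        1 / 2 * (iteratedDeriv 2 (fun ξ => f (A p.1, ξ)) (x p.1) * incr x p ^ 2) +
        ∑ i, fderiv ℝ f (A p.1, x p.1) (Pi.single i 1, 0) * incr (fun t => A t i) p)) =o[mesh]
      (fun p => incr w p + incr x p ^ 2) := by
  have hy := continuousOn_path hA hx
  have hK := isCompact_Icc.image_of_continuousOn hy
  have hKU : (fun t => (A t, x t)) '' Icc 0 1 ⊆ U := by rintro _ ⟨t, ht, rfl⟩; exact hAU t ht
  -- Increments of order `dw + dx²` suffice. In the uniqueness argument one component is the
  -- pulled-back `B`, whose bounded variation is not yet known.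
  have hAO : (fun p : ℝ × ℝ => A p.2 - A p.1) =O[mesh] (fun p => incr w p + incr x p ^ 2) :=
    isBigO_pi.2 hA'
  obtain ⟨M, hM, hAM⟩ := hAO.exists_pos
  rw [isLittleO_iff]
  intro ε hε
  obtain ⟨δ₁, hδ₁, H₁⟩ := hK.exists_ball_dist_lt hU hKU
    (hf.continuousOn_fderiv_of_isOpen hU le_rfl) (show 0 < ε / (2 * M) by positivity)
  obtain ⟨δ₂, hδ₂, H₂⟩ := hK.exists_ball_dist_lt hU hKU hf₃ (half_pos hε)
  filter_upwards [eventually_mesh_dist_lt hy (lt_min hδ₁ hδ₂), eventually_mesh_mem, hAM.bound]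
  rintro ⟨s, t⟩ hd ⟨h0, hst, h1⟩ hAn
  simp only at hd h0 hst h1 hAn
  have hs : s ∈ Icc (0 : ℝ) 1 := ⟨h0, hst.trans h1⟩
  have hys : (A s, x s) ∈ (fun t => (A t, x t)) '' Icc 0 1 := ⟨s, hs, rfl⟩
  have hd₁ := hd.trans_le (min_le_left _ _)
  have hd₂ := hd.trans_le (min_le_right _ _)
  have hwst := hw.mono h0 hst h1
  simp only [incr] at hAn
  rw [Real.norm_eq_abs (_ + _), abs_of_nonneg (add_nonneg (by linarith) (sq_nonneg _))] at hAn
  -- The increment is split at `(A s, x t)`: `A` moves with `x` at its final value, where first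
  -- derivatives suffice, and `x` moves with `A` frozen, where two derivatives are available.
  have part₁ : |f (A t, x t) - f (A s, x t) - fderiv ℝ f (A s, x s) (A t - A s, 0)| ≤
      ε / 2 * (w t - w s + (x t - x s) ^ 2) := by
    have hmem : (A s, x t) ∈ Metric.ball (A s, x s) δ₁ := by
      rw [Metric.mem_ball, Prod.dist_eq] at *
      simp only [dist_self, max_lt_iff] at *
      exact ⟨hδ₁, hd₁.2⟩
    have := (convex_ball (A s, x s) δ₁).norm_image_sub_le_of_norm_hasFDerivWithin_le' (𝕜 := ℝ)
      (f := f) (f' := fderiv ℝ f) (φ := fderiv ℝ f (A s, x s)) (C := ε / (2 * M))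
      (fun q hq => (((hf.contDiffAt (hU.mem_nhds (H₁ _ hys q hq).1)).differentiableAt
        one_ne_zero).hasFDerivAt).hasFDerivWithinAt)
      (fun q hq => by rw [← dist_eq_norm]; exact (H₁ _ hys q hq).2.le) hmem
      (Metric.mem_ball.2 hd₁)
    rw [Prod.mk_sub_mk, sub_self] at this
    have e : ‖((A t - A s, 0) : (Fin k → ℝ) × ℝ)‖ = ‖A t - A s‖ := by simp [Prod.norm_def]
    rw [e] at this
    refine this.trans ((mul_le_mul_of_nonneg_left hAn (by positivity)).trans_eq ?_)
    field_simp
  have part₂ := by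
    refine abs_sub_taylor_two_le (g := fun ξ => f (A s, ξ)) (g₁ := deriv fun ξ => f (A s, ξ))
      (g₂ := iteratedDeriv 2 fun ξ => f (A s, ξ)) (x := x s) (x' := x t) (ε := ε / 2) ?_ ?_ ?_
    all_goals
      intro ξ hξ
      have hξd : |ξ - x s| ≤ |x t - x s| := abs_sub_left_of_mem_uIcc hξ
      have hball : (A s, ξ) ∈ Metric.ball (A s, x s) δ₂ := by
        rw [Metric.mem_ball, Prod.dist_eq] at *
        simp only [dist_self, max_lt_iff] at *
        exact ⟨hδ₂, by rw [Real.dist_eq]; rw [Real.dist_eq] at hd₂; exact hξd.trans_lt hd₂.2⟩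
      obtain ⟨hξU, hξε⟩ := H₂ _ hys _ hball
      have hO : IsOpen {ξ | (A s, ξ) ∈ U} := hU.preimage (by fun_prop)
    · exact (((hf₂ (A s)).contDiffAt (hO.mem_nhds hξU)).differentiableAt two_ne_zero).hasDerivAt
    · have h1 : ContDiffOn ℝ 1 (deriv fun ξ => f (A s, ξ)) {ξ | (A s, ξ) ∈ U} :=
        (hf₂ (A s)).deriv_of_isOpen hO (by norm_num)
      have := ((h1.contDiffAt (hO.mem_nhds hξU)).differentiableAt one_ne_zero).hasDerivAt
      rwa [iteratedDeriv_succ, iteratedDeriv_one]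
    · rw [Real.dist_eq] at hξε
      exact hξε.le
  have hlin : fderiv ℝ f (A s, x s) (A t - A s, 0) =
      ∑ i, fderiv ℝ f (A s, x s) (Pi.single i 1, 0) * (A t i - A s i) := by
    have : ((A t - A s, 0) : (Fin k → ℝ) × ℝ) =
        ∑ i, (A t i - A s i) • ((Pi.single i 1, 0) : (Fin k → ℝ) × ℝ) := by
      ext j
      · simp [Prod.fst_sum, Finset.sum_apply, Pi.single_apply]
      · simp [Prod.snd_sum]
    rw [this, map_sum]
    refine Finset.sum_congr rfl fun i _ => ?_
    rw [map_smul, smul_eq_mul, mul_comm]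
  simp only [incr]
  rw [← hlin, Real.norm_eq_abs, Real.norm_eq_abs,
    abs_of_nonneg (add_nonneg (by linarith) (sq_nonneg (x t - x s)))]
  rw [abs_le] at part₁ part₂ ⊢
  have hwn : 0 ≤ ε * (w t - w s) := mul_nonneg hε.le (by linarith)
  constructor <;> linarith

end Taylor

/-! ### Grönwall's inequality and Stieltjes differential equations -/

/-- Grönwall's inequality in incremental form. -/
lemma gronwall_of_incr_le {D w : ℝ → ℝ} {L c : ℝ} (hc : 0 ≤ c)
    (h : ∀ ε > 0, ∀ᶠ p in mesh, |incr D p| ≤ L * (|D p.1| + c + ε) * incr w p) {t : ℝ}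
    (ht : t ∈ Icc (0 : ℝ) 1) : |D t| + c ≤ (|D 0| + c) * Real.exp (L * (w t - w 0)) := by
  -- Adding `ε` to the quantity being estimated absorbs the infinitesimal error of the hypothesis;
  -- it tends to zero at the end.
  have key : ∀ ε > 0, |D t| + c + ε ≤ (|D 0| + c + ε) * Real.exp (L * (w t - w 0)) := by
    intro ε hε
    refine mesh_induction (h ε hε)
      (C := fun t => |D t| + c + ε ≤ (|D 0| + c + ε) * Real.exp (L * (w t - w 0)))
      le_rfl ht.1 ht.2 (by simp) ?_
    intro s u _ _ _ hP hs
    simp only [incr] at hP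
    have h1 : |D u| ≤ |D s| + |D u - D s| := by
      have := abs_add_le (D s) (D u - D s); rwa [add_sub_cancel] at this
    have h2 : 1 + L * (w u - w s) ≤ Real.exp (L * (w u - w s)) := by
      have := Real.add_one_le_exp (L * (w u - w s)); linarith
    have h3 : 0 ≤ |D s| + c + ε := by positivity
    calc |D u| + c + ε ≤ (|D s| + c + ε) * (1 + L * (w u - w s)) := by nlinarith
      _ ≤ (|D s| + c + ε) * Real.exp (L * (w u - w s)) := mul_le_mul_of_nonneg_left h2 h3
      _ ≤ ((|D 0| + c + ε) * Real.exp (L * (w s - w 0))) * Real.exp (L * (w u - w s)) :=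
        mul_le_mul_of_nonneg_right hs (Real.exp_pos _).le
      _ = _ := by rw [mul_assoc, ← Real.exp_add]; ring_nf
  refine le_of_forall_pos_le_add fun η hη => ?_
  have he := Real.exp_pos (L * (w t - w 0))
  have := key (η / Real.exp (L * (w t - w 0))) (by positivity)
  have e : (|D 0| + c + η / Real.exp (L * (w t - w 0))) * Real.exp (L * (w t - w 0)) =
    (|D 0| + c) * Real.exp (L * (w t - w 0)) + η := by field_simp
  rw [e] at this
  have : 0 < η / Real.exp (L * (w t - w 0)) := by positivity
  linarith

section StieltjesEquation

variable {k : ℕ} {w : ℝ → ℝ} {A : Fin k → ℝ → ℝ} {β : Fin k → ℝ → ℝ → ℝ} {z₀ : ℝ}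

/-- `B` solves `dB = ∑ i, β i (t, B) dA i`, `B 0 = z₀`, in incremental form. -/
def SolvesStieltjes (w : ℝ → ℝ) (A : Fin k → ℝ → ℝ) (β : Fin k → ℝ → ℝ → ℝ) (z₀ : ℝ)
    (B : ℝ → ℝ) : Prop :=
  ContinuousOn B (Icc 0 1) ∧ B 0 = z₀ ∧
    (fun p : ℝ × ℝ => incr B p - ∑ i, β i p.1 (B p.1) * incr (A i) p) =o[mesh] incr w

lemma continuousOn_coeff {β : ℝ → ℝ → ℝ} {B : ℝ → ℝ}
    (hβ : ContinuousOn (fun q : ℝ × ℝ => β q.1 q.2) (Icc (0 : ℝ) 1 ×ˢ univ))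
    (hB : ContinuousOn B (Icc 0 1)) : ContinuousOn (fun s => β s (B s)) (Icc 0 1) :=
  hβ.comp (continuousOn_id.prodMk hB) fun _ hs => ⟨hs, mem_univ _⟩

lemma abs_sum_mul_incr_le (hA : ∀ i, Controls w (A i)) {c : Fin k → ℝ} {M : ℝ}
    (hc : ∀ i, |c i| ≤ M) {p : ℝ × ℝ} (hp : 0 ≤ p.1 ∧ p.1 ≤ p.2 ∧ p.2 ≤ 1) :
    |∑ i, c i * incr (A i) p| ≤ k * M * incr w p := by
  calc |∑ i, c i * incr (A i) p| ≤ ∑ i, |c i * incr (A i) p| := Finset.abs_sum_le_sum_abs _ _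
    _ ≤ ∑ _i : Fin k, M * incr w p := Finset.sum_le_sum fun i _ => by
        rw [abs_mul]
        exact mul_le_mul (hc i) (hA i _ _ hp.1 hp.2.1 hp.2.2) (abs_nonneg _)
          ((abs_nonneg _).trans (hc i))
    _ = k * M * incr w p := by simp; ring

lemma IsLittleO.eventually_abs_le {R : ℝ × ℝ → ℝ} (hw : Controls w w) (h : R =o[mesh] incr w)
    {ε : ℝ} (hε : 0 < ε) : ∀ᶠ p in mesh, |R p| ≤ ε * incr w p := by
  filter_upwards [isLittleO_iff.1 h hε, hw.incr_nonneg] with p hp hn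
  rwa [Real.norm_eq_abs, Real.norm_eq_abs, abs_of_nonneg hn] at hp

/-- The coefficients are bounded along the continuous `B`, so `dB` is at most a multiple of `dw` up
to an error that telescopes away. -/
lemma SolvesStieltjes.isCBV (hw : Controls w w) (hA : ∀ i, Controls w (A i))
    (hβ : ∀ i, ContinuousOn (fun q : ℝ × ℝ => β i q.1 q.2) (Icc (0 : ℝ) 1 ×ˢ univ)) {B : ℝ → ℝ}
    (hB : SolvesStieltjes w A β z₀ B) : ∃ M, Controls (fun t => M * w t) B := by
  choose M hM using fun i => isCompact_Icc.exists_bound_of_continuousOn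
    (continuousOn_coeff (hβ i) hB.1)
  have hM0 : ∀ i, 0 ≤ M i := fun i => (norm_nonneg _).trans (hM i 0 ⟨le_rfl, zero_le_one⟩)
  refine ⟨k * ∑ i, M i, Controls.of_isLittleO hw ⟨_, hB.2.2, ?_⟩⟩
  filter_upwards [eventually_mesh_mem] with p hp
  have h1 := abs_sum_mul_incr_le hA (c := fun i => β i p.1 (B p.1)) (M := ∑ i, M i) (fun i =>
    (hM i p.1 ⟨hp.1, hp.2.1.trans hp.2.2⟩).trans
      (Finset.single_le_sum (fun j _ => hM0 j) (Finset.mem_univ i))) hp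
  have h2 := abs_add_le (∑ i, β i p.1 (B p.1) * incr (A i) p)
    (incr B p - ∑ i, β i p.1 (B p.1) * incr (A i) p)
  rw [add_sub_cancel] at h2
  have h3 : incr (fun t => (k * ∑ i, M i) * w t) p = k * (∑ i, M i) * incr w p := by
    simp only [incr]; ring
  rw [h3]
  linarith

lemma SolvesStieltjes.eqOn (hw : Controls w w) (hA : ∀ i, Controls w (A i))
    (hL : ∀ i, LocalLipschitzCond (β i)) {B B' : ℝ → ℝ} (hB : SolvesStieltjes w A β z₀ B)
    (hB' : SolvesStieltjes w A β z₀ B') : EqOn B' B (Icc 0 1) := by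
  obtain ⟨p₁, hp₁⟩ := isCompact_Icc.exists_bound_of_continuousOn hB.1
  obtain ⟨p₂, hp₂⟩ := isCompact_Icc.exists_bound_of_continuousOn hB'.1
  set r := max (max p₁ p₂) 1 with hr
  have hr1 : ∀ t ∈ Icc (0 : ℝ) 1, B t ∈ Icc (-r) r := fun t ht => abs_le.1
    ((hp₁ t ht).trans ((le_max_left _ _).trans (le_max_left _ _)))
  have hr2 : ∀ t ∈ Icc (0 : ℝ) 1, B' t ∈ Icc (-r) r := fun t ht => abs_le.1
    ((hp₂ t ht).trans ((le_max_right _ _).trans (le_max_left _ _)))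
  choose L hL0 hL using fun i => hL i r (one_pos.trans_le (le_max_right _ _))
  have hLi : ∀ i, L i ≤ ∑ j, L j := fun i =>
    Finset.single_le_sum (fun j _ => hL0 j) (Finset.mem_univ i)
  have hLs : 0 ≤ ∑ j, L j := Finset.sum_nonneg fun j _ => hL0 j
  intro t ht
  -- The `+ 1` makes room for the two `o(dw)` errors, jointly at most `ε dw`.
  have := gronwall_of_incr_le (D := fun t => B' t - B t) (w := w) (L := k * (∑ j, L j) + 1)
    (c := 0) le_rfl (fun ε hε => ?_) ht
  · simp only [add_zero, hB.2.1, hB'.2.1, sub_self, abs_zero, zero_mul, abs_nonpos_iff] at this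
    linarith
  · filter_upwards [eventually_mesh_mem, hw.incr_nonneg,
      IsLittleO.eventually_abs_le hw (IsLittleO.sub hB'.2.2 hB.2.2) hε] with p hp hwp ho
    have hp1 : p.1 ∈ Icc (0 : ℝ) 1 := ⟨hp.1, hp.2.1.trans hp.2.2⟩
    have h1 := abs_sum_mul_incr_le hA (c := fun i => β i p.1 (B' p.1) - β i p.1 (B p.1))
      (M := (∑ j, L j) * |B' p.1 - B p.1|) (fun i =>
      (hL i p.1 hp1 _ (hr2 _ hp1) _ (hr1 _ hp1)).trans
        (mul_le_mul_of_nonneg_right (hLi i) (abs_nonneg _))) hp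
    have e : incr (fun t => B' t - B t) p =
        (∑ i, (β i p.1 (B' p.1) - β i p.1 (B p.1)) * incr (A i) p) +
        (incr B' p - ∑ i, β i p.1 (B' p.1) * incr (A i) p -
          (incr B p - ∑ i, β i p.1 (B p.1) * incr (A i) p)) := by
      simp only [sub_mul, Finset.sum_sub_distrib]
      simp only [incr]; ring
    rw [e]
    refine (abs_add_le _ _).trans ?_
    have : 0 ≤ |B' p.1 - B p.1| * incr w p := by positivity
    have : 0 ≤ k * (∑ j, L j) * ε * incr w p := by positivity
    nlinarith

/-- Picard iteration with distances weighted by `exp (l w)`. One step halves the weighted distance,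
hence some iterate contracts the sup norm, and its fixed point is fixed by the Picard map itself. -/
lemma exists_solvesStieltjes_of_lipschitz (hw : Controls w w) (hA : ∀ i, Controls w (A i))
    (hAc : ∀ i, ContinuousOn (A i) (Icc 0 1))
    (hβ : ∀ i, ContinuousOn (fun q : ℝ × ℝ => β i q.1 q.2) (Icc (0 : ℝ) 1 ×ˢ univ)) {L : ℝ}
    (hL0 : 0 ≤ L) (hL : ∀ i, ∀ t ∈ Icc (0 : ℝ) 1, ∀ y y', |β i t y - β i t y'| ≤ L * |y - y'|)
    (z₀ : ℝ) : ∃ B, SolvesStieltjes w A β z₀ B := by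
  let ext : C(Icc (0 : ℝ) 1, ℝ) → ℝ → ℝ := fun B t => B (projIcc 0 1 zero_le_one t)
  have hext : ∀ B, Continuous (ext B) := fun B => B.continuous.comp continuous_projIcc
  choose G hG0 hG using fun (B : C(Icc (0 : ℝ) 1, ℝ)) (i : Fin k) =>
    exists_isIndefIntegral (hAc i) (hA i) (continuousOn_coeff (hβ i) (hext B).continuousOn)
  have hGc : ∀ B i, ContinuousOn (G B i) (Icc 0 1) := fun B i =>
    (hG B i).continuousOn hw (continuousOn_coeff (hβ i) (hext B).continuousOn) (hAc i)
  let S : C(Icc (0 : ℝ) 1, ℝ) → ℝ → ℝ := fun B t => z₀ + ∑ i, G B i t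
  have hSc : ∀ B, ContinuousOn (S B) (Icc 0 1) := fun B =>
    continuousOn_const.add (continuousOn_finsetSum _ fun i _ => hGc B i)
  let Φ : C(Icc (0 : ℝ) 1, ℝ) → C(Icc (0 : ℝ) 1, ℝ) := fun B =>
    ⟨fun t => S B t, continuousOn_iff_continuous_domRestrict.1 (hSc B)⟩
  have hS : ∀ B, (fun p : ℝ × ℝ => incr (S B) p - ∑ i, β i p.1 (ext B p.1) * incr (A i) p)
      =o[mesh] incr w := fun B => by
    have := IsLittleO.sum (s := Finset.univ) fun i _ => hG B i
    refine this.congr_left fun p => ?_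
    rw [Finset.sum_apply, Finset.sum_sub_distrib]
    simp only [incr, S, Finset.sum_sub_distrib]; ring
  have hextm : ∀ B : C(Icc (0 : ℝ) 1, ℝ), ∀ t (ht : t ∈ Icc (0 : ℝ) 1), ext B t = B ⟨t, ht⟩ :=
    fun B t ht => by simp only [ext, projIcc_of_mem zero_le_one ht]
  -- Chosen so that `k L ≤ l / 2`: since `exp(l w) l dw ≤ d(exp(l w))`, the integrated difference is
  -- at most half the previous weight.
  set l := 2 * (k * L) + 1 with hl
  have hkL : 0 ≤ k * L := by positivity
  have hlp : 0 < l := by linarith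
  have step : ∀ B B' : C(Icc (0 : ℝ) 1, ℝ), ∀ m ≥ 0,
      (∀ t : Icc (0 : ℝ) 1, |B t - B' t| ≤ m * Real.exp (l * w t)) →
      ∀ t : Icc (0 : ℝ) 1, |Φ B t - Φ B' t| ≤ (1 / 2 * m) * Real.exp (l * w t) := by
    intro B B' m hm h t
    have hc : Controls (fun t => (1 / 2 * m) * Real.exp (l * w t)) (fun t => S B t - S B' t) := by
      refine Controls.of_isLittleO hw ⟨_, (hS B).sub (hS B'), ?_⟩
      filter_upwards [eventually_mesh_mem, hw.incr_nonneg] with p hp hwp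
      have hp1 : p.1 ∈ Icc (0 : ℝ) 1 := ⟨hp.1, hp.2.1.trans hp.2.2⟩
      have h1 := abs_sum_mul_incr_le hA (c := fun i => β i p.1 (ext B p.1) - β i p.1 (ext B' p.1))
        (M := L * (m * Real.exp (l * w p.1))) (fun i => (hL i p.1 hp1 _ _).trans
          (mul_le_mul_of_nonneg_left (by rw [hextm _ _ hp1, hextm _ _ hp1]; exact h _) hL0)) hp
      have e : incr (fun t => S B t - S B' t) p =
          (∑ i, (β i p.1 (ext B p.1) - β i p.1 (ext B' p.1)) * incr (A i) p) +
          (incr (S B) p - ∑ i, β i p.1 (ext B p.1) * incr (A i) p -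
            (incr (S B') p - ∑ i, β i p.1 (ext B' p.1) * incr (A i) p)) := by
        simp only [sub_mul, Finset.sum_sub_distrib]
        simp only [incr]; ring
      rw [e]
      refine (abs_add_le _ _).trans (add_le_add (h1.trans ?_) le_rfl)
      have h2 : Real.exp (l * w p.1) * (l * incr w p) ≤
          Real.exp (l * w p.2) - Real.exp (l * w p.1) := by
        have h3 := Real.add_one_le_exp (l * incr w p)
        have h4 : Real.exp (l * w p.2) = Real.exp (l * w p.1) * Real.exp (l * incr w p) := by
          rw [← Real.exp_add]; simp only [incr]; ring_nf
        rw [h4]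
        nlinarith [Real.exp_pos (l * w p.1)]
      have h5 : incr (fun t => 1 / 2 * m * Real.exp (l * w t)) p =
          1 / 2 * m * (Real.exp (l * w p.2) - Real.exp (l * w p.1)) := by
        simp only [incr]; ring
      rw [h5]
      refine le_trans ?_ (mul_le_mul_of_nonneg_left h2 (by positivity))
      have h6 : 0 ≤ m * Real.exp (l * w p.1) * incr w p := by positivity
      have h7 : 1 / 2 * m * (Real.exp (l * w p.1) * (l * incr w p)) =
        (1 / 2 * l) * (m * Real.exp (l * w p.1) * incr w p) := by ring
      have h8 : k * (L * (m * Real.exp (l * w p.1))) * incr w p =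
        (k * L) * (m * Real.exp (l * w p.1) * incr w p) := by ring
      rw [h7, h8]
      exact mul_le_mul_of_nonneg_right (by rw [hl]; linarith) h6
    have : |S B t - S B' t - (S B 0 - S B' 0)| ≤ 1 / 2 * m * Real.exp (l * w t) -
        1 / 2 * m * Real.exp (l * w 0) := hc 0 t le_rfl t.2.1 t.2.2
    have hz : S B 0 - S B' 0 = 0 := by simp [S, hG0]
    rw [hz, sub_zero] at this
    refine this.trans ?_
    have := Real.exp_pos (l * w 0)
    have : 0 ≤ 1 / 2 * m * Real.exp (l * w 0) := by positivity
    linarith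
  have iter : ∀ n : ℕ, ∀ B B' : C(Icc (0 : ℝ) 1, ℝ), ∀ t : Icc (0 : ℝ) 1,
      |Φ^[n] B t - Φ^[n] B' t| ≤
        ((1 / 2) ^ n * (dist B B' * Real.exp (-(l * w 0)))) * Real.exp (l * w t) := by
    intro n B B'
    induction n with
    | zero =>
      intro t
      simp only [Function.iterate_zero, id, pow_zero, one_mul]
      rw [mul_assoc, ← Real.exp_add]
      have h1 : |B t - B' t| ≤ dist B B' := by
        rw [← Real.dist_eq]; exact ContinuousMap.dist_apply_le_dist t
      have h2 : 1 ≤ Real.exp (-(l * w 0) + l * w t) := by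
        apply Real.one_le_exp
        have := hw.mono le_rfl t.2.1 t.2.2
        nlinarith
      nlinarith [dist_nonneg (x := B) (y := B')]
    | succ n ih =>
      intro t
      rw [Function.iterate_succ_apply', Function.iterate_succ_apply']
      have := step _ _ _ (by positivity) ih t
      rwa [← mul_assoc, ← pow_succ'] at this
  -- The largest ratio of the weights on `[0, 1]`: the price of passing from the weighted norm to
  -- the sup norm.
  set E := Real.exp (-(l * w 0)) * Real.exp (l * w 1) with hE
  have hEp : 0 < E := by positivity
  obtain ⟨n, hn⟩ := exists_pow_lt_of_lt_one (inv_pos.2 hEp) (by norm_num : (1 / 2 : ℝ) < 1)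
  have hlt : (1 / 2 : ℝ) ^ n * E < 1 := by
    have := mul_lt_mul_of_pos_right hn hEp
    rwa [inv_mul_cancel₀ hEp.ne'] at this
  have hcontr : ContractingWith ⟨(1 / 2 : ℝ) ^ n * E, by positivity⟩ (Φ^[n]) := by
    refine ⟨by exact_mod_cast hlt, LipschitzWith.of_dist_le_mul fun B B' => ?_⟩
    refine (ContinuousMap.dist_le (mul_nonneg (NNReal.coe_nonneg _) dist_nonneg)).2 fun t => ?_
    rw [Real.dist_eq]
    refine (iter n B B' t).trans ?_
    have h1 : Real.exp (l * w t) ≤ Real.exp (l * w 1) := by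
      apply Real.exp_le_exp.2
      exact mul_le_mul_of_nonneg_left (hw.mono t.2.1 t.2.2 le_rfl) hlp.le
    calc (1 / 2 : ℝ) ^ n * (dist B B' * Real.exp (-(l * w 0))) * Real.exp (l * w t)
        ≤ (1 / 2 : ℝ) ^ n * (dist B B' * Real.exp (-(l * w 0))) * Real.exp (l * w 1) :=
          mul_le_mul_of_nonneg_left h1 (by positivity)
      _ = (1 / 2 : ℝ) ^ n * E * dist B B' := by rw [hE]; ring
  have hfix : Φ (hcontr.fixedPoint (Φ^[n])) = hcontr.fixedPoint (Φ^[n]) :=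
    hcontr.isFixedPt_fixedPoint_iterate
  set B := hcontr.fixedPoint (Φ^[n]) with hB
  have hBS : ∀ t ∈ Icc (0 : ℝ) 1, ext B t = S B t := fun t ht => by
    rw [hextm B t ht]
    conv_lhs => rw [← hfix]
    rfl
  refine ⟨ext B, (hext B).continuousOn, ?_, ?_⟩
  · rw [hBS 0 ⟨le_rfl, zero_le_one⟩]; simp [S, hG0]
  · refine (hS B).congr' (eventually_mesh_mem.mono fun p hp => ?_) .rfl
    simp only [incr]
    rw [hBS _ ⟨hp.1.trans hp.2.1, hp.2.2⟩, ← hBS _ ⟨hp.1, hp.2.1.trans hp.2.2⟩]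

/-- Truncating the space variable makes the coefficients globally Lipschitz. Clamping does not spoil
linear growth, so Grönwall keeps the truncated solution within the truncation radius, where nothing
was changed. -/
lemma exists_solvesStieltjes (hw : Controls w w) (hA : ∀ i, Controls w (A i))
    (hAc : ∀ i, ContinuousOn (A i) (Icc 0 1))
    (hβ : ∀ i, ContinuousOn (fun q : ℝ × ℝ => β i q.1 q.2) (Icc (0 : ℝ) 1 ×ˢ univ))
    (hL : ∀ i, LocalLipschitzCond (β i)) (hG : ∀ i, LinearGrowthCond (β i)) (z₀ : ℝ) :
    ∃ B, SolvesStieltjes w A β z₀ B := by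
  choose c hc0 hc using hG
  have hci : ∀ i, c i ≤ ∑ j, c j := fun i =>
    Finset.single_le_sum (fun j _ => hc0 j) (Finset.mem_univ i)
  set C := ∑ j, c j with hC
  have hC0 : 0 ≤ C := Finset.sum_nonneg fun j _ => hc0 j
  -- Grönwall's bound at time `1` with `c = 1`. It involves only the growth constants, so it can be
  -- fixed before the Lipschitz constants are chosen.
  set r := (|z₀| + 1) * Real.exp ((k * C + 1) * (w 1 - w 0)) with hr
  have hrp : 0 < r := by positivity
  choose L hL0 hL using fun i => hL i r hrp
  have hLi : ∀ i, L i ≤ ∑ j, L j := fun i =>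
    Finset.single_le_sum (fun j _ => hL0 j) (Finset.mem_univ i)
  let clamp : ℝ → ℝ := fun y => max (-r) (min r y)
  have hclc : Continuous clamp := by fun_prop
  have hclm : ∀ y, clamp y ∈ Icc (-r) r := fun y =>
    ⟨le_max_left _ _, max_le (by linarith) (min_le_left _ _)⟩
  have hclid : ∀ y, |y| ≤ r → clamp y = y := fun y hy => by
    have := abs_le.1 hy
    simp only [clamp]
    rw [min_eq_right this.2, max_eq_right this.1]
  have hclL : ∀ y y', |clamp y - clamp y'| ≤ |y - y'| := fun y y' => by
    refine (abs_max_sub_max_le_max _ _ _ _).trans ?_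
    rw [sub_self, abs_zero]
    refine max_le (abs_nonneg _) ((abs_min_sub_min_le_max _ _ _ _).trans ?_)
    rw [sub_self, abs_zero]
    exact max_le (abs_nonneg _) le_rfl
  have hclabs : ∀ y, |clamp y| ≤ |y| := fun y => by
    have := hclL y 0
    rwa [hclid 0 (by simpa using hrp.le), sub_zero, sub_zero] at this
  obtain ⟨B, hB⟩ := exists_solvesStieltjes_of_lipschitz (β := fun i t y => β i t (clamp y))
    hw hA hAc (fun i => (hβ i).comp (f := fun q : ℝ × ℝ => (q.1, clamp q.2))
      (by fun_prop) fun q hq => ⟨hq.1, mem_univ _⟩)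
    (L := ∑ j, L j) (Finset.sum_nonneg fun j _ => hL0 j)
    (fun i t ht y y' => (hL i t ht _ (hclm _) _ (hclm _)).trans
      (mul_le_mul (hLi i) (hclL y y') (abs_nonneg _) (Finset.sum_nonneg fun j _ => hL0 j))) z₀
  have hbound : ∀ t ∈ Icc (0 : ℝ) 1, |B t| ≤ r := fun t ht => by
    have := gronwall_of_incr_le (D := B) (w := w) (L := k * C + 1) (c := 1) zero_le_one
      (fun ε hε => ?_) ht
    · rw [hB.2.1] at this
      have h1 : Real.exp ((k * C + 1) * (w t - w 0)) ≤ Real.exp ((k * C + 1) * (w 1 - w 0)) := by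
        apply Real.exp_le_exp.2
        have := hw.mono ht.1 ht.2 le_rfl
        exact mul_le_mul_of_nonneg_left (by linarith) (by positivity)
      have h2 := mul_le_mul_of_nonneg_left h1 (by positivity : 0 ≤ |z₀| + 1)
      linarith
    · filter_upwards [eventually_mesh_mem, hw.incr_nonneg,
        IsLittleO.eventually_abs_le hw hB.2.2 hε] with p hp hwp ho
      have hp1 : p.1 ∈ Icc (0 : ℝ) 1 := ⟨hp.1, hp.2.1.trans hp.2.2⟩
      have h1 := abs_sum_mul_incr_le hA (c := fun i => β i p.1 (clamp (B p.1)))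
        (M := C * (1 + |B p.1|)) (fun i => (hc i p.1 hp1 _).trans
          (mul_le_mul (hci i) (by have := hclabs (B p.1); linarith) (by positivity) hC0)) hp
      have h2 := abs_add_le (∑ i, β i p.1 (clamp (B p.1)) * incr (A i) p)
        (incr B p - ∑ i, β i p.1 (clamp (B p.1)) * incr (A i) p)
      rw [add_sub_cancel] at h2
      have : 0 ≤ (|B p.1| + 1) * incr w p := by positivity
      have : 0 ≤ k * C * ε * incr w p := by positivity
      nlinarith
  refine ⟨B, hB.1, hB.2.1, hB.2.2.congr' (eventually_mesh_mem.mono fun p hp => ?_) .rfl⟩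
  simp only
  rw [hclid _ (hbound p.1 ⟨hp.1, hp.2.1.trans hp.2.2⟩)]

end StieltjesEquation

/-! ### Global solutions of autonomous equations and parameter integrals -/

/-- On the ball of radius `|v x|` about `x` the field is at most `(1 + K) |v x|`. Picard–Lindelöf
thus gives an existence time `1 / (2 (K + 1))` not depending on `x`, and uniform existence time
makes solutions global. -/
lemma exists_global_solution {v : ℝ → ℝ} {K : NNReal} (hv : LipschitzWith K v)
    (hc : ContDiff ℝ 1 v) (ξ : ℝ) : ∃ u : ℝ → ℝ, u 0 = ξ ∧ ∀ t, HasDerivAt u (v (u t)) t := by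
  set ε : ℝ := 1 / (2 * (K + 1)) with hε
  have hKp : (0 : ℝ) < K + 1 := by positivity
  have hεp : 0 < ε := by positivity
  have hv' : ContMDiff (modelWithCornersSelf ℝ ℝ) (modelWithCornersSelf ℝ ℝ).tangent 1
      (fun x ↦ (⟨x, v x⟩ : TangentBundle (modelWithCornersSelf ℝ ℝ) ℝ)) :=
    contMDiff_vectorSpace_iff_contDiff.2 hc
  have hloc : ∀ x : ℝ, ∃ γ : ℝ → ℝ, γ 0 = x ∧
      IsMIntegralCurveOn (I := modelWithCornersSelf ℝ ℝ) γ v (Ioo (-ε) ε) := by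
    intro x
    have hPL : IsPicardLindelof (fun _ => v) (tmin := -ε) (tmax := ε)
        ⟨0, by linarith, hεp.le⟩ x ‖v x‖₊ 0 (‖v x‖₊ + K * ‖v x‖₊) K := by
      refine IsPicardLindelof.of_time_independent (fun y hy => ?_) hv.lipschitzOnWith ?_
      · have h1 := hv.dist_le_mul y x
        have h2 : ‖v y‖ ≤ ‖v x‖ + dist (v y) (v x) := by
          rw [dist_eq_norm]; have := norm_add_le (v x) (v y - v x); rwa [add_sub_cancel] at this
        have h3 : (K : ℝ) * dist y x ≤ K * ‖v x‖ :=
          mul_le_mul_of_nonneg_left (Metric.mem_closedBall.1 hy) K.2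
        push_cast
        linarith
      · simp only [sub_zero, zero_sub, neg_neg, max_self]
        push_cast
        rw [hε, sub_zero, mul_one_div, div_le_iff₀ (by positivity)]
        nlinarith [norm_nonneg (v x), K.2, mul_nonneg (norm_nonneg (v x)) K.2]
    obtain ⟨α, hα0, hα⟩ := hPL.exists_eq_forall_mem_Icc_hasDerivWithinAt₀
    refine ⟨α, hα0, fun t ht => ?_⟩
    have := ((hα t (Ioo_subset_Icc_self ht)).hasDerivAt (Icc_mem_nhds ht.1 ht.2)).hasFDerivAt
    exact this.hasMFDerivAt.hasMFDerivWithinAt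
  obtain ⟨γ, hγ0, hγ⟩ := exists_isMIntegralCurve_of_isMIntegralCurveOn hv' hεp hloc ξ
  refine ⟨γ, hγ0, fun t => ?_⟩
  have h : HasFDerivAt γ ((1 : ℝ →L[ℝ] ℝ).smulRight (v (γ t))) t := (hγ t).hasFDerivAt
  exact h.hasDerivAt.congr_deriv (by simp)

lemma global_solution_unique {v : ℝ → ℝ} {K : NNReal} (hv : LipschitzWith K v) {u u' : ℝ → ℝ}
    (hu : ∀ t, HasDerivAt u (v (u t)) t) (hu' : ∀ t, HasDerivAt u' (v (u' t)) t) {t₀ : ℝ}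
    (h : u t₀ = u' t₀) : u = u' :=
  ODE_solution_unique_univ (v := fun _ => v) (s := fun _ => univ) (fun _ => hv.lipschitzOnWith)
    (fun t => ⟨hu t, mem_univ _⟩) (fun t => ⟨hu' t, mem_univ _⟩) h

lemma contDiff_one_integral {H : Type*} [NormedAddCommGroup H] [NormedSpace ℝ H]
    [FiniteDimensional ℝ H] {h : H × ℝ → ℝ} (hh : ContDiff ℝ 1 h) :
    ContDiff ℝ 1 (fun p => ∫ θ in (0 : ℝ)..1, h (p, θ)) := by
  have : ProperSpace H := FiniteDimensional.proper ℝ H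
  have hd : Continuous (fderiv ℝ h) := hh.continuous_fderiv one_ne_zero
  let h' : H → ℝ → H →L[ℝ] ℝ := fun p θ =>
    (fderiv ℝ h (p, θ)).comp (ContinuousLinearMap.inl ℝ H ℝ)
  have hh' : Continuous (Function.uncurry h') := by
    have : Continuous fun q : H × ℝ => (fderiv ℝ h q).comp (ContinuousLinearMap.inl ℝ H ℝ) :=
      hd.clm_comp continuous_const
    exact this
  refine contDiff_one_iff_hasFDerivAt.2 ⟨fun p => ∫ θ in (0 : ℝ)..1, h' p θ,
    intervalIntegral.continuous_parametric_intervalIntegral_of_continuous' hh' 0 1, fun p => ?_⟩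
  obtain ⟨C, hC⟩ := ((isCompact_closedBall p 1).prod
    (isCompact_Icc (a := (0 : ℝ)) (b := 1))).exists_bound_of_continuousOn hh'.continuousOn
  refine intervalIntegral.hasFDerivAt_integral_of_dominated_of_fderiv_le
    (F := fun p θ => h (p, θ)) (F' := h') (bound := fun _ => C)
    (Metric.closedBall_mem_nhds p one_pos) ?_ ?_ ?_ ?_ ?_ ?_
  · exact .of_forall fun q =>
      (hh.continuous.comp (by fun_prop : Continuous fun θ : ℝ => (q, θ))).aestronglyMeasurable
  · exact (hh.continuous.comp (by fun_prop : Continuous fun θ : ℝ => (p, θ))).intervalIntegrable _ _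
  · exact (hh'.comp (by fun_prop : Continuous fun θ : ℝ => (p, θ))).aestronglyMeasurable
  · refine .of_forall fun θ hθ q hq => hC (q, θ) ⟨hq, ?_⟩
    rw [uIoc_of_le zero_le_one] at hθ
    exact Ioc_subset_Icc_self hθ
  · exact intervalIntegrable_const
  · refine .of_forall fun θ _ q _ => ?_
    exact ((hh.differentiable one_ne_zero (q, θ)).hasFDerivAt).comp q
      (hasFDerivAt_prodMk_left q θ)

/-- An integral over `[0, s p]` depends `C¹` on parameters. -/
lemma ContDiff.integral_upper {H : Type*} [NormedAddCommGroup H] [NormedSpace ℝ H]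
    [FiniteDimensional ℝ H] {h : H → ℝ → ℝ} (hh : ContDiff ℝ 1 (fun q : H × ℝ => h q.1 q.2))
    {s : H → ℝ} (hs : ContDiff ℝ 1 s) :
    ContDiff ℝ 1 (fun p => ∫ θ in (0 : ℝ)..s p, h p θ) := by
  -- Rescaling by `s p` moves the variable endpoint into the integrand.
  have e : (fun p => ∫ θ in (0 : ℝ)..s p, h p θ) =
      fun p => s p * ∫ θ in (0 : ℝ)..1, h p (s p * θ) := by
    funext p
    rw [intervalIntegral.mul_integral_comp_mul_left (f := h p)]; simp
  rw [e]
  refine hs.mul (contDiff_one_integral (h := fun q : H × ℝ => h q.1 (s q.1 * q.2)) ?_)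
  exact hh.comp (g := fun q : H × ℝ => h q.1 q.2) (f := fun q : H × ℝ => (q.1, s q.1 * q.2))
    (by fun_prop)

/-- Carathéodory's form of differentiability: an exact slope identity with a continuous slope
replaces remainder estimates. -/
lemma hasFDerivAt_of_slope {E : Type*} [NormedAddCommGroup E] [NormedSpace ℝ E] {f : E → ℝ}
    {L : E → E →L[ℝ] ℝ} {p : E} (h : ∀ q, f q - f p = L q (q - p)) (hL : ContinuousAt L p) :
    HasFDerivAt f (L p) p := by
  rw [hasFDerivAt_iff_isLittleO]
  have e : (fun q => f q - f p - L p (q - p)) = fun q => (L q - L p) (q - p) := by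
    funext q; rw [h]; simp
  rw [e]
  have h1 : (fun q => L q - L p) =o[𝓝 p] (fun _ => (1 : ℝ)) := by
    rw [isLittleO_one_iff]
    simpa using hL.tendsto.sub_const (L p)
  have h2 : (fun q => (L q - L p) (q - p)) =O[𝓝 p] fun q => ‖L q - L p‖ * ‖q - p‖ :=
    IsBigO.of_bound 1 (.of_forall fun q => by
      simpa using (L q - L p).le_opNorm (q - p))
  refine h2.trans_isLittleO ?_
  have := h1.norm_left.mul_isBigO (isBigO_refl (fun q => ‖q - p‖) (𝓝 p))
  simpa using this.norm_right

lemma ContDiff.sub_eq_integral {f : ℝ × ℝ → ℝ} (hf : ContDiff ℝ 1 f) (q v : ℝ × ℝ) :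
    f (q + v) - f q = ∫ θ in (0 : ℝ)..1, fderiv ℝ f (q + θ • v) v := by
  have hd : ∀ θ ∈ uIcc (0 : ℝ) 1, HasDerivAt (fun θ : ℝ => f (q + θ • v))
      (fderiv ℝ f (q + θ • v) v) θ := fun θ _ => by
    have h1 : HasDerivAt (fun θ : ℝ => q + θ • v) v θ := by
      simpa using ((hasDerivAt_id θ).smul_const v).const_add q
    exact (hf.differentiable one_ne_zero _).hasFDerivAt.comp_hasDerivAt θ h1
  have hc : Continuous fun θ : ℝ => fderiv ℝ f (q + θ • v) v :=
    ((hf.continuous_fderiv one_ne_zero).comp (by fun_prop)).clm_apply continuous_const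
  rw [intervalIntegral.integral_eq_sub_of_hasDerivAt hd (hc.intervalIntegrable _ _)]
  simp

/-- Variation of constants. The factor `d` is kept outside the integral because it will be the
parameter increment `τ' - τ`, in which the result must be linear. -/
lemma linear_ode_solution {a c D : ℝ → ℝ} (ha : Continuous a) (hc : Continuous c) {d : ℝ}
    (hD : ∀ t, HasDerivAt D (a t * D t + c t * d) t) (t : ℝ) :
    D t = Real.exp (∫ s in (0 : ℝ)..t, a s) *
      (D 0 + (∫ s in (0 : ℝ)..t, c s * Real.exp (-∫ r in (0 : ℝ)..s, a r)) * d) := by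
  have h1 : ∀ t, HasDerivAt (fun t => ∫ s in (0 : ℝ)..t, a s) (a t) t := fun t =>
    ha.integral_hasStrictDerivAt 0 t |>.hasDerivAt
  have hcont : Continuous fun s => c s * Real.exp (-∫ r in (0 : ℝ)..s, a r) := by
    have : Continuous fun t => ∫ s in (0 : ℝ)..t, a s :=
      continuous_iff_continuousAt.2 fun t => (h1 t).continuousAt
    fun_prop
  have h2 : ∀ t, HasDerivAt (fun t => ∫ s in (0 : ℝ)..t, c s * Real.exp (-∫ r in (0 : ℝ)..s, a r))
      (c t * Real.exp (-∫ r in (0 : ℝ)..t, a r)) t := fun t =>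
    hcont.integral_hasStrictDerivAt 0 t |>.hasDerivAt
  have h3 : ∀ t, HasDerivAt (fun t => D t * Real.exp (-∫ s in (0 : ℝ)..t, a s) -
      (∫ s in (0 : ℝ)..t, c s * Real.exp (-∫ r in (0 : ℝ)..s, a r)) * d) 0 t := fun t => by
    have := ((hD t).mul ((h1 t).neg.exp)).sub ((h2 t).mul_const d)
    refine HasDerivAt.congr_deriv this ?_
    simp only [Pi.neg_apply]
    ring
  have h4 := is_const_of_deriv_eq_zero (fun t => (h3 t).differentiableAt)
    (fun t => (h3 t).deriv) t 0
  simp only [intervalIntegral.integral_same, neg_zero, Real.exp_zero, mul_one, zero_mul,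
    sub_zero] at h4
  have h5 : D t * Real.exp (-∫ s in (0 : ℝ)..t, a s) = D 0 +
      (∫ s in (0 : ℝ)..t, c s * Real.exp (-∫ r in (0 : ℝ)..s, a r)) * d := by linarith
  rw [← h5, mul_comm, mul_assoc, ← Real.exp_add]
  simp

/-! ### Differentiability of the flow in all its variables -/

section SmoothFlow

variable {s : ℝ × ℝ → ℝ} {φ : ℝ → ℝ → ℝ → ℝ} {K : ℝ}

/-- The mean of `∂s/∂ξ` between two flow lines. -/
noncomputable def slopeXi (s : ℝ × ℝ → ℝ) (φ : ℝ → ℝ → ℝ → ℝ) (q q' : ℝ × ℝ × ℝ) (r : ℝ) : ℝ :=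
  ∫ θ in (0 : ℝ)..1, fderiv ℝ s
    (q'.1, φ q.1 q.2.1 r + θ * (φ q'.1 q'.2.1 r - φ q.1 q.2.1 r)) (0, 1)

/-- The mean of `∂s/∂τ` between two parameter values along a flow line. -/
noncomputable def slopeTau (s : ℝ × ℝ → ℝ) (φ : ℝ → ℝ → ℝ → ℝ) (q q' : ℝ × ℝ × ℝ) (r : ℝ) : ℝ :=
  ∫ θ in (0 : ℝ)..1, fderiv ℝ s (q.1 + θ * (q'.1 - q.1), φ q.1 q.2.1 r) (1, 0)

/-- The velocity difference splits at `(τ', φ)`: the change of position gives `slopeXi` times the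
difference of flow lines, the change of parameter gives `slopeTau` times `τ' - τ`. Both identities
are exact, so the difference solves a linear equation without remainder. -/
lemma flow_sub_eq (hs : ContDiff ℝ 1 s) (h0 : ∀ τ y, φ τ y 0 = y)
    (hφ : ∀ τ y t, HasDerivAt (φ τ y) (s (τ, φ τ y t)) t) (q q' : ℝ × ℝ × ℝ) (t : ℝ) :
    φ q'.1 q'.2.1 t - φ q.1 q.2.1 t = Real.exp (∫ r in (0 : ℝ)..t, slopeXi s φ q q' r) *
      (q'.2.1 - q.2.1 + (∫ r in (0 : ℝ)..t, slopeTau s φ q q' r *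
        Real.exp (-∫ ρ in (0 : ℝ)..r, slopeXi s φ q q' ρ)) * (q'.1 - q.1)) := by
  have hd := hs.continuous_fderiv one_ne_zero
  have hc : ∀ τ y, Continuous (φ τ y) := fun τ y =>
    continuous_iff_continuousAt.2 fun t => (hφ τ y t).continuousAt
  have hc1 := hc q.1 q.2.1
  have hc2 := hc q'.1 q'.2.1
  have ha : Continuous (slopeXi s φ q q') :=
    intervalIntegral.continuous_parametric_intervalIntegral_of_continuous'
      (f := fun r θ => fderiv ℝ s
        (q'.1, φ q.1 q.2.1 r + θ * (φ q'.1 q'.2.1 r - φ q.1 q.2.1 r)) (0, 1))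
      ((hd.comp (f := fun z : ℝ × ℝ =>
        (q'.1, φ q.1 q.2.1 z.1 + z.2 * (φ q'.1 q'.2.1 z.1 - φ q.1 q.2.1 z.1)))
        (by fun_prop)).clm_apply continuous_const) 0 1
  have hcc : Continuous (slopeTau s φ q q') :=
    intervalIntegral.continuous_parametric_intervalIntegral_of_continuous'
      (f := fun r θ => fderiv ℝ s (q.1 + θ * (q'.1 - q.1), φ q.1 q.2.1 r) (1, 0))
      ((hd.comp (f := fun z : ℝ × ℝ => (q.1 + z.2 * (q'.1 - q.1), φ q.1 q.2.1 z.1))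
        (by fun_prop)).clm_apply continuous_const) 0 1
  have := linear_ode_solution (D := fun t => φ q'.1 q'.2.1 t - φ q.1 q.2.1 t) ha hcc
    (d := q'.1 - q.1) (fun r => ?_) t
  · simpa only [h0] using this
  · refine ((hφ q'.1 q'.2.1 r).sub (hφ q.1 q.2.1 r)).congr_deriv ?_
    have e1 := hs.sub_eq_integral (q'.1, φ q.1 q.2.1 r) (0, φ q'.1 q'.2.1 r - φ q.1 q.2.1 r)
    have e2 := hs.sub_eq_integral (q.1, φ q.1 q.2.1 r) (q'.1 - q.1, 0)
    simp only [Prod.mk_add_mk, Prod.smul_mk, mul_zero, add_zero, add_sub_cancel,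
      smul_eq_mul] at e1 e2
    have l1 : ∀ p (d : ℝ), fderiv ℝ s p (0, d) = fderiv ℝ s p (0, 1) * d := fun p d => by
      have : ((0 : ℝ), d) = d • ((0 : ℝ), (1 : ℝ)) := by simp
      rw [this, map_smul, smul_eq_mul, mul_comm]
    have l2 : ∀ p (d : ℝ), fderiv ℝ s p (d, 0) = fderiv ℝ s p (1, 0) * d := fun p d => by
      have : (d, (0 : ℝ)) = d • ((1 : ℝ), (0 : ℝ)) := by simp
      rw [this, map_smul, smul_eq_mul, mul_comm]
    simp only [l1 _ (φ q'.1 q'.2.1 r - φ q.1 q.2.1 r), l2 _ (q'.1 - q.1),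
      intervalIntegral.integral_mul_const] at e1 e2
    simp only [slopeXi, slopeTau]
    rw [← e1, ← e2]
    ring

lemma abs_integral_mul_exp_le {a c : ℝ → ℝ} (ha : ∀ r, |a r| ≤ K) (hc : ∀ r, |c r| ≤ K) (t : ℝ) :
    |∫ r in (0 : ℝ)..t, c r * Real.exp (-∫ ρ in (0 : ℝ)..r, a ρ)| ≤
      K * Real.exp (K * |t|) * |t| := by
  have hK0 : 0 ≤ K := (abs_nonneg _).trans (ha 0)
  have h1 : ∀ r, |∫ ρ in (0 : ℝ)..r, a ρ| ≤ K * |r| := fun r => by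
    simpa using intervalIntegral.norm_integral_le_of_norm_le_const (a := (0 : ℝ)) (b := r)
      (f := a) (C := K) fun θ _ => ha θ
  have := intervalIntegral.norm_integral_le_of_norm_le_const (a := (0 : ℝ)) (b := t)
    (f := fun r => c r * Real.exp (-∫ ρ in (0 : ℝ)..r, a ρ))
    (C := K * Real.exp (K * |t|)) fun r hr => by
      rw [norm_mul, Real.norm_eq_abs, Real.norm_eq_abs, abs_of_pos (Real.exp_pos _)]
      refine mul_le_mul (hc r) (Real.exp_le_exp.2 ?_) (Real.exp_pos _).le hK0
      have h2 : |r| ≤ |t| := by simpa using abs_sub_left_of_mem_uIcc (uIoc_subset_uIcc hr)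
      exact ((neg_le_abs _).trans (h1 r)).trans (mul_le_mul_of_nonneg_left h2 hK0)
  simpa using this

lemma exp_integral_le {a : ℝ → ℝ} (ha : ∀ r, |a r| ≤ K) (t : ℝ) :
    Real.exp (∫ r in (0 : ℝ)..t, a r) ≤ Real.exp (K * |t|) := by
  refine Real.exp_le_exp.2 ((le_abs_self _).trans ?_)
  simpa using intervalIntegral.norm_integral_le_of_norm_le_const (a := (0 : ℝ)) (b := t)
    (f := a) (C := K) fun θ _ => ha θ

lemma abs_flow_sub_le (hs : ContDiff ℝ 1 s) (h0 : ∀ τ y, φ τ y 0 = y)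
    (hφ : ∀ τ y t, HasDerivAt (φ τ y) (s (τ, φ τ y t)) t)
    (hK₁ : ∀ q, |fderiv ℝ s q (1, 0)| ≤ K) (hK₂ : ∀ q, |fderiv ℝ s q (0, 1)| ≤ K)
    (τ y τ' y' t : ℝ) :
    |φ τ' y' t - φ τ y t| ≤ Real.exp (K * |t|) *
      (|y' - y| + K * Real.exp (K * |t|) * |t| * |τ' - τ|) := by
  have b1 : ∀ q q' r, |slopeXi s φ q q' r| ≤ K := fun q q' r => by
    have := intervalIntegral.norm_integral_le_of_norm_le_const (a := (0 : ℝ)) (b := 1)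
      (f := fun θ => fderiv ℝ s
        (q'.1, φ q.1 q.2.1 r + θ * (φ q'.1 q'.2.1 r - φ q.1 q.2.1 r)) (0, 1)) (C := K)
      fun θ _ => hK₂ _
    simpa [slopeXi] using this
  have b2 : ∀ q q' r, |slopeTau s φ q q' r| ≤ K := fun q q' r => by
    have := intervalIntegral.norm_integral_le_of_norm_le_const (a := (0 : ℝ)) (b := 1)
      (f := fun θ => fderiv ℝ s (q.1 + θ * (q'.1 - q.1), φ q.1 q.2.1 r) (1, 0)) (C := K)
      fun θ _ => hK₁ _
    simpa [slopeTau] using this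
  have := flow_sub_eq hs h0 hφ (τ, y, 0) (τ', y', 0) t
  simp only at this
  rw [this, abs_mul, abs_of_pos (Real.exp_pos _)]
  refine mul_le_mul (exp_integral_le (b1 _ _) t) ?_ (abs_nonneg _)
    (Real.exp_pos _).le
  refine (abs_add_le _ _).trans (add_le_add le_rfl ?_)
  rw [abs_mul]
  exact mul_le_mul_of_nonneg_right (abs_integral_mul_exp_le (b1 _ _) (b2 _ _) t) (abs_nonneg _)

/-- The slopes contain the flow itself, so its joint continuity has to precede theirs. It follows
from the locally uniform Lipschitz bound in `(τ, ξ)` and continuity of each flow line. -/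
lemma continuous_flow (hs : ContDiff ℝ 1 s) (h0 : ∀ τ y, φ τ y 0 = y)
    (hφ : ∀ τ y t, HasDerivAt (φ τ y) (s (τ, φ τ y t)) t)
    (hK₁ : ∀ q, |fderiv ℝ s q (1, 0)| ≤ K) (hK₂ : ∀ q, |fderiv ℝ s q (0, 1)| ≤ K) :
    Continuous fun q : ℝ × ℝ × ℝ => φ q.1 q.2.1 q.2.2 := by
  rw [continuous_iff_continuousAt]
  intro q₀
  have hc : Continuous (φ q₀.1 q₀.2.1) :=
    continuous_iff_continuousAt.2 fun t => (hφ _ _ t).continuousAt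
  have hb : Tendsto (fun q : ℝ × ℝ × ℝ => Real.exp (K * |q.2.2|) *
      (|q.2.1 - q₀.2.1| + K * Real.exp (K * |q.2.2|) * |q.2.2| * |q.1 - q₀.1|) +
      |φ q₀.1 q₀.2.1 q.2.2 - φ q₀.1 q₀.2.1 q₀.2.2|) (𝓝 q₀) (𝓝 0) := by
    have : Continuous (fun q : ℝ × ℝ × ℝ => Real.exp (K * |q.2.2|) *
      (|q.2.1 - q₀.2.1| + K * Real.exp (K * |q.2.2|) * |q.2.2| * |q.1 - q₀.1|) +
      |φ q₀.1 q₀.2.1 q.2.2 - φ q₀.1 q₀.2.1 q₀.2.2|) := by fun_prop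
    simpa using this.tendsto q₀
  rw [ContinuousAt, tendsto_iff_dist_tendsto_zero]
  refine squeeze_zero (fun _ => dist_nonneg) (fun q => ?_) hb
  rw [Real.dist_eq]
  refine (abs_sub_le _ (φ q₀.1 q₀.2.1 q.2.2) _).trans (add_le_add ?_ le_rfl)
  exact abs_flow_sub_le hs h0 hφ hK₁ hK₂ _ _ _ _ _

/-- The derivative of the flow. -/
noncomputable def flowDeriv (s : ℝ × ℝ → ℝ) (φ : ℝ → ℝ → ℝ → ℝ) (q q' : ℝ × ℝ × ℝ) :
    ℝ × ℝ × ℝ →L[ℝ] ℝ :=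
  (Real.exp (∫ r in (0 : ℝ)..q'.2.2, slopeXi s φ q q' r) *
    ∫ r in (0 : ℝ)..q'.2.2, slopeTau s φ q q' r *
      Real.exp (-∫ ρ in (0 : ℝ)..r, slopeXi s φ q q' ρ)) • ContinuousLinearMap.fst ℝ ℝ (ℝ × ℝ) +
  Real.exp (∫ r in (0 : ℝ)..q'.2.2, slopeXi s φ q q' r) •
    (ContinuousLinearMap.fst ℝ ℝ ℝ).comp (ContinuousLinearMap.snd ℝ ℝ (ℝ × ℝ)) +
  (∫ θ in (0 : ℝ)..1, s (q.1, φ q.1 q.2.1 (q.2.2 + θ * (q'.2.2 - q.2.2)))) •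
    (ContinuousLinearMap.snd ℝ ℝ ℝ).comp (ContinuousLinearMap.snd ℝ ℝ (ℝ × ℝ))

/-- First `(τ, ξ)` is changed at the new time, then time is changed along the old flow line. -/
lemma flow_sub_eq_flowDeriv (hs : ContDiff ℝ 1 s) (h0 : ∀ τ y, φ τ y 0 = y)
    (hφ : ∀ τ y t, HasDerivAt (φ τ y) (s (τ, φ τ y t)) t) (q q' : ℝ × ℝ × ℝ) :
    φ q'.1 q'.2.1 q'.2.2 - φ q.1 q.2.1 q.2.2 = flowDeriv s φ q q' (q' - q) := by
  have hc : Continuous (φ q.1 q.2.1) :=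
    continuous_iff_continuousAt.2 fun t => (hφ _ _ t).continuousAt
  have h1 := flow_sub_eq hs h0 hφ q q' q'.2.2
  have h2 : φ q.1 q.2.1 q'.2.2 - φ q.1 q.2.1 q.2.2 =
      (∫ θ in (0 : ℝ)..1, s (q.1, φ q.1 q.2.1 (q.2.2 + θ * (q'.2.2 - q.2.2)))) *
        (q'.2.2 - q.2.2) := by
    have hd : ∀ θ ∈ uIcc (0 : ℝ) 1,
        HasDerivAt (fun θ : ℝ => φ q.1 q.2.1 (q.2.2 + θ * (q'.2.2 - q.2.2)))
          (s (q.1, φ q.1 q.2.1 (q.2.2 + θ * (q'.2.2 - q.2.2))) * (q'.2.2 - q.2.2)) θ :=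
      fun θ _ => by
        have h1 : HasDerivAt (fun θ : ℝ => q.2.2 + θ * (q'.2.2 - q.2.2)) (q'.2.2 - q.2.2) θ := by
          simpa using ((hasDerivAt_id θ).mul_const (q'.2.2 - q.2.2)).const_add q.2.2
        exact (hφ q.1 q.2.1 _).comp θ h1
    have hcs : Continuous fun θ : ℝ =>
        s (q.1, φ q.1 q.2.1 (q.2.2 + θ * (q'.2.2 - q.2.2))) * (q'.2.2 - q.2.2) :=
      (hs.continuous.comp (by fun_prop)).mul continuous_const
    rw [← intervalIntegral.integral_mul_const,
      intervalIntegral.integral_eq_sub_of_hasDerivAt hd (hcs.intervalIntegrable _ _)]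
    simp
  simp only [flowDeriv, add_apply, smul_apply,
    ContinuousLinearMap.coe_fst', ContinuousLinearMap.comp_apply, ContinuousLinearMap.coe_snd',
    Prod.fst_sub, Prod.snd_sub, smul_eq_mul]
  rw [← h2]
  linear_combination h1

lemma continuous_flowDeriv (hs : ContDiff ℝ 1 s)
    (hc : Continuous fun q : ℝ × ℝ × ℝ => φ q.1 q.2.1 q.2.2) (q : ℝ × ℝ × ℝ) :
    Continuous (flowDeriv s φ q) := by
  have hd := hs.continuous_fderiv one_ne_zero
  have hcomp : ∀ {X : Type} [TopologicalSpace X] {f g h : X → ℝ}, Continuous f → Continuous g →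
      Continuous h → Continuous fun z => φ (f z) (g z) (h z) := fun hf hg hh =>
    hc.comp (hf.prodMk (hg.prodMk hh))
  have ha : Continuous fun z : (ℝ × ℝ × ℝ) × ℝ => slopeXi s φ q z.1 z.2 :=
    intervalIntegral.continuous_parametric_intervalIntegral_of_continuous'
      (f := fun (z : (ℝ × ℝ × ℝ) × ℝ) θ => fderiv ℝ s
        (z.1.1, φ q.1 q.2.1 z.2 + θ * (φ z.1.1 z.1.2.1 z.2 - φ q.1 q.2.1 z.2)) (0, 1))
      ((hd.comp (f := fun z : ((ℝ × ℝ × ℝ) × ℝ) × ℝ =>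
        (z.1.1.1, φ q.1 q.2.1 z.1.2 + z.2 * (φ z.1.1.1 z.1.1.2.1 z.1.2 - φ q.1 q.2.1 z.1.2)))
        ((by fun_prop : Continuous fun z : ((ℝ × ℝ × ℝ) × ℝ) × ℝ => z.1.1.1).prodMk
          ((hcomp (by fun_prop) (by fun_prop) (by fun_prop)).add (continuous_snd.mul
            ((hcomp (by fun_prop) (by fun_prop) (by fun_prop)).sub
              (hcomp (by fun_prop) (by fun_prop) (by fun_prop))))))).clm_apply
        continuous_const) 0 1
  have hcc : Continuous fun z : (ℝ × ℝ × ℝ) × ℝ => slopeTau s φ q z.1 z.2 :=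
    intervalIntegral.continuous_parametric_intervalIntegral_of_continuous'
      (f := fun (z : (ℝ × ℝ × ℝ) × ℝ) θ =>
        fderiv ℝ s (q.1 + θ * (z.1.1 - q.1), φ q.1 q.2.1 z.2) (1, 0))
      ((hd.comp (f := fun z : ((ℝ × ℝ × ℝ) × ℝ) × ℝ =>
        (q.1 + z.2 * (z.1.1.1 - q.1), φ q.1 q.2.1 z.1.2))
        ((by fun_prop : Continuous fun z : ((ℝ × ℝ × ℝ) × ℝ) × ℝ =>
          q.1 + z.2 * (z.1.1.1 - q.1)).prodMk
          (hcomp (by fun_prop) (by fun_prop) (by fun_prop)))).clm_apply continuous_const) 0 1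
  have hI : Continuous fun z : (ℝ × ℝ × ℝ) × ℝ => ∫ ρ in (0 : ℝ)..z.2, slopeXi s φ q z.1 ρ :=
    intervalIntegral.continuous_parametric_intervalIntegral_of_continuous
      (f := fun (z : (ℝ × ℝ × ℝ) × ℝ) ρ => slopeXi s φ q z.1 ρ)
      (ha.comp (f := fun z : ((ℝ × ℝ × ℝ) × ℝ) × ℝ => (z.1.1, z.2)) (by fun_prop)) continuous_snd
  have hE : Continuous fun q' : ℝ × ℝ × ℝ => ∫ r in (0 : ℝ)..q'.2.2, slopeXi s φ q q' r :=
    hI.comp (f := fun q' : ℝ × ℝ × ℝ => (q', q'.2.2)) (by fun_prop)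
  have hG : Continuous fun q' : ℝ × ℝ × ℝ => ∫ r in (0 : ℝ)..q'.2.2, slopeTau s φ q q' r *
      Real.exp (-∫ ρ in (0 : ℝ)..r, slopeXi s φ q q' ρ) :=
    intervalIntegral.continuous_parametric_intervalIntegral_of_continuous
      (f := fun (q' : ℝ × ℝ × ℝ) r => slopeTau s φ q q' r *
        Real.exp (-∫ ρ in (0 : ℝ)..r, slopeXi s φ q q' ρ))
      (hcc.mul (Real.continuous_exp.comp hI.neg)) (by fun_prop)
  have hH : Continuous fun q' : ℝ × ℝ × ℝ =>
      ∫ θ in (0 : ℝ)..1, s (q.1, φ q.1 q.2.1 (q.2.2 + θ * (q'.2.2 - q.2.2))) :=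
    intervalIntegral.continuous_parametric_intervalIntegral_of_continuous'
      (f := fun (q' : ℝ × ℝ × ℝ) θ => s (q.1, φ q.1 q.2.1 (q.2.2 + θ * (q'.2.2 - q.2.2))))
      (hs.continuous.comp (f := fun z : (ℝ × ℝ × ℝ) × ℝ =>
        (q.1, φ q.1 q.2.1 (q.2.2 + z.2 * (z.1.2.2 - q.2.2))))
        (continuous_const.prodMk (hcomp (by fun_prop) (by fun_prop) (by fun_prop)))) 0 1
  unfold flowDeriv
  exact ((((Real.continuous_exp.comp hE).mul hG).smul continuous_const).add
    ((Real.continuous_exp.comp hE).smul continuous_const)).add (hH.smul continuous_const)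

lemma flowDeriv_self (q : ℝ × ℝ × ℝ) : flowDeriv s φ q q =
    (Real.exp (∫ r in (0 : ℝ)..q.2.2, fderiv ℝ s (q.1, φ q.1 q.2.1 r) (0, 1)) *
      ∫ r in (0 : ℝ)..q.2.2, fderiv ℝ s (q.1, φ q.1 q.2.1 r) (1, 0) *
        Real.exp (-∫ ρ in (0 : ℝ)..r, fderiv ℝ s (q.1, φ q.1 q.2.1 ρ) (0, 1))) •
      ContinuousLinearMap.fst ℝ ℝ (ℝ × ℝ) +
    Real.exp (∫ r in (0 : ℝ)..q.2.2, fderiv ℝ s (q.1, φ q.1 q.2.1 r) (0, 1)) •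
      (ContinuousLinearMap.fst ℝ ℝ ℝ).comp (ContinuousLinearMap.snd ℝ ℝ (ℝ × ℝ)) +
    s (q.1, φ q.1 q.2.1 q.2.2) •
      (ContinuousLinearMap.snd ℝ ℝ ℝ).comp (ContinuousLinearMap.snd ℝ ℝ (ℝ × ℝ)) := by
  simp [flowDeriv, slopeXi, slopeTau]

lemma hasFDerivAt_flow (hs : ContDiff ℝ 1 s) (h0 : ∀ τ y, φ τ y 0 = y)
    (hφ : ∀ τ y t, HasDerivAt (φ τ y) (s (τ, φ τ y t)) t)
    (hK₁ : ∀ q, |fderiv ℝ s q (1, 0)| ≤ K) (hK₂ : ∀ q, |fderiv ℝ s q (0, 1)| ≤ K)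
    (q : ℝ × ℝ × ℝ) :
    HasFDerivAt (fun q : ℝ × ℝ × ℝ => φ q.1 q.2.1 q.2.2) (flowDeriv s φ q q) q :=
  hasFDerivAt_of_slope (flow_sub_eq_flowDeriv hs h0 hφ q)
    (continuous_flowDeriv hs (continuous_flow hs h0 hφ hK₁ hK₂) q).continuousAt

lemma contDiff_one_flow (hs : ContDiff ℝ 1 s) (h0 : ∀ τ y, φ τ y 0 = y)
    (hφ : ∀ τ y t, HasDerivAt (φ τ y) (s (τ, φ τ y t)) t)
    (hK₁ : ∀ q, |fderiv ℝ s q (1, 0)| ≤ K) (hK₂ : ∀ q, |fderiv ℝ s q (0, 1)| ≤ K) :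
    ContDiff ℝ 1 (fun q : ℝ × ℝ × ℝ => φ q.1 q.2.1 q.2.2) := by
  refine contDiff_one_iff_hasFDerivAt.2 ⟨fun q => flowDeriv s φ q q, ?_,
    hasFDerivAt_flow hs h0 hφ hK₁ hK₂⟩
  have hc := continuous_flow hs h0 hφ hK₁ hK₂
  have hd := hs.continuous_fderiv one_ne_zero
  have hpath : Continuous fun z : (ℝ × ℝ × ℝ) × ℝ => (z.1.1, φ z.1.1 z.1.2.1 z.2) :=
    (by fun_prop : Continuous fun z : (ℝ × ℝ × ℝ) × ℝ => z.1.1).prodMk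
      (hc.comp (f := fun z : (ℝ × ℝ × ℝ) × ℝ => (z.1.1, z.1.2.1, z.2)) (by fun_prop))
  have ha : Continuous fun z : (ℝ × ℝ × ℝ) × ℝ =>
      fderiv ℝ s (z.1.1, φ z.1.1 z.1.2.1 z.2) (0, 1) :=
    (hd.comp hpath).clm_apply continuous_const
  have hb : Continuous fun z : (ℝ × ℝ × ℝ) × ℝ =>
      fderiv ℝ s (z.1.1, φ z.1.1 z.1.2.1 z.2) (1, 0) :=
    (hd.comp hpath).clm_apply continuous_const
  have hI : Continuous fun z : (ℝ × ℝ × ℝ) × ℝ =>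
      ∫ ρ in (0 : ℝ)..z.2, fderiv ℝ s (z.1.1, φ z.1.1 z.1.2.1 ρ) (0, 1) :=
    intervalIntegral.continuous_parametric_intervalIntegral_of_continuous
      (f := fun (z : (ℝ × ℝ × ℝ) × ℝ) ρ => fderiv ℝ s (z.1.1, φ z.1.1 z.1.2.1 ρ) (0, 1))
      (ha.comp (f := fun z : ((ℝ × ℝ × ℝ) × ℝ) × ℝ => (z.1.1, z.2)) (by fun_prop)) continuous_snd
  have hE : Continuous fun q : ℝ × ℝ × ℝ =>
      ∫ r in (0 : ℝ)..q.2.2, fderiv ℝ s (q.1, φ q.1 q.2.1 r) (0, 1) :=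
    hI.comp (f := fun q : ℝ × ℝ × ℝ => (q, q.2.2)) (by fun_prop)
  have hG : Continuous fun q : ℝ × ℝ × ℝ =>
      ∫ r in (0 : ℝ)..q.2.2, fderiv ℝ s (q.1, φ q.1 q.2.1 r) (1, 0) *
        Real.exp (-∫ ρ in (0 : ℝ)..r, fderiv ℝ s (q.1, φ q.1 q.2.1 ρ) (0, 1)) :=
    intervalIntegral.continuous_parametric_intervalIntegral_of_continuous
      (f := fun (q : ℝ × ℝ × ℝ) r => fderiv ℝ s (q.1, φ q.1 q.2.1 r) (1, 0) *
        Real.exp (-∫ ρ in (0 : ℝ)..r, fderiv ℝ s (q.1, φ q.1 q.2.1 ρ) (0, 1)))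
      (hb.mul (Real.continuous_exp.comp hI.neg)) (by fun_prop)
  have hH : Continuous fun q : ℝ × ℝ × ℝ => s (q.1, φ q.1 q.2.1 q.2.2) :=
    hs.continuous.comp (continuous_fst.prodMk hc)
  simp only [flowDeriv_self]
  exact ((((Real.continuous_exp.comp hE).mul hG).smul continuous_const).add
    ((Real.continuous_exp.comp hE).smul continuous_const)).add (hH.smul continuous_const)

/-- Bootstrapping: the explicit derivative on the diagonal is built from `fderiv ℝ s` and the flow,
both now `C¹`, by integrals and exponentials. -/
lemma contDiff_two_flow (hs : ContDiff ℝ 2 s) (h0 : ∀ τ y, φ τ y 0 = y)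
    (hφ : ∀ τ y t, HasDerivAt (φ τ y) (s (τ, φ τ y t)) t)
    (hK₁ : ∀ q, |fderiv ℝ s q (1, 0)| ≤ K) (hK₂ : ∀ q, |fderiv ℝ s q (0, 1)| ≤ K) :
    ContDiff ℝ 2 (fun q : ℝ × ℝ × ℝ => φ q.1 q.2.1 q.2.2) := by
  have hs1 : ContDiff ℝ 1 s := hs.of_le (by norm_num)
  have hc := contDiff_one_flow hs1 h0 hφ hK₁ hK₂
  have hd : ContDiff ℝ 1 (fderiv ℝ s) := hs.fderiv_right (by norm_num)
  have hpath : ContDiff ℝ 1 fun z : (ℝ × ℝ × ℝ) × ℝ => (z.1.1, φ z.1.1 z.1.2.1 z.2) :=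
    (by fun_prop : ContDiff ℝ 1 fun z : (ℝ × ℝ × ℝ) × ℝ => z.1.1).prodMk
      (hc.comp (f := fun z : (ℝ × ℝ × ℝ) × ℝ => (z.1.1, z.1.2.1, z.2)) (by fun_prop))
  have ha : ContDiff ℝ 1 fun z : (ℝ × ℝ × ℝ) × ℝ =>
      fderiv ℝ s (z.1.1, φ z.1.1 z.1.2.1 z.2) (0, 1) :=
    (hd.comp hpath).clm_apply contDiff_const
  have hb : ContDiff ℝ 1 fun z : (ℝ × ℝ × ℝ) × ℝ =>
      fderiv ℝ s (z.1.1, φ z.1.1 z.1.2.1 z.2) (1, 0) :=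
    (hd.comp hpath).clm_apply contDiff_const
  have hI : ContDiff ℝ 1 fun z : (ℝ × ℝ × ℝ) × ℝ =>
      ∫ ρ in (0 : ℝ)..z.2, fderiv ℝ s (z.1.1, φ z.1.1 z.1.2.1 ρ) (0, 1) :=
    ContDiff.integral_upper (h := fun (z : (ℝ × ℝ × ℝ) × ℝ) ρ =>
        fderiv ℝ s (z.1.1, φ z.1.1 z.1.2.1 ρ) (0, 1))
      (ha.comp (f := fun z : ((ℝ × ℝ × ℝ) × ℝ) × ℝ => (z.1.1, z.2)) (by fun_prop)) contDiff_snd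
  have hE : ContDiff ℝ 1 fun q : ℝ × ℝ × ℝ =>
      ∫ r in (0 : ℝ)..q.2.2, fderiv ℝ s (q.1, φ q.1 q.2.1 r) (0, 1) :=
    hI.comp (f := fun q : ℝ × ℝ × ℝ => (q, q.2.2)) (by fun_prop)
  have hG : ContDiff ℝ 1 fun q : ℝ × ℝ × ℝ =>
      ∫ r in (0 : ℝ)..q.2.2, fderiv ℝ s (q.1, φ q.1 q.2.1 r) (1, 0) *
        Real.exp (-∫ ρ in (0 : ℝ)..r, fderiv ℝ s (q.1, φ q.1 q.2.1 ρ) (0, 1)) :=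
    ContDiff.integral_upper
      (h := fun (q : ℝ × ℝ × ℝ) r => fderiv ℝ s (q.1, φ q.1 q.2.1 r) (1, 0) *
        Real.exp (-∫ ρ in (0 : ℝ)..r, fderiv ℝ s (q.1, φ q.1 q.2.1 ρ) (0, 1)))
      (hb.mul (Real.contDiff_exp.comp hI.neg)) (by fun_prop)
  have hH : ContDiff ℝ 1 fun q : ℝ × ℝ × ℝ => s (q.1, φ q.1 q.2.1 q.2.2) :=
    hs1.comp (contDiff_fst.prodMk hc)
  have h := (contDiff_succ_iff_hasFDerivAt (𝕜 := ℝ) (n := 1)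
    (f := fun q : ℝ × ℝ × ℝ => φ q.1 q.2.1 q.2.2)).2 ⟨fun q => flowDeriv s φ q q, ?_,
      hasFDerivAt_flow hs1 h0 hφ hK₁ hK₂⟩
  · exact h.of_le (by norm_num)
  · simp only [flowDeriv_self, Nat.cast_one]
    exact ((((Real.contDiff_exp.comp hE).mul hG).smul contDiff_const).add
      ((Real.contDiff_exp.comp hE).smul contDiff_const)).add (hH.smul contDiff_const)

end SmoothFlow

/-! ### Localisation to a parameter interval -/

open Classical in
/-- The global solution of `u' = v u`, `u 0 = ξ`, if there is one. -/
noncomputable def globalFlow (v : ℝ → ℝ) (ξ : ℝ) : ℝ → ℝ :=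
  if h : ∃ u : ℝ → ℝ, u 0 = ξ ∧ ∀ t, HasDerivAt u (v (u t)) t then h.choose else fun _ => 0

lemma globalFlow_spec {v : ℝ → ℝ} {K : NNReal} (hv : LipschitzWith K v) (hc : ContDiff ℝ 1 v)
    (ξ : ℝ) : globalFlow v ξ 0 = ξ ∧ ∀ t, HasDerivAt (globalFlow v ξ) (v (globalFlow v ξ t)) t := by
  have h := exists_global_solution hv hc ξ
  rw [globalFlow, dif_pos h]
  exact h.choose_spec

lemma globalFlow_unique {v : ℝ → ℝ} {K : NNReal} (hv : LipschitzWith K v) (hc : ContDiff ℝ 1 v)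
    {ξ : ℝ} {u : ℝ → ℝ} (h0 : u 0 = ξ) (hu : ∀ t, HasDerivAt u (v (u t)) t) :
    u = globalFlow v ξ :=
  global_solution_unique hv hu (globalFlow_spec hv hc ξ).2 (t₀ := 0)
    (h0.trans (globalFlow_spec hv hc ξ).1.symm)

lemma globalFlow_add {v : ℝ → ℝ} {K : NNReal} (hv : LipschitzWith K v) (hc : ContDiff ℝ 1 v)
    (ξ a t : ℝ) : globalFlow v (globalFlow v ξ a) t = globalFlow v ξ (a + t) := by
  have := globalFlow_unique hv hc (ξ := globalFlow v ξ a)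
    (u := fun t => globalFlow v ξ (a + t)) (by simp) fun t =>
      ((globalFlow_spec hv hc ξ).2 (a + t)).comp_const_add a t
  rw [← this]

/-- Composing `σ` with `r` in the parameter gives a field defined for all parameters, with bounded
first derivatives, that agrees with `σ` near `τ₀`. The derivative of `r` is bounded because `r` is
constant off a compact set. -/
lemma exists_smooth_retraction {I : Set ℝ} (hI : IsOpen I) {τ₀ : ℝ} (hτ₀ : τ₀ ∈ I) :
    ∃ r : ℝ → ℝ, ContDiff ℝ 2 r ∧ (∃ C, ∀ τ, |deriv r τ| ≤ C) ∧ (∀ τ, r τ ∈ I) ∧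
      ∀ᶠ τ in 𝓝 τ₀, r τ = τ := by
  obtain ⟨ε, hε, hball⟩ := Metric.isOpen_iff.1 hI τ₀ hτ₀
  let f : ContDiffBump τ₀ := ⟨ε / 4, ε / 2, by positivity, by linarith⟩
  have hf : ContDiff ℝ 2 f := f.contDiff
  have hr : ContDiff ℝ 2 fun τ => f τ * (τ - τ₀) := hf.mul (by fun_prop)
  refine ⟨fun τ => τ₀ + f τ * (τ - τ₀), contDiff_const.add hr, ?_, fun τ => hball ?_, ?_⟩
  · have hcs : HasCompactSupport fun τ => f τ * (τ - τ₀) := f.hasCompactSupport.mul_right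
    obtain ⟨C, hC⟩ := hcs.deriv.exists_bound_of_continuous
      (hr.continuous_deriv (by norm_num))
    refine ⟨C, fun τ => ?_⟩
    rw [deriv_const_add]
    exact hC τ
  · rw [Metric.mem_ball, Real.dist_eq, add_sub_cancel_left, abs_mul, abs_of_nonneg (f.nonneg)]
    by_cases h : dist τ τ₀ < ε / 2
    · have h1 : f τ ≤ 1 := f.le_one
      rw [Real.dist_eq] at h
      nlinarith [abs_nonneg (τ - τ₀), f.nonneg (x := τ)]
    · rw [f.zero_of_le_dist (not_lt.1 h)]; simpa using hε
  · filter_upwards [f.eventuallyEq_one] with τ hτ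
    rw [hτ]; simp

/-! ### The flow of `σ`: partial derivatives and bounds -/

section FlowOn

variable {I : Set ℝ} {σ : ℝ → ℝ → ℝ} {K : ℝ}

/-- The standing assumptions on the diffusion coefficient. -/
structure FlowCoeff (I : Set ℝ) (σ : ℝ → ℝ → ℝ) (K : ℝ) : Prop where
  isOpen : IsOpen I
  contDiffOn : ContDiffOn ℝ 2 (fun q : ℝ × ℝ => σ q.1 q.2) (I ×ˢ univ)
  nonneg : 0 ≤ K
  deriv_fst_le : ∀ t ∈ I, ∀ ξ, |deriv (fun r => σ r ξ) t| ≤ K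
  deriv_snd_le : ∀ t ∈ I, ∀ ξ, |deriv (fun y => σ t y) ξ| ≤ K

lemma FlowCoeff.contDiff_slice (h : FlowCoeff I σ K) {τ : ℝ} (hτ : τ ∈ I) :
    ContDiff ℝ 2 (σ τ) :=
  h.contDiffOn.comp_contDiff (f := fun y : ℝ => (τ, y)) (by fun_prop)
    fun _ => ⟨hτ, mem_univ _⟩

lemma FlowCoeff.lipschitzWith (h : FlowCoeff I σ K) {τ : ℝ} (hτ : τ ∈ I) :
    LipschitzWith ⟨K, h.nonneg⟩ (σ τ) :=
  lipschitzWith_of_nnnorm_deriv_le ((h.contDiff_slice hτ).differentiable two_ne_zero)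
    fun ξ => h.deriv_snd_le τ hτ ξ

/-- The flow of `u' = σ τ u`. -/
noncomputable def flow (σ : ℝ → ℝ → ℝ) (τ : ℝ) : ℝ → ℝ → ℝ := globalFlow (σ τ)

lemma FlowCoeff.flow_zero (h : FlowCoeff I σ K) {τ : ℝ} (hτ : τ ∈ I) (ξ : ℝ) :
    flow σ τ ξ 0 = ξ :=
  (globalFlow_spec (h.lipschitzWith hτ) ((h.contDiff_slice hτ).of_le (by norm_num)) ξ).1

lemma FlowCoeff.hasDerivAt_flow (h : FlowCoeff I σ K) {τ : ℝ} (hτ : τ ∈ I) (ξ t : ℝ) :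
    HasDerivAt (flow σ τ ξ) (σ τ (flow σ τ ξ t)) t :=
  (globalFlow_spec (h.lipschitzWith hτ) ((h.contDiff_slice hτ).of_le (by norm_num)) ξ).2 t

lemma FlowCoeff.isFlowLine (h : FlowCoeff I σ K) {τ : ℝ} (hτ : τ ∈ I) (ξ : ℝ) :
    IsFlowLine σ τ ξ (flow σ τ ξ) :=
  ⟨h.flow_zero hτ ξ, h.hasDerivAt_flow hτ ξ⟩

lemma FlowCoeff.eq_flow (h : FlowCoeff I σ K) {τ : ℝ} (hτ : τ ∈ I) {ξ : ℝ} {u : ℝ → ℝ}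
    (hu : IsFlowLine σ τ ξ u) : u = flow σ τ ξ :=
  globalFlow_unique (h.lipschitzWith hτ) ((h.contDiff_slice hτ).of_le (by norm_num)) hu.1 hu.2

lemma FlowCoeff.flow_flow (h : FlowCoeff I σ K) {τ : ℝ} (hτ : τ ∈ I) (ξ a t : ℝ) :
    flow σ τ (flow σ τ ξ a) t = flow σ τ ξ (a + t) :=
  globalFlow_add (h.lipschitzWith hτ) ((h.contDiff_slice hτ).of_le (by norm_num)) ξ a t

lemma FlowCoeff.flow_neg (h : FlowCoeff I σ K) {τ : ℝ} (hτ : τ ∈ I) (ξ t : ℝ) :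
    flow σ τ (flow σ τ ξ t) (-t) = ξ := by
  rw [h.flow_flow hτ, add_neg_cancel, h.flow_zero hτ]

/-- Near a parameter in `I`, the flow is smooth and its `τ`-derivative is bounded. -/
lemma FlowCoeff.flow_local (h : FlowCoeff I σ K) {q : ℝ × ℝ × ℝ} (hq : q.1 ∈ I) :
    ContDiffAt ℝ 2 (fun q : ℝ × ℝ × ℝ => flow σ q.1 q.2.1 q.2.2) q ∧
      |fderiv ℝ (fun q : ℝ × ℝ × ℝ => flow σ q.1 q.2.1 q.2.2) q (1, 0, 0)| ≤
        Real.exp (K * |q.2.2|) * (K * Real.exp (K * |q.2.2|) * |q.2.2|) := by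
  obtain ⟨r, hr, ⟨C, hC⟩, hrI, hrid⟩ := exists_smooth_retraction h.isOpen hq
  set s : ℝ × ℝ → ℝ := fun p => σ (r p.1) p.2 with hs
  have hsc : ContDiff ℝ 2 s :=
    h.contDiffOn.comp_contDiff (f := fun p : ℝ × ℝ => (r p.1, p.2))
      ((hr.comp contDiff_fst).prodMk contDiff_snd) fun p => ⟨hrI p.1, mem_univ _⟩
  have hC0 : 0 ≤ C := (abs_nonneg _).trans (hC 0)
  have hd : ∀ p, HasFDerivAt s (fderiv ℝ s p) p := fun p =>
    (hsc.differentiable two_ne_zero p).hasFDerivAt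
  have e₁ : ∀ p, fderiv ℝ s p (1, 0) = deriv (fun t => σ t p.2) (r p.1) * deriv r p.1 := fun p => by
    have h1 : HasDerivAt (fun t => s (t, p.2)) (fderiv ℝ s p (1, 0)) p.1 :=
      (hd p).comp_hasDerivAt (f := fun t : ℝ => (t, p.2)) p.1
        ((hasDerivAt_id p.1).prodMk (hasDerivAt_const p.1 p.2))
    have h2 : DifferentiableAt ℝ (fun t => σ t p.2) (r p.1) := by
      have := (h.contDiffOn.contDiffAt ((h.isOpen.prod isOpen_univ).mem_nhds
        (x := (r p.1, p.2)) ⟨hrI p.1, mem_univ _⟩)).differentiableAt two_ne_zero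
      exact this.comp (f := fun t : ℝ => (t, p.2)) (r p.1) (by fun_prop)
    have h3 : HasDerivAt (fun t => s (t, p.2)) _ p.1 :=
      h2.hasDerivAt.comp p.1 (hr.differentiable two_ne_zero p.1).hasDerivAt
    exact h1.unique h3
  have e₂ : ∀ p, fderiv ℝ s p (0, 1) = deriv (fun y => σ (r p.1) y) p.2 := fun p => by
    have h1 : HasDerivAt (fun y => s (p.1, y)) (fderiv ℝ s p (0, 1)) p.2 :=
      (hd p).comp_hasDerivAt (f := fun y : ℝ => (p.1, y)) p.2
        ((hasDerivAt_const p.2 p.1).prodMk (hasDerivAt_id p.2))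
    exact h1.deriv.symm
  have b₂ : ∀ p, |fderiv ℝ s p (0, 1)| ≤ K := fun p => by
    rw [e₂]; exact h.deriv_snd_le _ (hrI _) _
  -- One constant serving both partial derivatives of the modified field; it depends on the
  -- retraction and is used only qualitatively.
  have hK₁ : ∀ p, |fderiv ℝ s p (1, 0)| ≤ K * C + K := fun p => by
    rw [e₁, abs_mul]
    have := mul_le_mul (h.deriv_fst_le _ (hrI p.1) p.2) (hC p.1) (abs_nonneg _) h.nonneg
    have := h.nonneg
    linarith
  have hK₂ : ∀ p, |fderiv ℝ s p (0, 1)| ≤ K * C + K := fun p =>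
    (b₂ p).trans (by have := mul_nonneg h.nonneg hC0; linarith)
  set φ : ℝ → ℝ → ℝ → ℝ := fun τ => flow σ (r τ) with hφ
  have h0 : ∀ τ y, φ τ y 0 = y := fun τ y => h.flow_zero (hrI τ) y
  have hφd : ∀ τ y t, HasDerivAt (φ τ y) (s (τ, φ τ y t)) t := fun τ y t =>
    h.hasDerivAt_flow (hrI τ) y t
  have hev : (fun q : ℝ × ℝ × ℝ => flow σ q.1 q.2.1 q.2.2) =ᶠ[𝓝 q]
      fun q => φ q.1 q.2.1 q.2.2 := by
    filter_upwards [(continuous_fst.tendsto q).eventually hrid] with p hp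
    simp only [hφ, hp]
  refine ⟨(contDiff_two_flow hsc h0 hφd hK₁ hK₂).contDiffAt.congr_of_eventuallyEq hev, ?_⟩
  rw [hev.fderiv_eq, (hasFDerivAt_flow (hsc.of_le (by norm_num)) h0 hφd hK₁ hK₂ q).fderiv,
    flowDeriv_self]
  simp only [add_apply, smul_apply, ContinuousLinearMap.coe_fst', ContinuousLinearMap.comp_apply,
    ContinuousLinearMap.coe_snd', smul_eq_mul, mul_one, mul_zero, add_zero]
  -- At the parameter `q.1` itself `r' = 1`, and the derivative of the flow there involves no other
  -- parameter. Hence the final bound contains `K` alone.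
  have b₁ : ∀ y, |fderiv ℝ s (q.1, y) (1, 0)| ≤ K := fun y => by
    rw [e₁]
    have : deriv r q.1 = 1 := by
      have hrid' : r =ᶠ[𝓝 q.1] id := hrid
      rw [hrid'.deriv_eq, deriv_id]
    rw [this, mul_one]
    exact h.deriv_fst_le _ (hrI _) _
  rw [abs_mul, abs_of_pos (Real.exp_pos _)]
  exact mul_le_mul (exp_integral_le (fun _ => b₂ _) _)
    (abs_integral_mul_exp_le (fun _ => b₂ _) (fun _ => b₁ _) _) (abs_nonneg _) (Real.exp_pos _).le

lemma FlowCoeff.contDiffOn_flow (h : FlowCoeff I σ K) :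
    ContDiffOn ℝ 2 (fun q : ℝ × ℝ × ℝ => flow σ q.1 q.2.1 q.2.2) (I ×ˢ univ) :=
  fun _ hq => (h.flow_local hq.1).1.contDiffWithinAt

/-- The slice `σ τ` is viewed as a field constant in its parameter, so only the bound on `∂σ/∂ξ`
enters. -/
lemma FlowCoeff.abs_flow_sub_le (h : FlowCoeff I σ K) {τ : ℝ} (hτ : τ ∈ I) (y y' t : ℝ) :
    |flow σ τ y' t - flow σ τ y t| ≤ Real.exp (K * |t|) * |y' - y| := by
  have hs : ContDiff ℝ 1 fun p : ℝ × ℝ => σ τ p.2 :=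
    ((h.contDiff_slice hτ).of_le (by norm_num)).comp contDiff_snd
  have hd : ∀ p : ℝ × ℝ, fderiv ℝ (fun p : ℝ × ℝ => σ τ p.2) p =
      (deriv (σ τ) p.2) • ContinuousLinearMap.snd ℝ ℝ ℝ := fun p => by
    have h1 := ((h.contDiff_slice hτ).differentiable two_ne_zero p.2).hasDerivAt
    exact (h1.comp_hasFDerivAt p hasFDerivAt_snd).fderiv
  have := _root_.abs_flow_sub_le (s := fun p : ℝ × ℝ => σ τ p.2) (φ := fun _ => flow σ τ) (K := K)
    hs (fun _ => h.flow_zero hτ) (fun _ => h.hasDerivAt_flow hτ)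
    (fun q => by rw [hd]; simpa using h.nonneg)
    (fun q => by rw [hd]; simpa using h.deriv_snd_le τ hτ q.2) 0 y 0 y' t
  simpa using this

section Partials

variable {φ : ℝ → ℝ → ℝ → ℝ} {q : ℝ × ℝ × ℝ} {L : ℝ × ℝ × ℝ →L[ℝ] ℝ}

lemma hasDerivAt_tau (h : HasFDerivAt (fun q : ℝ × ℝ × ℝ => φ q.1 q.2.1 q.2.2) L q) :
    HasDerivAt (fun τ => φ τ q.2.1 q.2.2) (L (1, 0, 0)) q.1 :=
  h.comp_hasDerivAt (f := fun τ : ℝ => (τ, q.2.1, q.2.2)) q.1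
    ((hasDerivAt_id q.1).prodMk (hasDerivAt_const q.1 (q.2.1, q.2.2)))

lemma hasDerivAt_xi (h : HasFDerivAt (fun q : ℝ × ℝ × ℝ => φ q.1 q.2.1 q.2.2) L q) :
    HasDerivAt (fun y => φ q.1 y q.2.2) (L (0, 1, 0)) q.2.1 :=
  h.comp_hasDerivAt (f := fun y : ℝ => (q.1, y, q.2.2)) q.2.1
    ((hasDerivAt_const q.2.1 q.1).prodMk
      ((hasDerivAt_id q.2.1).prodMk (hasDerivAt_const q.2.1 q.2.2)))

lemma hasDerivAt_t (h : HasFDerivAt (fun q : ℝ × ℝ × ℝ => φ q.1 q.2.1 q.2.2) L q) :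
    HasDerivAt (fun t => φ q.1 q.2.1 t) (L (0, 0, 1)) q.2.2 :=
  h.comp_hasDerivAt (f := fun t : ℝ => (q.1, q.2.1, t)) q.2.2
    ((hasDerivAt_const q.2.2 q.1).prodMk
      ((hasDerivAt_const q.2.2 q.2.1).prodMk (hasDerivAt_id q.2.2)))

end Partials

lemma FlowCoeff.hasFDerivAt_flow (h : FlowCoeff I σ K) {q : ℝ × ℝ × ℝ} (hq : q.1 ∈ I) :
    HasFDerivAt (fun q : ℝ × ℝ × ℝ => flow σ q.1 q.2.1 q.2.2)
      (fderiv ℝ (fun q : ℝ × ℝ × ℝ => flow σ q.1 q.2.1 q.2.2) q) q :=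
  ((h.flow_local hq).1.differentiableAt two_ne_zero).hasFDerivAt

lemma FlowCoeff.isOpen_dom (h : FlowCoeff I σ K) :
    IsOpen (I ×ˢ (univ : Set (ℝ × ℝ))) := h.isOpen.prod isOpen_univ

lemma FlowCoeff.contDiffOn_fderiv_flow (h : FlowCoeff I σ K) (v : ℝ × ℝ × ℝ) :
    ContDiffOn ℝ 1 (fun q => fderiv ℝ (fun q : ℝ × ℝ × ℝ => flow σ q.1 q.2.1 q.2.2) q v)
      (I ×ˢ univ) :=
  (h.contDiffOn_flow.fderiv_of_isOpen h.isOpen_dom (by norm_num)).clm_apply contDiffOn_const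

lemma FlowCoeff.contDiffOn_partialTau (h : FlowCoeff I σ K) :
    ContDiffOn ℝ 1 (fun q : ℝ × ℝ × ℝ => partialTau (flow σ) q.1 q.2.1 q.2.2) (I ×ˢ univ) :=
  (h.contDiffOn_fderiv_flow (1, 0, 0)).congr fun _ hq =>
    (hasDerivAt_tau (h.hasFDerivAt_flow hq.1)).deriv

lemma FlowCoeff.contDiffOn_partialXi (h : FlowCoeff I σ K) :
    ContDiffOn ℝ 1 (fun q : ℝ × ℝ × ℝ => partialXi (flow σ) q.1 q.2.1 q.2.2) (I ×ˢ univ) :=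
  (h.contDiffOn_fderiv_flow (0, 1, 0)).congr fun _ hq =>
    (hasDerivAt_xi (h.hasFDerivAt_flow hq.1)).deriv

lemma FlowCoeff.partialT_flow (h : FlowCoeff I σ K) {τ : ℝ} (hτ : τ ∈ I) (ξ t : ℝ) :
    partialT (flow σ) τ ξ t = σ τ (flow σ τ ξ t) := (h.hasDerivAt_flow hτ ξ t).deriv

lemma FlowCoeff.contDiffOn_partialT (h : FlowCoeff I σ K) :
    ContDiffOn ℝ 2 (fun q : ℝ × ℝ × ℝ => partialT (flow σ) q.1 q.2.1 q.2.2) (I ×ˢ univ) := by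
  have : ContDiffOn ℝ 2 (fun q : ℝ × ℝ × ℝ => σ q.1 (flow σ q.1 q.2.1 q.2.2)) (I ×ˢ univ) :=
    h.contDiffOn.comp (f := fun q : ℝ × ℝ × ℝ => (q.1, flow σ q.1 q.2.1 q.2.2))
      (contDiffOn_fst.prodMk h.contDiffOn_flow) fun q hq => ⟨hq.1, mem_univ _⟩
  exact this.congr fun q hq => h.partialT_flow hq.1 _ _

lemma FlowCoeff.contDiffOn_partialTT (h : FlowCoeff I σ K) :
    ContDiffOn ℝ 1 (fun q : ℝ × ℝ × ℝ => partialT (partialT (flow σ)) q.1 q.2.1 q.2.2)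
      (I ×ˢ univ) :=
  ((h.contDiffOn_partialT.fderiv_of_isOpen h.isOpen_dom (by norm_num)).clm_apply
    (contDiffOn_const (c := ((0 : ℝ), (0 : ℝ), (1 : ℝ))))).congr fun q hq =>
      (hasDerivAt_t ((h.contDiffOn_partialT.contDiffAt
        (h.isOpen_dom.mem_nhds hq)).differentiableAt two_ne_zero).hasFDerivAt).deriv

lemma FlowCoeff.partialTT_flow (h : FlowCoeff I σ K) {τ : ℝ} (hτ : τ ∈ I) (ξ t : ℝ) :
    partialT (partialT (flow σ)) τ ξ t =
      deriv (σ τ) (flow σ τ ξ t) * σ τ (flow σ τ ξ t) := by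
  have e : (fun r => partialT (flow σ) τ ξ r) = fun r => σ τ (flow σ τ ξ r) :=
    funext fun r => h.partialT_flow hτ ξ r
  rw [partialT, e]
  exact (((h.contDiff_slice hτ).differentiable two_ne_zero _).hasDerivAt.comp t
    (h.hasDerivAt_flow hτ ξ t)).deriv

lemma FlowCoeff.hasDerivAt_xi (h : FlowCoeff I σ K) {τ : ℝ} (hτ : τ ∈ I) (ξ t : ℝ) :
    HasDerivAt (fun y => flow σ τ y t) (partialXi (flow σ) τ ξ t) ξ :=
  (_root_.hasDerivAt_xi (h.hasFDerivAt_flow (q := (τ, ξ, t)) hτ)).differentiableAt.hasDerivAt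

lemma FlowCoeff.abs_partialXi_le (h : FlowCoeff I σ K) {τ : ℝ} (hτ : τ ∈ I) (ξ t : ℝ) :
    |partialXi (flow σ) τ ξ t| ≤ Real.exp (K * |t|) := by
  have hL : LipschitzWith ⟨Real.exp (K * |t|), (Real.exp_pos _).le⟩ (fun y => flow σ τ y t) :=
    LipschitzWith.of_dist_le_mul fun y y' => h.abs_flow_sub_le hτ y' y t
  exact norm_deriv_le_of_lipschitz hL

/-- Chain rule for the flow run forth and back. It shows that `φ_ξ` never vanishes and that its
reciprocal is again some `φ_ξ`, with the same bound. -/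
lemma FlowCoeff.partialXi_mul (h : FlowCoeff I σ K) {τ : ℝ} (hτ : τ ∈ I) (ξ t : ℝ) :
    partialXi (flow σ) τ (flow σ τ ξ t) (-t) * partialXi (flow σ) τ ξ t = 1 := by
  have h1 : HasDerivAt (fun y => flow σ τ (flow σ τ y t) (-t))
      (partialXi (flow σ) τ (flow σ τ ξ t) (-t) * partialXi (flow σ) τ ξ t) ξ :=
    HasDerivAt.comp (h₂ := fun y => flow σ τ y (-t)) (h := fun y => flow σ τ y t) ξ
      (h.hasDerivAt_xi hτ (flow σ τ ξ t) (-t)) (h.hasDerivAt_xi hτ ξ t)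
  simp only [h.flow_neg hτ] at h1
  exact h1.unique (hasDerivAt_id ξ)

lemma FlowCoeff.partialXi_ne_zero (h : FlowCoeff I σ K) {τ : ℝ} (hτ : τ ∈ I) (ξ t : ℝ) :
    partialXi (flow σ) τ ξ t ≠ 0 := right_ne_zero_of_mul_eq_one (h.partialXi_mul hτ ξ t)

lemma FlowCoeff.abs_inv_partialXi_le (h : FlowCoeff I σ K) {τ : ℝ} (hτ : τ ∈ I) (ξ t : ℝ) :
    |(partialXi (flow σ) τ ξ t)⁻¹| ≤ Real.exp (K * |t|) := by
  rw [← eq_inv_of_mul_eq_one_left (h.partialXi_mul hτ ξ t)]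
  simpa using h.abs_partialXi_le hτ (flow σ τ ξ t) (-t)

lemma FlowCoeff.abs_partialTau_le (h : FlowCoeff I σ K) {τ : ℝ} (hτ : τ ∈ I) (ξ t : ℝ) :
    |partialTau (flow σ) τ ξ t| ≤
      Real.exp (K * |t|) * (K * Real.exp (K * |t|) * |t|) := by
  have := (hasDerivAt_tau (h.hasFDerivAt_flow (q := (τ, ξ, t)) hτ)).deriv
  rw [partialTau, this]
  exact (h.flow_local (q := (τ, ξ, t)) hτ).2

end FlowOn

/-! ### Stability of local Lipschitz and linear growth conditions -/

section Coefficients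

lemma LocalLipschitzCond.comp {f g : ℝ → ℝ → ℝ} (hf : LocalLipschitzCond f)
    (hg : LocalLipschitzCond g) (hg' : LinearGrowthCond g) :
    LocalLipschitzCond (fun t y => f t (g t y)) := by
  intro p hp
  obtain ⟨c, hc, hgc⟩ := hg'
  obtain ⟨L, hL, hgL⟩ := hg p hp
  -- Linear growth confines `g` to radius `c (1 + p)`; the `+ 1` makes the radius positive.
  obtain ⟨L', hL', hfL⟩ := hf (c * (1 + p) + 1) (by positivity)
  refine ⟨L' * L, by positivity, fun t ht ξ hξ ζ hζ => ?_⟩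
  have hb : ∀ ξ ∈ Icc (-p) p, g t ξ ∈ Icc (-(c * (1 + p) + 1)) (c * (1 + p) + 1) := fun ξ hξ => by
    refine abs_le.1 ((hgc t ht ξ).trans ?_)
    have := mul_le_mul_of_nonneg_left (abs_le.2 hξ) hc
    linarith
  refine (hfL t ht _ (hb ξ hξ) _ (hb ζ hζ)).trans ?_
  rw [mul_assoc]
  exact mul_le_mul_of_nonneg_left (hgL t ht ξ hξ ζ hζ) hL'

lemma LinearGrowthCond.comp {f g : ℝ → ℝ → ℝ} (hf : LinearGrowthCond f)
    (hg : LinearGrowthCond g) : LinearGrowthCond (fun t y => f t (g t y)) := by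
  obtain ⟨c, hc, hfc⟩ := hf
  obtain ⟨d, hd, hgd⟩ := hg
  refine ⟨c * (1 + d), by positivity, fun t ht ξ => (hfc t ht _).trans ?_⟩
  rw [mul_assoc]
  refine mul_le_mul_of_nonneg_left ?_ hc
  have := hgd t ht ξ
  have := abs_nonneg ξ
  linarith

lemma LinearGrowthCond.mul_bounded {f g : ℝ → ℝ → ℝ} (hf : LinearGrowthCond f) {M : ℝ}
    (hg : ∀ t ∈ Icc (0 : ℝ) 1, ∀ y, |g t y| ≤ M) : LinearGrowthCond (fun t y => f t y * g t y) := by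
  obtain ⟨c, hc, hfc⟩ := hf
  have hM : 0 ≤ M := (abs_nonneg _).trans (hg 0 ⟨le_rfl, zero_le_one⟩ 0)
  refine ⟨c * M, by positivity, fun t ht ξ => ?_⟩
  rw [abs_mul]
  calc |f t ξ| * |g t ξ| ≤ (c * (1 + |ξ|)) * M :=
        mul_le_mul (hfc t ht ξ) (hg t ht ξ) (abs_nonneg _) (by positivity)
    _ = _ := by ring

lemma LinearGrowthCond.of_bounded {g : ℝ → ℝ → ℝ} {M : ℝ}
    (hg : ∀ t ∈ Icc (0 : ℝ) 1, ∀ y, |g t y| ≤ M) : LinearGrowthCond g := by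
  have hM : 0 ≤ M := (abs_nonneg _).trans (hg 0 ⟨le_rfl, zero_le_one⟩ 0)
  refine ⟨M, hM, fun t ht ξ => (hg t ht ξ).trans ?_⟩
  have := mul_nonneg hM (abs_nonneg ξ)
  linarith

lemma LocalLipschitzCond.mul {f g : ℝ → ℝ → ℝ} (hf : LocalLipschitzCond f)
    (hg : LocalLipschitzCond g) (hf' : LinearGrowthCond f) (hg' : LinearGrowthCond g) :
    LocalLipschitzCond (fun t y => f t y * g t y) := by
  intro p hp
  obtain ⟨c, hc, hfc⟩ := hf'
  obtain ⟨d, hd, hgd⟩ := hg'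
  obtain ⟨L, hL, hfL⟩ := hf p hp
  obtain ⟨L', hL', hgL⟩ := hg p hp
  refine ⟨c * (1 + p) * L' + d * (1 + p) * L, by positivity, fun t ht ξ hξ ζ hζ => ?_⟩
  have h1 : |f t ξ| ≤ c * (1 + p) :=
    (hfc t ht ξ).trans (mul_le_mul_of_nonneg_left (by linarith [abs_le.2 hξ]) hc)
  have h2 : |g t ζ| ≤ d * (1 + p) :=
    (hgd t ht ζ).trans (mul_le_mul_of_nonneg_left (by linarith [abs_le.2 hζ]) hd)
  have e : f t ξ * g t ξ - f t ζ * g t ζ =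
      f t ξ * (g t ξ - g t ζ) + g t ζ * (f t ξ - f t ζ) := by ring
  rw [e]
  refine (abs_add_le _ _).trans ?_
  rw [abs_mul, abs_mul, add_mul, mul_assoc (c * (1 + p)), mul_assoc (d * (1 + p))]
  exact add_le_add
    (mul_le_mul h1 (hgL t ht ξ hξ ζ hζ) (abs_nonneg _) (by positivity))
    (mul_le_mul h2 (hfL t ht ξ hξ ζ hζ) (abs_nonneg _) (by positivity))

variable {I : Set ℝ} {x : ℝ → ℝ} {F : ℝ × ℝ × ℝ → ℝ}

lemma continuousOn_along_path (hI : Icc (0 : ℝ) 1 ⊆ I) (hx : ContinuousOn x (Icc 0 1))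
    (hF : ContinuousOn F (I ×ˢ univ)) :
    ContinuousOn (fun q : ℝ × ℝ => F (q.1, q.2, x q.1)) (Icc (0 : ℝ) 1 ×ˢ univ) :=
  hF.comp (f := fun q : ℝ × ℝ => (q.1, q.2, x q.1))
    (continuousOn_fst.prodMk (continuousOn_snd.prodMk
      (hx.comp continuousOn_fst fun _ hq => hq.1))) fun _ hq => ⟨hI hq.1, mem_univ _⟩

lemma localLipschitzCond_along_path (hIo : IsOpen I) (hI : Icc (0 : ℝ) 1 ⊆ I)
    (hx : ContinuousOn x (Icc 0 1)) (hF : ContDiffOn ℝ 1 F (I ×ˢ univ)) :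
    LocalLipschitzCond (fun t y => F (t, y, x t)) := by
  intro p hp
  have hO : IsOpen (I ×ˢ (univ : Set (ℝ × ℝ))) := hIo.prod isOpen_univ
  have hd : ContinuousOn (fun q => fderiv ℝ F q (0, 1, 0)) (I ×ˢ univ) :=
    (hF.continuousOn_fderiv_of_isOpen hO le_rfl).clm_apply continuousOn_const
  obtain ⟨L, hL⟩ := (isCompact_Icc.prod
    (isCompact_Icc (a := -p) (b := p))).exists_bound_of_continuousOn
    ((continuousOn_along_path hI hx hd).mono (prod_mono le_rfl (subset_univ _)))
  have h00 : ((0 : ℝ), (0 : ℝ)) ∈ Icc (0 : ℝ) 1 ×ˢ Icc (-p) p :=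
    ⟨⟨le_rfl, zero_le_one⟩, ⟨by linarith, hp.le⟩⟩
  refine ⟨L, (norm_nonneg _).trans (hL _ h00), fun t ht ξ hξ ζ hζ => ?_⟩
  have hder : ∀ y ∈ Icc (-p) p, HasDerivWithinAt (fun y => F (t, y, x t))
      (fderiv ℝ F (t, y, x t) (0, 1, 0)) (Icc (-p) p) y := fun y _ => by
    have h1 := ((hF.contDiffAt (hO.mem_nhds (x := (t, y, x t))
      ⟨hI ht, mem_univ _⟩)).differentiableAt one_ne_zero).hasFDerivAt
    exact (h1.comp_hasDerivAt (f := fun y : ℝ => (t, y, x t)) y ((hasDerivAt_const y t).prodMk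
      ((hasDerivAt_id y).prodMk (hasDerivAt_const y (x t))))).hasDerivWithinAt
  exact (convex_Icc (-p) p).norm_image_sub_le_of_norm_hasDerivWithin_le hder
    (fun y hy => hL (t, y) ⟨ht, hy⟩) hζ hξ

end Coefficients

/-! ### Coefficients of the equation for `B` -/

section DossSussmannCoefficients

variable {I : Set ℝ} {σ b : ℝ → ℝ → ℝ} {K : ℝ} {x : ℝ → ℝ}

lemma FlowCoeff.linearGrowth_flow (h : FlowCoeff I σ K) (hI : Icc (0 : ℝ) 1 ⊆ I)
    (hx : ContinuousOn x (Icc 0 1)) : LinearGrowthCond (fun t y => flow σ t y (x t)) := by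
  obtain ⟨X, hX⟩ := isCompact_Icc.exists_bound_of_continuousOn hx
  obtain ⟨C, hC⟩ := isCompact_Icc.exists_bound_of_continuousOn (continuousOn_coeff
    (β := fun t y => flow σ t y (x t))
    (continuousOn_along_path hI hx h.contDiffOn_flow.continuousOn)
    (B := fun _ => 0) continuousOn_const)
  have hC0 : 0 ≤ C := (norm_nonneg _).trans (hC 0 ⟨le_rfl, zero_le_one⟩)
  refine ⟨C + Real.exp (K * X), by positivity, fun t ht y => ?_⟩
  have h1 := h.abs_flow_sub_le (hI ht) 0 y (x t)
  have h2 : Real.exp (K * |x t|) ≤ Real.exp (K * X) :=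
    Real.exp_le_exp.2 (mul_le_mul_of_nonneg_left (hX t ht) h.nonneg)
  rw [sub_zero] at h1
  have h3 := mul_le_mul_of_nonneg_right h2 (abs_nonneg y)
  have h4 : |flow σ t 0 (x t)| ≤ C := hC t ht
  have h5 := abs_sub_abs_le_abs_sub (flow σ t y (x t)) (flow σ t 0 (x t))
  have h6 := mul_nonneg hC0 (abs_nonneg y)
  have h7 := Real.exp_pos (K * X)
  simp only
  linarith

lemma FlowCoeff.linearGrowth (h : FlowCoeff I σ K) (hI : Icc (0 : ℝ) 1 ⊆ I) :
    LinearGrowthCond σ := by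
  have hc : ContinuousOn (fun t => σ t 0) (Icc 0 1) :=
    h.contDiffOn.continuousOn.comp (f := fun t : ℝ => (t, (0 : ℝ))) (by fun_prop)
      fun t ht => ⟨hI ht, mem_univ _⟩
  obtain ⟨C, hC⟩ := isCompact_Icc.exists_bound_of_continuousOn hc
  have hC0 : 0 ≤ C := (norm_nonneg _).trans (hC 0 ⟨le_rfl, zero_le_one⟩)
  have hK := h.nonneg
  refine ⟨C + K, by positivity, fun t ht y => ?_⟩
  have h1 : |σ t y - σ t 0| ≤ K * |y - 0| := (h.lipschitzWith (hI ht)).dist_le_mul y 0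
  rw [sub_zero] at h1
  have h4 : |σ t 0| ≤ C := hC t ht
  have h5 := abs_sub_abs_le_abs_sub (σ t y) (σ t 0)
  have h6 := mul_nonneg hC0 (abs_nonneg y)
  linarith

lemma FlowCoeff.exists_bounds (h : FlowCoeff I σ K) (hI : Icc (0 : ℝ) 1 ⊆ I)
    (hx : ContinuousOn x (Icc 0 1)) : ∃ M : ℝ, ∀ t ∈ Icc (0 : ℝ) 1, ∀ y,
      Real.exp (K * |x t|) ≤ M ∧ |partialTau (flow σ) t y (x t)| ≤ M ∧
        |(partialXi (flow σ) t y (x t))⁻¹| ≤ M := by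
  obtain ⟨X, hX⟩ := isCompact_Icc.exists_bound_of_continuousOn hx
  have hX0 : 0 ≤ X := (norm_nonneg _).trans (hX 0 ⟨le_rfl, zero_le_one⟩)
  have hK := h.nonneg
  refine ⟨Real.exp (K * X) + Real.exp (K * X) * (K * Real.exp (K * X) * X),
    fun t ht y => ?_⟩
  have h2 : Real.exp (K * |x t|) ≤ Real.exp (K * X) :=
    Real.exp_le_exp.2 (mul_le_mul_of_nonneg_left (hX t ht) hK)
  have h3 : 0 ≤ Real.exp (K * X) * (K * Real.exp (K * X) * X) := by positivity
  have hxt : |x t| ≤ X := hX t ht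
  refine ⟨by linarith, ?_, ?_⟩
  · refine (h.abs_partialTau_le (hI ht) y (x t)).trans ?_
    have : Real.exp (K * |x t|) * (K * Real.exp (K * |x t|) * |x t|) ≤
      Real.exp (K * X) * (K * Real.exp (K * X) * X) := by gcongr
    have := Real.exp_pos (K * X)
    linarith
  · refine (h.abs_inv_partialXi_le (hI ht) y (x t)).trans ?_
    linarith

lemma FlowCoeff.contDiffOn_inv_partialXi (h : FlowCoeff I σ K) :
    ContDiffOn ℝ 1 (fun q : ℝ × ℝ × ℝ => (partialXi (flow σ) q.1 q.2.1 q.2.2)⁻¹) (I ×ˢ univ) :=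
  h.contDiffOn_partialXi.inv fun _ hq => h.partialXi_ne_zero hq.1 _ _

/-- The coefficients of the Doss–Sussmann equation, with respect to `A`, `t` and `⟨x⟩`. -/
noncomputable def dossCoeff (σ b : ℝ → ℝ → ℝ) (x : ℝ → ℝ) : Fin 3 → ℝ → ℝ → ℝ :=
  ![fun t y => b t (flow σ t y (x t)) * (partialXi (flow σ) t y (x t))⁻¹,
    fun t y => -1 * (partialTau (flow σ) t y (x t) * (partialXi (flow σ) t y (x t))⁻¹),
    fun t y => -(1 / 2) *
      (partialT (partialT (flow σ)) t y (x t) * (partialXi (flow σ) t y (x t))⁻¹)]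

/-- `φ_tt = σ_ξ(φ) σ(φ)`: a bounded factor times a composition of functions of linear growth. -/
lemma FlowCoeff.linearGrowth_partialTT (h : FlowCoeff I σ K) (hI : Icc (0 : ℝ) 1 ⊆ I)
    (hx : ContinuousOn x (Icc 0 1)) :
    LinearGrowthCond (fun t y => partialT (partialT (flow σ)) t y (x t)) := by
  obtain ⟨c, hc, h1⟩ := ((h.linearGrowth hI).comp (h.linearGrowth_flow hI hx)).mul_bounded
    (g := fun t y => deriv (σ t) (flow σ t y (x t))) (M := K)
    (fun t ht y => h.deriv_snd_le t (hI ht) _)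
  refine ⟨c, hc, fun t ht y => ?_⟩
  simp only
  rw [h.partialTT_flow (hI ht), mul_comm]
  exact h1 t ht y

lemma FlowCoeff.continuousOn_b_flow (h : FlowCoeff I σ K) (hI : Icc (0 : ℝ) 1 ⊆ I)
    (hx : ContinuousOn x (Icc 0 1))
    (hb : ContinuousOn (fun q : ℝ × ℝ => b q.1 q.2) (Icc (0 : ℝ) 1 ×ˢ univ)) :
    ContinuousOn (fun q : ℝ × ℝ => b q.1 (flow σ q.1 q.2 (x q.1))) (Icc (0 : ℝ) 1 ×ˢ univ) :=
  hb.comp (f := fun q : ℝ × ℝ => (q.1, flow σ q.1 q.2 (x q.1)))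
    (continuousOn_fst.prodMk (continuousOn_along_path hI hx h.contDiffOn_flow.continuousOn))
    fun _ hq => ⟨hq.1, mem_univ _⟩

lemma FlowCoeff.continuousOn_dossCoeff (h : FlowCoeff I σ K) (hI : Icc (0 : ℝ) 1 ⊆ I)
    (hx : ContinuousOn x (Icc 0 1))
    (hb : ContinuousOn (fun q : ℝ × ℝ => b q.1 q.2) (Icc (0 : ℝ) 1 ×ˢ univ)) (i : Fin 3) :
    ContinuousOn (fun q : ℝ × ℝ => dossCoeff σ b x i q.1 q.2) (Icc (0 : ℝ) 1 ×ˢ univ) := by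
  have hinv := continuousOn_along_path hI hx h.contDiffOn_inv_partialXi.continuousOn
  fin_cases i
  · exact (h.continuousOn_b_flow hI hx hb).mul hinv
  · exact continuousOn_const.mul
      ((continuousOn_along_path hI hx h.contDiffOn_partialTau.continuousOn).mul hinv)
  · exact continuousOn_const.mul
      ((continuousOn_along_path hI hx h.contDiffOn_partialTT.continuousOn).mul hinv)

lemma LocalLipschitzCond.const_mul {f : ℝ → ℝ → ℝ} (hf : LocalLipschitzCond f) (a : ℝ) :
    LocalLipschitzCond (fun t y => a * f t y) := fun p hp => by
  obtain ⟨L, hL, h⟩ := hf p hp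
  refine ⟨|a| * L, by positivity, fun t ht ξ hξ ζ hζ => ?_⟩
  rw [← mul_sub, abs_mul, mul_assoc]
  exact mul_le_mul_of_nonneg_left (h t ht ξ hξ ζ hζ) (abs_nonneg a)

lemma LinearGrowthCond.const_mul {f : ℝ → ℝ → ℝ} (hf : LinearGrowthCond f) (a : ℝ) :
    LinearGrowthCond (fun t y => a * f t y) := by
  obtain ⟨L, hL, h⟩ := hf
  refine ⟨|a| * L, by positivity, fun t ht ξ => ?_⟩
  rw [abs_mul, mul_assoc]
  exact mul_le_mul_of_nonneg_left (h t ht ξ) (abs_nonneg a)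

lemma FlowCoeff.localLipschitz_dossCoeff (h : FlowCoeff I σ K) (hI : Icc (0 : ℝ) 1 ⊆ I)
    (hx : ContinuousOn x (Icc 0 1)) (hb : LocalLipschitzCond b) (hb' : LinearGrowthCond b)
    (i : Fin 3) : LocalLipschitzCond (dossCoeff σ b x i) := by
  obtain ⟨M, hM⟩ := h.exists_bounds hI hx
  have hinv := localLipschitzCond_along_path h.isOpen hI hx h.contDiffOn_inv_partialXi
  have hinv' := LinearGrowthCond.of_bounded fun t ht y => (hM t ht y).2.2
  have hflow := localLipschitzCond_along_path h.isOpen hI hx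
    (h.contDiffOn_flow.of_le (by norm_num))
  fin_cases i
  · exact (hb.comp hflow (h.linearGrowth_flow hI hx)).mul hinv
      (hb'.comp (h.linearGrowth_flow hI hx)) hinv'
  · exact ((localLipschitzCond_along_path h.isOpen hI hx h.contDiffOn_partialTau).mul hinv
      (LinearGrowthCond.of_bounded fun t ht y => (hM t ht y).2.1) hinv').const_mul (-1)
  · exact ((localLipschitzCond_along_path h.isOpen hI hx h.contDiffOn_partialTT).mul hinv
      (h.linearGrowth_partialTT hI hx) hinv').const_mul (-(1 / 2))

lemma FlowCoeff.linearGrowth_dossCoeff (h : FlowCoeff I σ K) (hI : Icc (0 : ℝ) 1 ⊆ I)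
    (hx : ContinuousOn x (Icc 0 1)) (hb' : LinearGrowthCond b)
    (i : Fin 3) : LinearGrowthCond (dossCoeff σ b x i) := by
  obtain ⟨M, hM⟩ := h.exists_bounds hI hx
  fin_cases i
  · exact (hb'.comp (h.linearGrowth_flow hI hx)).mul_bounded fun t ht y => (hM t ht y).2.2
  · exact ((LinearGrowthCond.of_bounded fun t ht y => (hM t ht y).2.1).mul_bounded
      fun t ht y => (hM t ht y).2.2).const_mul (-1)
  · exact ((h.linearGrowth_partialTT hI hx).mul_bounded
      fun t ht y => (hM t ht y).2.2).const_mul (-(1 / 2))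

end DossSussmannCoefficients

/-! ### Orders of magnitude relative to `dw + dx²` -/

section Infinitesimals

lemma Controls.incr_self_isBigO_add_sq {w f x : ℝ → ℝ} (h : Controls w f) :
    incr w =O[mesh] (fun p => incr w p + incr x p ^ 2) :=
  IsBigO.of_bound 1 (h.incr_nonneg.mono fun p hp => by
    rw [Real.norm_eq_abs, Real.norm_eq_abs, abs_of_nonneg hp, abs_of_nonneg (by positivity)]
    nlinarith [sq_nonneg (incr x p)])

lemma Controls.incr_isBigO_add_sq {w f x : ℝ → ℝ} (h : Controls w f) :
    incr f =O[mesh] (fun p => incr w p + incr x p ^ 2) :=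
  h.incr_isBigO.trans h.incr_self_isBigO_add_sq

lemma Controls.sq_isBigO_add_sq {w f x : ℝ → ℝ} (h : Controls w f) :
    (fun p => incr x p ^ 2) =O[mesh] (fun p => incr w p + incr x p ^ 2) :=
  IsBigO.of_bound 1 (h.incr_nonneg.mono fun p hp => by
    rw [Real.norm_eq_abs, Real.norm_eq_abs, abs_of_nonneg (by positivity),
      abs_of_nonneg (by positivity)]
    linarith)

lemma ContinuousOn.left_mul_isLittleO {f : ℝ → ℝ} (hf : ContinuousOn f (Icc 0 1))
    {R g : ℝ × ℝ → ℝ} (h : R =o[mesh] g) : (fun p => f p.1 * R p) =o[mesh] g := by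
  simpa using hf.left_isBigO.mul_isLittleO h

lemma ContinuousOn.left_mul_isBigO {f : ℝ → ℝ} (hf : ContinuousOn f (Icc 0 1))
    {R g : ℝ × ℝ → ℝ} (h : R =O[mesh] g) : (fun p => f p.1 * R p) =O[mesh] g := by
  simpa using hf.left_isBigO.mul h

end Infinitesimals

/-! ### Integral form and incremental form of Stieltjes equations -/

section IntegralForm

lemma HasRSIntegral.const_mul {g A : ℝ → ℝ} {a c J : ℝ} (h : HasRSIntegral g A a c J) (r : ℝ) :
    HasRSIntegral (fun s => r * g s) A a c (r * J) := by
  intro ε hε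
  obtain ⟨δ, hδ, H⟩ := h (ε / (|r| + 1)) (by positivity)
  refine ⟨δ, hδ, fun m p tag p0 pm hp hm htag => ?_⟩
  have h1 := H m p tag p0 pm hp hm htag
  rw [lt_div_iff₀ (by positivity)] at h1
  simp only [mul_assoc]
  rw [← Finset.mul_sum, ← mul_sub, abs_mul]
  refine lt_of_le_of_lt ?_ h1
  rw [mul_comm]
  exact mul_le_mul_of_nonneg_left (by linarith) (abs_nonneg _)

variable {k : ℕ} {A : Fin k → ℝ → ℝ} {β : Fin k → ℝ → ℝ → ℝ} {w B : ℝ → ℝ} {z₀ : ℝ}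

lemma incr_sum (G : Fin k → ℝ → ℝ) (p : ℝ × ℝ) :
    incr (fun t => ∑ i, G i t) p = ∑ i, incr (G i) p := by
  simp only [incr, Finset.sum_sub_distrib]

/-- Indefinite integrals have increments `β dA + o(dw)`, so the two forms differ by a function with
`o(dw)` increments, that is, a constant. The integral form does not mention `w`, which allows the
control to be enlarged later. -/
lemma solvesStieltjes_iff (hw : Controls w w) (hA : ∀ i, Controls w (A i))
    (hAc : ∀ i, ContinuousOn (A i) (Icc 0 1))
    (hβ : ∀ i, ContinuousOn (fun q : ℝ × ℝ => β i q.1 q.2) (Icc (0 : ℝ) 1 ×ˢ univ)) :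
    SolvesStieltjes w A β z₀ B ↔ ContinuousOn B (Icc 0 1) ∧ ∀ t ∈ Icc (0 : ℝ) 1,
      ∃ J : Fin k → ℝ, (∀ i, HasRSIntegral (fun s => β i s (B s)) (A i) 0 t (J i)) ∧
        B t = z₀ + ∑ i, J i := by
  have i0 : (0 : ℝ) ∈ Icc (0 : ℝ) 1 := ⟨le_rfl, zero_le_one⟩
  rw [SolvesStieltjes]
  refine and_congr_right fun hB => ?_
  choose G hG0 hG using fun i =>
    exists_isIndefIntegral (hAc i) (hA i) (continuousOn_coeff (hβ i) hB)
  have hint : ∀ t ∈ Icc (0 : ℝ) 1, ∀ i,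
      HasRSIntegral (fun s => β i s (B s)) (A i) 0 t (G i t) := fun t ht i => by
    simpa [hG0] using (hG i).hasRSIntegral (hA i) (continuousOn_coeff (hβ i) hB) ht
  have hsum : (fun p : ℝ × ℝ => ∑ i, (incr (G i) p - β i p.1 (B p.1) * incr (A i) p))
      =o[mesh] incr w := IsLittleO.fun_sum fun i _ => hG i
  constructor
  · rintro ⟨h0, h⟩ t ht
    refine ⟨fun i => G i t, hint t ht, ?_⟩
    have hD : incr (fun t => B t - ∑ i, G i t) =o[mesh] incr w :=
      (h.sub hsum).congr_left fun p => by
        rw [Finset.sum_sub_distrib, ← incr_sum]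
        simp only [incr]; ring
    have := eq_of_incr_isLittleO hw hD le_rfl ht.1 ht.2
    simp only [hG0, Finset.sum_const_zero, h0] at this
    linarith
  · intro h
    have e : ∀ t ∈ Icc (0 : ℝ) 1, B t = z₀ + ∑ i, G i t := fun t ht => by
      obtain ⟨J, hJ, hBt⟩ := h t ht
      rw [hBt]
      congr 1
      exact Finset.sum_congr rfl fun i _ => (hJ i).unique ht.1 (hint t ht i)
    refine ⟨by simpa [hG0] using e 0 i0, hsum.congr' (eventually_mesh_mem.mono fun p hp => ?_) .rfl⟩
    beta_reduce
    rw [Finset.sum_sub_distrib, ← incr_sum]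
    simp only [incr]
    rw [e p.1 ⟨hp.1, hp.2.1.trans hp.2.2⟩, e p.2 ⟨hp.1.trans hp.2.1, hp.2.2⟩]
    ring

end IntegralForm

/-! ### Expansion of `φ(t, B, x)` -/

section Doss

variable {I : Set ℝ} {σ b : ℝ → ℝ → ℝ} {K z₀ : ℝ} {x Q A B w : ℝ → ℝ}

lemma forall_integrators {P : (ℝ → ℝ) → Prop} (hA : P A) (ht : P fun t => t) (hQ : P Q)
    (i : Fin 3) : P ((![A, fun t => t, Q] : Fin 3 → ℝ → ℝ) i) := by
  fin_cases i
  exacts [hA, ht, hQ]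

lemma FlowCoeff.isDossSussmannSolution_iff (h : FlowCoeff I σ K) (hI : Icc (0 : ℝ) 1 ⊆ I)
    (hx : ContinuousOn x (Icc 0 1)) (hb : ContinuousOn (fun q : ℝ × ℝ => b q.1 q.2)
      (Icc (0 : ℝ) 1 ×ˢ univ)) (hA : ContinuousOn A (Icc 0 1)) (hQ : ContinuousOn Q (Icc 0 1))
    (hwA : Controls w A) (hwt : Controls w fun t => t) (hwQ : Controls w Q) :
    IsDossSussmannSolution x Q A b (flow σ) z₀ B ↔
      SolvesStieltjes w ![A, fun t => t, Q] (dossCoeff σ b x) z₀ B := by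
  rw [solvesStieltjes_iff hwA.self (forall_integrators hwA hwt hwQ)
    (forall_integrators (P := fun f => ContinuousOn f (Icc 0 1)) hA continuousOn_id hQ)
    (h.continuousOn_dossCoeff hI hx hb), IsDossSussmannSolution]
  refine and_congr_right fun _ => forall₂_congr fun t _ => ?_
  simp only [div_eq_mul_inv]
  constructor
  · rintro ⟨J₁, J₂, J₃, h₁, h₂, h₃, e⟩
    refine ⟨![J₁, -1 * J₂, -(1 / 2) * J₃], fun i => ?_, ?_⟩
    · fin_cases i
      exacts [h₁, h₂.const_mul (-1), h₃.const_mul (-(1 / 2))]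
    · rw [e]
      simp [Fin.sum_univ_three]
      ring
  · rintro ⟨J, hJ, e⟩
    refine ⟨J 0, -1 * J 1, -2 * J 2, hJ 0, ?_, ?_, ?_⟩
    · simpa [dossCoeff] using (hJ 1).const_mul (-1)
    · have := (hJ 2).const_mul (-2)
      simpa [dossCoeff] using this
    · rw [e, Fin.sum_univ_three]
      ring

/-- The projection through which `φ(τ, ξ, t)` becomes a function of `((τ, ξ), t)`. -/
def flowCoord : ((Fin 2 → ℝ) × ℝ) →L[ℝ] ℝ × ℝ × ℝ :=
  ((ContinuousLinearMap.proj 0).comp (ContinuousLinearMap.fst ℝ (Fin 2 → ℝ) ℝ)).prod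
    (((ContinuousLinearMap.proj 1).comp (ContinuousLinearMap.fst ℝ (Fin 2 → ℝ) ℝ)).prod
      (ContinuousLinearMap.snd ℝ (Fin 2 → ℝ) ℝ))

lemma flowCoord_apply (q : (Fin 2 → ℝ) × ℝ) : flowCoord q = (q.1 0, q.1 1, q.2) := rfl

lemma FlowCoeff.isOpen_flowCoord (h : FlowCoeff I σ K) :
    IsOpen {q : (Fin 2 → ℝ) × ℝ | q.1 0 ∈ I} :=
  h.isOpen.preimage ((continuous_apply 0).comp continuous_fst)

lemma FlowCoeff.contDiffOn_flowCoord (h : FlowCoeff I σ K) :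
    ContDiffOn ℝ 2 (fun q : (Fin 2 → ℝ) × ℝ => flow σ (q.1 0) (q.1 1) q.2)
      {q | q.1 0 ∈ I} :=
  h.contDiffOn_flow.comp (f := flowCoord) flowCoord.contDiff.contDiffOn
    fun _ hq => ⟨hq, mem_univ _⟩

lemma FlowCoeff.contDiff_flow_slice (h : FlowCoeff I σ K) {τ : ℝ} (hτ : τ ∈ I) (ξ : ℝ) :
    ContDiff ℝ 2 (flow σ τ ξ) :=
  h.contDiffOn_flow.comp_contDiff (f := fun t : ℝ => (τ, ξ, t)) (by fun_prop)
    fun _ => ⟨hτ, mem_univ _⟩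

lemma iteratedDeriv_two_eq_partialTT (φ : ℝ → ℝ → ℝ → ℝ) (τ ξ t : ℝ) :
    iteratedDeriv 2 (fun r => φ τ ξ r) t = partialT (partialT φ) τ ξ t := by
  rw [iteratedDeriv_succ, iteratedDeriv_one]; rfl

lemma FlowCoeff.continuousOn_iteratedDeriv_flowCoord (h : FlowCoeff I σ K) :
    ContinuousOn (fun q : (Fin 2 → ℝ) × ℝ =>
      iteratedDeriv 2 (fun ξ => flow σ (q.1 0) (q.1 1) ξ) q.2) {q | q.1 0 ∈ I} := by
  simp only [iteratedDeriv_two_eq_partialTT]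
  exact h.contDiffOn_partialTT.continuousOn.comp (f := flowCoord)
    flowCoord.continuous.continuousOn fun _ hq => ⟨hq, mem_univ _⟩

lemma FlowCoeff.fderiv_flowCoord (h : FlowCoeff I σ K) {q : (Fin 2 → ℝ) × ℝ} (hq : q.1 0 ∈ I)
    (v : (Fin 2 → ℝ) × ℝ) :
    fderiv ℝ (fun q : (Fin 2 → ℝ) × ℝ => flow σ (q.1 0) (q.1 1) q.2) q v =
      fderiv ℝ (fun q : ℝ × ℝ × ℝ => flow σ q.1 q.2.1 q.2.2) (flowCoord q) (flowCoord v) := by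
  have := (h.hasFDerivAt_flow (q := flowCoord q) hq).comp q flowCoord.hasFDerivAt
  exact congrArg (· v) this.fderiv

/-- The potential is `φ` itself with `𝐀 = (t, B)`, because `φ_t = σ(τ, φ)`. -/
lemma FlowCoeff.isAdmissible (h : FlowCoeff I σ K) (hI : Icc (0 : ℝ) 1 ⊆ I) (hB : IsCBV B) :
    IsAdmissible x (fun t => σ t (flow σ t (B t) (x t))) := by
  refine ⟨2, fun t => ![t, B t], {q | q.1 0 ∈ I}, fun q => flow σ (q.1 0) (q.1 1) q.2,
    fun i => ?_, h.isOpen_flowCoord, fun t ht => hI ht, h.contDiffOn_flowCoord.of_le (by norm_num),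
    fun a ξ hξ => (h.contDiff_flow_slice hξ _).contDiffAt.contDiffWithinAt,
    h.continuousOn_iteratedDeriv_flowCoord,
    fun t ht => ((h.hasDerivAt_flow (hI ht) _ _).deriv).symm⟩
  fin_cases i
  · exact ⟨continuousOn_id, Controls.boundedVariationOn (w := fun t => t)
      (controls_self_of_monotoneOn (monotone_id.monotoneOn _))⟩
  · exact hB

lemma FlowCoeff.incr_flow_isLittleO (h : FlowCoeff I σ K) (hI : Icc (0 : ℝ) 1 ⊆ I)
    (hx : ContinuousOn x (Icc 0 1)) (hB : ContinuousOn B (Icc 0 1))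
    (hwt : Controls w fun t => t)
    (hBO : incr B =O[mesh] (fun p => incr w p + incr x p ^ 2)) :
    (fun p : ℝ × ℝ => incr (fun t => flow σ t (B t) (x t)) p -
      (σ p.1 (flow σ p.1 (B p.1) (x p.1)) * incr x p +
        1 / 2 * (partialT (partialT (flow σ)) p.1 (B p.1) (x p.1) * incr x p ^ 2) +
        (partialTau (flow σ) p.1 (B p.1) (x p.1) * incr (fun t => t) p +
          partialXi (flow σ) p.1 (B p.1) (x p.1) * incr B p))) =o[mesh]
      (fun p => incr w p + incr x p ^ 2) := by
  have htO : incr (fun t => t) =O[mesh] (fun p => incr w p + incr x p ^ 2) :=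
    hwt.incr_isBigO_add_sq
  have key := incr_comp_isLittleO (w := w) (A := fun t => ![t, B t])
    (f := fun q => flow σ (q.1 0) (q.1 1) q.2) (U := {q | q.1 0 ∈ I})
    (fun i => by fin_cases i; exacts [htO, hBO]) hwt.self
    (fun i => by fin_cases i; exacts [continuousOn_id, hB]) hx h.isOpen_flowCoord
    (fun t ht => hI ht) (h.contDiffOn_flowCoord.of_le (by norm_num))
    (fun a ξ hξ => (h.contDiff_flow_slice hξ _).contDiffAt.contDiffWithinAt)
    h.continuousOn_iteratedDeriv_flowCoord
  refine key.congr' (eventually_mesh_mem.mono fun p hp => ?_) .rfl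
  have hp1 : p.1 ∈ I := hI ⟨hp.1, hp.2.1.trans hp.2.2⟩
  have hF := h.hasFDerivAt_flow (q := (p.1, B p.1, x p.1)) hp1
  have e1 : deriv (fun ξ => flow σ p.1 (B p.1) ξ) (x p.1) = σ p.1 (flow σ p.1 (B p.1) (x p.1)) :=
    (h.hasDerivAt_flow hp1 _ _).deriv
  have e2 : fderiv ℝ (fun q : (Fin 2 → ℝ) × ℝ => flow σ (q.1 0) (q.1 1) q.2)
      (![p.1, B p.1], x p.1) (Pi.single 0 1, 0) = partialTau (flow σ) p.1 (B p.1) (x p.1) := by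
    rw [h.fderiv_flowCoord (by exact hp1), partialTau, (hasDerivAt_tau hF).deriv]
    simp [flowCoord_apply]
  have e3 : fderiv ℝ (fun q : (Fin 2 → ℝ) × ℝ => flow σ (q.1 0) (q.1 1) q.2)
      (![p.1, B p.1], x p.1) (Pi.single 1 1, 0) = partialXi (flow σ) p.1 (B p.1) (x p.1) := by
    rw [h.fderiv_flowCoord (by exact hp1), partialXi, (_root_.hasDerivAt_xi hF).deriv]
    simp [flowCoord_apply]
  simp only [Matrix.cons_val_zero, Matrix.cons_val_one, Fin.sum_univ_two]
  rw [e1, e2, e3, iteratedDeriv_two_eq_partialTT]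

end Doss

/-! ### `φ(t, B, x)` solves the equation -/

section Existence

variable {I : Set ℝ} {σ b : ℝ → ℝ → ℝ} {K z₀ : ℝ} {x Q A B w : ℝ → ℝ} {T : ℕ → Finset ℝ}

lemma ContinuousOn.comp_path {F : ℝ × ℝ × ℝ → ℝ} (hF : ContinuousOn F (I ×ˢ univ))
    (hI : Icc (0 : ℝ) 1 ⊆ I) {y x : ℝ → ℝ} (hy : ContinuousOn y (Icc 0 1))
    (hx : ContinuousOn x (Icc 0 1)) : ContinuousOn (fun t => F (t, y t, x t)) (Icc 0 1) :=
  hF.comp (continuousOn_id.prodMk (hy.prodMk hx)) fun _ ht => ⟨hI ht, mem_univ _⟩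

lemma FlowCoeff.isItoSolution (h : FlowCoeff I σ K) (hI : Icc (0 : ℝ) 1 ⊆ I) (hT : IsRefining T)
    (hx : ContinuousOn x (Icc 0 1)) (hx0 : x 0 = 0) (hQ : HasContinuousQuadVar T x Q)
    (hb : ContinuousOn (fun q : ℝ × ℝ => b q.1 q.2) (Icc (0 : ℝ) 1 ×ˢ univ))
    (hA : ContinuousOn A (Icc 0 1)) (hwA : Controls w A) (hwt : Controls w fun t => t)
    (hwQ : Controls w Q) (hB : SolvesStieltjes w ![A, fun t => t, Q] (dossCoeff σ b x) z₀ B) :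
    IsItoSolution T x A σ b z₀ (fun t => flow σ t (B t) (x t)) := by
  have i0 : (0 : ℝ) ∈ Icc (0 : ℝ) 1 := ⟨le_rfl, zero_le_one⟩
  obtain ⟨M, hM⟩ := hB.isCBV hwA.self (forall_integrators hwA hwt hwQ)
    (h.continuousOn_dossCoeff hI hx hb)
  have hz : ContinuousOn (fun t => flow σ t (B t) (x t)) (Icc 0 1) :=
    h.contDiffOn_flow.continuousOn.comp_path hI hB.1 hx
  have hβ : ContinuousOn (fun t => b t (flow σ t (B t) (x t))) (Icc 0 1) :=
    continuousOn_coeff (β := b) hb hz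
  have hγ : ContinuousOn (fun t => partialT (partialT (flow σ)) t (B t) (x t)) (Icc 0 1) :=
    h.contDiffOn_partialTT.continuousOn.comp_path hI hB.1 hx
  have hξ : ContinuousOn (fun t => partialXi (flow σ) t (B t) (x t)) (Icc 0 1) :=
    h.contDiffOn_partialXi.continuousOn.comp_path hI hB.1 hx
  have hBO : incr B =O[mesh] (fun p => incr w p + incr x p ^ 2) := by
    have h1 : incr (fun t => M * w t) =O[mesh] incr w :=
      (isBigO_const_mul_self M (incr w) mesh).congr_left fun p => by simp only [incr]; ring
    exact hM.incr_isBigO.trans (h1.trans hwA.incr_self_isBigO_add_sq)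
  obtain ⟨J, hJ0, hJ⟩ := exists_isIndefIntegral hA hwA hβ
  obtain ⟨Γ, hΓ0, hΓ⟩ := exists_isIndefIntegral hQ.1 hQ.controls hγ
  have hΓw : IsIndefIntegral w (fun t => partialT (partialT (flow σ)) t (B t) (x t)) Q Γ :=
    hΓ.trans_isBigO hwQ.incr_isBigO
  have hC : ContinuousOn (fun t => J t - 1 / 2 * Γ t) (Icc 0 1) :=
    (hJ.continuousOn hwA.self hβ hA).sub
      (continuousOn_const.mul (hΓ.continuousOn hQ.controls hγ hQ.1))
  have hexp := h.incr_flow_isLittleO hI hx hB.1 hwt hBO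
  -- The equation for `B` multiplied by `φ_ξ`: it turns `φ_τ dt + φ_ξ dB` into `dJ - ½ dΓ`.
  have hlin : (fun p : ℝ × ℝ => partialXi (flow σ) p.1 (B p.1) (x p.1) * (incr B p -
      ∑ i, dossCoeff σ b x i p.1 (B p.1) * incr ((![A, fun t => t, Q] : Fin 3 → ℝ → ℝ) i) p) -
      (incr J p - b p.1 (flow σ p.1 (B p.1) (x p.1)) * incr A p - 1 / 2 *
        (incr Γ p - partialT (partialT (flow σ)) p.1 (B p.1) (x p.1) * incr Q p)))
      =o[mesh] incr w :=
    (hξ.left_mul_isLittleO hB.2.2).sub (IsLittleO.sub hJ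
      (hΓw.const_mul_left (1 / 2)))
  have hfin := hexp.add (hlin.trans_isBigO (hwA.incr_self_isBigO_add_sq (x := x)))
  refine ⟨hz, h.isAdmissible hI ⟨hB.1, hM.boundedVariationOn⟩, fun t ht => ?_⟩
  -- The Itô correction `½ Γ` cancels against the one inside `C = J - ½ Γ`, so the Föllmer integral
  -- equals `z t - z 0 - J t`.
  refine ⟨_, J t, hQ.hasFollmerIntegral hT hx hwA.self hz hγ hC hΓ (hfin.congr'
    (eventually_mesh_mem.mono fun p hp => ?_) .rfl) ht, ?_, ?_⟩
  · have hne := h.partialXi_ne_zero (hI ⟨hp.1, hp.2.1.trans hp.2.2⟩) (B p.1) (x p.1)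
    simp only [Fin.sum_univ_three, dossCoeff, Matrix.cons_val, incr]
    field_simp
    ring
  · simpa [hJ0] using hJ.hasRSIntegral hwA hβ ht
  · simp only [hJ0, hΓ0, hx0, hB.2.1, h.flow_zero (hI i0)]
    ring

end Existence

/-! ### Every solution is of this form -/

section Uniqueness

variable {I : Set ℝ} {σ b : ℝ → ℝ → ℝ} {K z₀ : ℝ} {x Q A B z w : ℝ → ℝ} {T : ℕ → Finset ℝ}

lemma Controls.sum {ι : Type*} [Fintype ι] {W F : ι → ℝ → ℝ} (h : ∀ i, Controls (W i) (F i))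
    (i : ι) : Controls (fun t => ∑ j, W j t) (F i) := fun s t h0 hst h1 => by
  refine (h i s t h0 hst h1).trans ?_
  rw [← Finset.sum_sub_distrib]
  exact Finset.single_le_sum (f := fun j => W j t - W j s)
    (fun j _ => sub_nonneg.2 ((h j).mono h0 hst h1)) (Finset.mem_univ i)

lemma controls_self_sum {ι : Type*} [Fintype ι] {W F : ι → ℝ → ℝ}
    (h : ∀ i, Controls (W i) (F i)) :
    Controls (fun t => ∑ j, W j t) (fun t => ∑ j, W j t) :=
  controls_self_of_monotoneOn fun _ hs _ ht hst =>
    Finset.sum_le_sum fun j _ => (h j).mono hs.1 hst ht.2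

/-- A solution expands infinitesimally as `dz = σ dx + γ (dx² - d⟨x⟩) / 2 + b dA`. -/
lemma IsItoSolution.exists_expansion (hz : IsItoSolution T x A σ b z₀ z) (hT : IsRefining T)
    (hx : ContinuousOn x (Icc 0 1)) (hQ : HasContinuousQuadVar T x Q)
    (hb : ContinuousOn (fun q : ℝ × ℝ => b q.1 q.2) (Icc (0 : ℝ) 1 ×ˢ univ))
    (hA : ContinuousOn A (Icc 0 1)) (hwA : Controls w A) (hwQ : Controls w Q) :
    z 0 = z₀ ∧ ∃ v γ : ℝ → ℝ, Controls v v ∧ ContinuousOn γ (Icc 0 1) ∧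
      (fun p : ℝ × ℝ => incr z p - (σ p.1 (z p.1) * incr x p +
        1 / 2 * (γ p.1 * (incr x p ^ 2 - incr Q p)) + b p.1 (z p.1) * incr A p)) =o[mesh]
        (fun p => incr (fun t => w t + v t) p + incr x p ^ 2) := by
  obtain ⟨hzc, ⟨k, A', U, f, hA', hU, hAU, hf, hf₂, hf₃, hη⟩, hint⟩ := hz
  have hA'c : ∀ i, ContinuousOn (fun t => A' t i) (Icc 0 1) := fun i => (hA' i).1
  have hpath := continuousOn_path hA'c hx
  have hv := controls_self_sum fun i => (hA' i).controls
  -- The auxiliary functions hidden in admissibility need not be controlled by `w`; their total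
  -- variation is added to it.
  set v : ℝ → ℝ := fun t => ∑ i, cumVariation (fun t => A' t i) t with hvdef
  have hwv : Controls (fun t => w t + v t) (fun t => w t + v t) := (hwA.add_right hv).self
  have hwA' : ∀ i, Controls (fun t => w t + v t) (fun t => A' t i) := fun i =>
    (Controls.sum (fun i => (hA' i).controls) i).add_left hwA
  have hwA₂ : Controls (fun t => w t + v t) A := hwA.add_right hv
  have hwQ₂ : Controls (fun t => w t + v t) Q := hwQ.add_right hv
  have hγ : ContinuousOn (fun t => iteratedDeriv 2 (fun ξ => f (A' t, ξ)) (x t)) (Icc 0 1) :=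
    hf₃.comp (f := fun t => (A' t, x t)) hpath hAU
  obtain ⟨γ, hγdef⟩ : ∃ γ : ℝ → ℝ, γ = fun t => iteratedDeriv 2 (fun ξ => f (A' t, ξ)) (x t) :=
    ⟨_, rfl⟩
  rw [← hγdef] at hγ
  have hβ : ContinuousOn (fun t => b t (z t)) (Icc 0 1) := continuousOn_coeff (β := b) hb hzc
  have hy : ContinuousOn (fun t => f (A' t, x t)) (Icc 0 1) :=
    hf.continuousOn.comp (f := fun t => (A' t, x t)) hpath hAU
  have hc : ∀ i, ContinuousOn (fun t => fderiv ℝ f (A' t, x t) (Pi.single i 1, 0)) (Icc 0 1) :=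
    fun i => continuousOn_fderiv_path hA'c hx hU hAU hf _
  choose C hC0 hC using fun i => exists_isIndefIntegral (hA'c i) (hwA' i) (hc i)
  obtain ⟨Γ, hΓ0, hΓ⟩ := exists_isIndefIntegral hQ.1 hQ.controls hγ
  obtain ⟨J, hJ0, hJ⟩ := exists_isIndefIntegral hA hwA₂ hβ
  have hΓw : IsIndefIntegral (fun t => w t + v t) γ Q Γ := hΓ.trans_isBigO hwQ₂.incr_isBigO
  have hCc : ContinuousOn (fun t => ∑ i, C i t) (Icc 0 1) := continuousOn_finsetSum _ fun i _ =>
    (hC i).continuousOn hwv (hc i) (hA'c i)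
  have hCsum : (fun p : ℝ × ℝ => ∑ i, (incr (C i) p -
      fderiv ℝ f (A' p.1, x p.1) (Pi.single i 1, 0) * incr (fun t => A' t i) p)) =o[mesh]
      incr (fun t => w t + v t) := IsLittleO.fun_sum fun i _ => hC i
  have hexp := incr_comp_isLittleO (fun i => (hwA' i).incr_isBigO_add_sq) hwv hA'c hx hU hAU hf
    hf₂ hf₃
  have hexp' : (fun p : ℝ × ℝ => incr (fun t => f (A' t, x t)) p - (σ p.1 (z p.1) * incr x p +
      1 / 2 * (γ p.1 * incr x p ^ 2) + incr (fun t => ∑ i, C i t) p)) =o[mesh]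
      (fun p => incr (fun t => w t + v t) p + incr x p ^ 2) := by
    refine (hexp.sub (hCsum.trans_isBigO hwv.incr_self_isBigO_add_sq)).congr'
      (eventually_mesh_mem.mono fun p hp => ?_) .rfl
    have e := hη p.1 ⟨hp.1, hp.2.1.trans hp.2.2⟩
    beta_reduce at e ⊢
    rw [incr_sum, Finset.sum_sub_distrib, e, hγdef]
    ring
  -- Uniqueness of both integrals identifies `z` with explicit antiderivatives. Subtracting `∑ C i`
  -- removes the first-order part of `d f(𝐀, x)` in the directions of `𝐀`, and `-½ Γ` contributes
  -- `-½ γ dQ`.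
  have hzt : ∀ t ∈ Icc (0 : ℝ) 1, z t = z₀ + (f (A' t, x t) - f (A' 0, x 0) - 1 / 2 * Γ t -
      ∑ i, C i t) + J t := fun t ht => by
    obtain ⟨J₁, J₂, h₁, h₂, e⟩ := hint t ht
    have e₁ := h₁.unique (hQ.hasFollmerIntegral (α := fun t => σ t (z t)) hT hx hwv hy hγ hCc hΓ
      hexp' ht)
    have e₂ := h₂.unique ht.1 (hJ.hasRSIntegral hwA₂ hβ ht)
    simp only [hΓ0, hC0, hJ0, Finset.sum_const_zero, sub_zero] at e₁ e₂
    rw [e, e₁, e₂]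
  refine ⟨by simpa [hΓ0, hC0, hJ0] using hzt 0 ⟨le_rfl, zero_le_one⟩, v, γ, hv, hγ, ?_⟩
  have hrest := (IsLittleO.sub hJ (hΓw.const_mul_left (1 / 2))).trans_isBigO
    (hwv.incr_self_isBigO_add_sq (x := x))
  refine (hexp'.add hrest).congr' (eventually_mesh_mem.mono fun p hp => ?_) .rfl
  simp only [incr]
  rw [hzt p.1 ⟨hp.1, hp.2.1.trans hp.2.2⟩, hzt p.2 ⟨hp.1.trans hp.2.1, hp.2.2⟩]
  ring

lemma FlowCoeff.abs_flow_sub_tau_le (h : FlowCoeff I σ K) (hI : Icc (0 : ℝ) 1 ⊆ I) {τ τ' : ℝ}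
    (hτ : τ ∈ Icc (0 : ℝ) 1) (hτ' : τ' ∈ Icc (0 : ℝ) 1) (ξ t : ℝ) :
    |flow σ τ' ξ t - flow σ τ ξ t| ≤
      Real.exp (K * |t|) * (K * Real.exp (K * |t|) * |t|) * |τ' - τ| :=
  (convex_Icc (0 : ℝ) 1).norm_image_sub_le_of_norm_hasDerivWithin_le
    (f := fun τ => flow σ τ ξ t) (f' := fun τ => partialTau (flow σ) τ ξ t)
    (fun _ hr => (hasDerivAt_tau (h.hasFDerivAt_flow
      (q := (_, ξ, t)) (hI hr))).differentiableAt.hasDerivAt.hasDerivWithinAt)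
    (fun _ hr => h.abs_partialTau_le (hI hr) ξ t) hτ hτ'

/-- First-order Taylor expansion in time; eventually `|dx| < 1`, and there `φ_tt` along `z` is
bounded by compactness. -/
lemma FlowCoeff.flow_incr_isBigO (h : FlowCoeff I σ K) (hI : Icc (0 : ℝ) 1 ⊆ I)
    (hx : ContinuousOn x (Icc 0 1)) (hz : ContinuousOn z (Icc 0 1)) :
    (fun p : ℝ × ℝ => flow σ p.1 (z p.1) (incr x p) - z p.1 - σ p.1 (z p.1) * incr x p)
      =O[mesh] (fun p => incr x p ^ 2) := by
  have hcont : ContinuousOn (fun q : ℝ × ℝ => partialT (partialT (flow σ)) q.1 (z q.1) q.2)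
      (Icc (0 : ℝ) 1 ×ˢ Icc (-1) 1) :=
    h.contDiffOn_partialTT.continuousOn.comp (f := fun q : ℝ × ℝ => (q.1, z q.1, q.2))
      (continuousOn_fst.prodMk ((hz.comp continuousOn_fst fun q hq => hq.1).prodMk
        continuousOn_snd)) fun q hq => ⟨hI hq.1, mem_univ _⟩
  obtain ⟨C, hC⟩ := (isCompact_Icc.prod isCompact_Icc).exists_bound_of_continuousOn hcont
  refine IsBigO.of_bound (C + C + 1 / 2 * C) ?_
  filter_upwards [eventually_mesh_mem, eventually_mesh_dist_lt hx one_pos] with p hp hd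
  have hp1 : p.1 ∈ Icc (0 : ℝ) 1 := ⟨hp.1, hp.2.1.trans hp.2.2⟩
  have hsub : uIcc 0 (incr x p) ⊆ Icc (-1) 1 :=
    (convex_Icc (-1 : ℝ) 1).ordConnected.uIcc_subset (by norm_num) (abs_le.1 hd.le)
  have hb : ∀ ξ ∈ Icc (-1 : ℝ) 1, |partialT (partialT (flow σ)) p.1 (z p.1) ξ| ≤ C :=
    fun ξ hξ => hC (p.1, ξ) ⟨hp1, hξ⟩
  have hσd : ∀ ξ, HasDerivAt (fun r => σ p.1 (flow σ p.1 (z p.1) r))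
      (partialT (partialT (flow σ)) p.1 (z p.1) ξ) ξ := fun ξ => by
    rw [h.partialTT_flow (hI hp1)]
    exact (((h.contDiff_slice (hI hp1)).differentiable two_ne_zero _).hasDerivAt.comp ξ
      (h.hasDerivAt_flow (hI hp1) _ ξ))
  have h0 : (0 : ℝ) ∈ Icc (-1 : ℝ) 1 := by norm_num
  have key := abs_sub_taylor_two_le (g := flow σ p.1 (z p.1)) (x := 0) (x' := incr x p)
    (ε := C + C) (fun ξ _ => h.hasDerivAt_flow (hI hp1) (z p.1) ξ) (fun ξ _ => hσd ξ)
    (fun ξ hξ => (abs_sub _ _).trans (add_le_add (hb ξ (hsub hξ)) (hb 0 h0)))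
  rw [h.flow_zero (hI hp1), sub_zero] at key
  have h2 : |1 / 2 * (partialT (partialT (flow σ)) p.1 (z p.1) 0 * incr x p ^ 2)| ≤
      1 / 2 * C * incr x p ^ 2 := by
    rw [abs_mul, abs_mul, abs_of_nonneg (sq_nonneg (incr x p)), abs_of_pos (by norm_num), mul_assoc]
    have := mul_le_mul_of_nonneg_right (hb 0 h0) (sq_nonneg (incr x p))
    linarith
  rw [Real.norm_eq_abs, Real.norm_eq_abs, abs_of_nonneg (sq_nonneg (incr x p)), add_mul]
  refine le_trans ?_ (add_le_add key h2)
  refine le_trans (le_of_eq ?_) (abs_add_le _ _)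
  congr 1
  ring

/-- By the group property, pulling `z s` back by `x s` equals first flowing it forward by `dx` and
then pulling back by `x t`. Backward flow is Lipschitz, so the spatial change is governed by `z t -
φ(s, z s, dx)`, where the terms `σ dx` cancel. The change of parameter costs `O(dt)`. -/
lemma FlowCoeff.incr_pullback_isBigO (h : FlowCoeff I σ K) (hI : Icc (0 : ℝ) 1 ⊆ I)
    (hx : ContinuousOn x (Icc 0 1)) (hz : ContinuousOn z (Icc 0 1)) {g : ℝ × ℝ → ℝ}
    (ht : incr (fun t => t) =O[mesh] g) (hsq : (fun p => incr x p ^ 2) =O[mesh] g)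
    (hzO : (fun p : ℝ × ℝ => incr z p - σ p.1 (z p.1) * incr x p) =O[mesh] g) :
    incr (fun t => flow σ t (z t) (-x t)) =O[mesh] g := by
  obtain ⟨X, hX⟩ := isCompact_Icc.exists_bound_of_continuousOn hx
  have hX0 : 0 ≤ X := (norm_nonneg _).trans (hX 0 ⟨le_rfl, zero_le_one⟩)
  have hK := h.nonneg
  have h1 : (fun p : ℝ × ℝ => z p.2 - flow σ p.1 (z p.1) (incr x p)) =O[mesh] g :=
    (hzO.sub ((h.flow_incr_isBigO hI hx hz).trans hsq)).congr_left fun p => by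
      simp only [incr]; ring
  have hexp : ∀ t ∈ Icc (0 : ℝ) 1, Real.exp (K * |(-x t)|) ≤ Real.exp (K * X) := fun t ht => by
    rw [abs_neg]
    exact Real.exp_le_exp.2 (mul_le_mul_of_nonneg_left (hX t ht) hK)
  have h2 : (fun p : ℝ × ℝ => flow σ p.2 (z p.2) (-x p.2) - flow σ p.1 (z p.2) (-x p.2))
      =O[mesh] g := by
    refine IsBigO.trans (IsBigO.of_bound (Real.exp (K * X) * (K * Real.exp (K * X) * X)) ?_) ht
    filter_upwards [eventually_mesh_mem] with p hp
    have hp2 : p.2 ∈ Icc (0 : ℝ) 1 := ⟨hp.1.trans hp.2.1, hp.2.2⟩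
    refine (h.abs_flow_sub_tau_le hI ⟨hp.1, hp.2.1.trans hp.2.2⟩ hp2 _ _).trans ?_
    have e1 := hexp p.2 hp2
    have e2 : |(-x p.2)| ≤ X := by rw [abs_neg]; exact hX p.2 hp2
    exact mul_le_mul_of_nonneg_right (by gcongr) (abs_nonneg _)
  have h3 : (fun p : ℝ × ℝ => flow σ p.1 (z p.2) (-x p.2) - flow σ p.1 (z p.1) (-x p.1))
      =O[mesh] g := by
    refine IsBigO.trans (IsBigO.of_bound (Real.exp (K * X)) ?_) h1
    filter_upwards [eventually_mesh_mem] with p hp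
    have hp1 : p.1 ∈ I := hI ⟨hp.1, hp.2.1.trans hp.2.2⟩
    have e : flow σ p.1 (z p.1) (-x p.1) =
        flow σ p.1 (flow σ p.1 (z p.1) (incr x p)) (-x p.2) := by
      rw [h.flow_flow hp1]
      congr 1
      simp only [incr]; ring
    rw [e]
    refine (h.abs_flow_sub_le hp1 _ _ _).trans ?_
    exact mul_le_mul_of_nonneg_right (hexp p.2 ⟨hp.1.trans hp.2.1, hp.2.2⟩) (abs_nonneg _)
  exact (h2.add h3).congr_left fun p => by simp only [incr]; ring

/-- Equating the two expansions of `dz` and dividing by `φ_ξ` leaves `dB = ½ κ dx² + dC` with `κ =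
(γ - φ_tt) / φ_ξ`, where `dC` contains `-½ (γ / φ_ξ) dQ`. Once `dx²` is replaced by `dQ` only `-½
(φ_tt / φ_ξ) dQ` remains, so `γ` never has to be identified. -/
lemma FlowCoeff.solvesStieltjes_of_expansion (h : FlowCoeff I σ K) (hI : Icc (0 : ℝ) 1 ⊆ I)
    (hT : IsRefining T) (hx : ContinuousOn x (Icc 0 1))
    (hQ : HasContinuousQuadVar T x Q)
    (hb : ContinuousOn (fun q : ℝ × ℝ => b q.1 q.2) (Icc (0 : ℝ) 1 ×ˢ univ))
    (hA : ContinuousOn A (Icc 0 1)) (hwA : Controls w A) (hwt : Controls w fun t => t)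
    (hwQ : Controls w Q) (hBc : ContinuousOn B (Icc 0 1)) (hB0 : B 0 = z₀)
    (hBO : incr B =O[mesh] (fun p => incr w p + incr x p ^ 2))
    (hzB : ∀ t ∈ Icc (0 : ℝ) 1, flow σ t (B t) (x t) = z t) {γ : ℝ → ℝ}
    (hγ : ContinuousOn γ (Icc 0 1))
    (hexp : (fun p : ℝ × ℝ => incr z p - (σ p.1 (z p.1) * incr x p +
        1 / 2 * (γ p.1 * (incr x p ^ 2 - incr Q p)) + b p.1 (z p.1) * incr A p)) =o[mesh]
        (fun p => incr w p + incr x p ^ 2)) :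
    SolvesStieltjes w ![A, fun t => t, Q] (dossCoeff σ b x) z₀ B := by
  have hflow := h.incr_flow_isLittleO hI hx hBc hwt hBO
  have hφ : ContinuousOn (fun t => (partialXi (flow σ) t (B t) (x t))⁻¹) (Icc 0 1) :=
    h.contDiffOn_inv_partialXi.continuousOn.comp_path hI hBc hx
  have hTT : ContinuousOn (fun t => partialT (partialT (flow σ)) t (B t) (x t)) (Icc 0 1) :=
    h.contDiffOn_partialTT.continuousOn.comp_path hI hBc hx
  have hd : ∀ i, ContinuousOn (fun t => dossCoeff σ b x i t (B t)) (Icc 0 1) := fun i =>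
    continuousOn_coeff (h.continuousOn_dossCoeff hI hx hb i) hBc
  have hκ : ContinuousOn (fun t => (γ t - partialT (partialT (flow σ)) t (B t) (x t)) *
      (partialXi (flow σ) t (B t) (x t))⁻¹) (Icc 0 1) := (hγ.sub hTT).mul hφ
  have hγφ : ContinuousOn (fun t => γ t * (partialXi (flow σ) t (B t) (x t))⁻¹) (Icc 0 1) :=
    hγ.mul hφ
  obtain ⟨G₁, -, hG₁⟩ := exists_isIndefIntegral hA hwA (hd 0)
  obtain ⟨G₂, -, hG₂⟩ := exists_isIndefIntegral (A := fun t => t) continuousOn_id hwt (hd 1)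
  obtain ⟨G₃, -, hG₃⟩ := exists_isIndefIntegral hQ.1 hwQ hγφ
  obtain ⟨Γ, -, hΓ⟩ := exists_isIndefIntegral hQ.1 hQ.controls hκ
  have hΓw : IsIndefIntegral w (fun t => (γ t - partialT (partialT (flow σ)) t (B t) (x t)) *
      (partialXi (flow σ) t (B t) (x t))⁻¹) Q Γ := hΓ.trans_isBigO hwQ.incr_isBigO
  have hCc : ContinuousOn (fun t => G₁ t + G₂ t - 1 / 2 * G₃ t) (Icc 0 1) :=
    ((hG₁.continuousOn hwA.self (hd 0) hA).add
      (hG₂.continuousOn hwA.self (hd 1) continuousOn_id)).sub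
      (continuousOn_const.mul (hG₃.continuousOn hwA.self hγφ hQ.1))
  have hGO := (IsLittleO.add hG₁ hG₂).sub (hG₃.const_mul_left (1 / 2))
  have hBexp : (fun p : ℝ × ℝ => incr B p - (0 * incr x p + 1 / 2 *
      ((γ p.1 - partialT (partialT (flow σ)) p.1 (B p.1) (x p.1)) *
        (partialXi (flow σ) p.1 (B p.1) (x p.1))⁻¹ * incr x p ^ 2) +
      incr (fun t => G₁ t + G₂ t - 1 / 2 * G₃ t) p)) =o[mesh]
      (fun p => incr w p + incr x p ^ 2) := by
    refine ((hφ.left_mul_isLittleO (hexp.sub hflow)).sub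
      (hGO.trans_isBigO hwA.incr_self_isBigO_add_sq)).congr'
      (eventually_mesh_mem.mono fun p hp => ?_) .rfl
    have hp1 : p.1 ∈ Icc (0 : ℝ) 1 := ⟨hp.1, hp.2.1.trans hp.2.2⟩
    have hp2 : p.2 ∈ Icc (0 : ℝ) 1 := ⟨hp.1.trans hp.2.1, hp.2.2⟩
    have hne := h.partialXi_ne_zero (hI hp1) (B p.1) (x p.1)
    have e1 : flow σ p.1 (B p.1) (x p.1) = z p.1 := hzB p.1 hp1
    have e2 : flow σ p.2 (B p.2) (x p.2) = z p.2 := hzB p.2 hp2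
    simp only [dossCoeff, Matrix.cons_val, incr, e1, e2]
    field_simp
    ring
  have hBt : ∀ t ∈ Icc (0 : ℝ) 1, B t = B 0 + 1 / 2 * (Γ t - Γ 0) +
      ((G₁ t + G₂ t - 1 / 2 * G₃ t) - (G₁ 0 + G₂ 0 - 1 / 2 * G₃ 0)) := fun t ht => by
    -- The expansion has no `dx` term, so the Itô formula with zero integrand turns `½ κ dx²` into
    -- `½ ∫ κ dQ`.
    have h0 : HasFollmerIntegral T (fun _ => 0) x t 0 := by simp [HasFollmerIntegral]
    have := h0.unique (hQ.hasFollmerIntegral (α := fun _ => 0) hT hx hwA.self hBc hκ hCc hΓ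
      hBexp ht)
    linarith
  refine ⟨hBc, hB0, ?_⟩
  refine (hGO.add (hΓw.const_mul_left (1 / 2))).congr'
    (eventually_mesh_mem.mono fun p hp => ?_) .rfl
  have hp1 : p.1 ∈ Icc (0 : ℝ) 1 := ⟨hp.1, hp.2.1.trans hp.2.2⟩
  simp only [Fin.sum_univ_three, dossCoeff, Matrix.cons_val, incr]
  linear_combination hBt p.1 hp1 - hBt p.2 ⟨hp.1.trans hp.2.1, hp.2.2⟩

lemma FlowCoeff.eqOn_of_isItoSolution (h : FlowCoeff I σ K) (hI : Icc (0 : ℝ) 1 ⊆ I)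
    (hT : IsRefining T) (hx : ContinuousOn x (Icc 0 1)) (hx0 : x 0 = 0)
    (hQ : HasContinuousQuadVar T x Q)
    (hb : ContinuousOn (fun q : ℝ × ℝ => b q.1 q.2) (Icc (0 : ℝ) 1 ×ˢ univ))
    (hbL : LocalLipschitzCond b) (hbG : LinearGrowthCond b)
    (hA : ContinuousOn A (Icc 0 1)) (hwA : Controls w A) (hwt : Controls w fun t => t)
    (hwQ : Controls w Q) (hB : IsDossSussmannSolution x Q A b (flow σ) z₀ B)
    (hz : IsItoSolution T x A σ b z₀ z) :
    EqOn z (fun t => flow σ t (B t) (x t)) (Icc 0 1) := by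
  obtain ⟨hz0, v, γ, hv, hγ, hexp⟩ := hz.exists_expansion hT hx hQ hb hA hwA hwQ
  have hzc := hz.1
  have hwA₂ := hwA.add_right hv
  have hwt₂ := hwt.add_right hv
  have hwQ₂ := hwQ.add_right hv
  have hzO : (fun p : ℝ × ℝ => incr z p - σ p.1 (z p.1) * incr x p) =O[mesh]
      (fun p => incr (fun t => w t + v t) p + incr x p ^ 2) := by
    have h1 := (hγ.left_mul_isBigO ((hwA₂.sq_isBigO_add_sq (x := x)).sub
      hwQ₂.incr_isBigO_add_sq)).const_mul_left (1 / 2)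
    exact (hexp.isBigO.add (h1.add ((continuousOn_coeff (β := b) hb hzc).left_mul_isBigO
      hwA₂.incr_isBigO_add_sq))).congr_left fun p => by ring
  have hBO := h.incr_pullback_isBigO hI hx hzc hwt₂.incr_isBigO_add_sq hwt₂.sq_isBigO_add_sq hzO
  have hzB : ∀ t ∈ Icc (0 : ℝ) 1, flow σ t (flow σ t (z t) (-x t)) (x t) = z t := fun t ht => by
    rw [h.flow_flow (hI ht), neg_add_cancel, h.flow_zero (hI ht)]
  have hsol := h.solvesStieltjes_of_expansion (z₀ := z₀) (B := fun t => flow σ t (z t) (-x t))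
    hI hT hx hQ hb hA hwA₂ hwt₂ hwQ₂ (h.contDiffOn_flow.continuousOn.comp_path hI hzc hx.neg)
    (by simp only [hz0, hx0, neg_zero, h.flow_zero (hI ⟨le_rfl, zero_le_one⟩)]) hBO hzB hγ hexp
  -- Passing through the integral form transfers `B` to the enlarged control `w + v`, where it can
  -- be compared with the pullback of `z`.
  have hBsol := (h.isDossSussmannSolution_iff hI hx hb hA hQ.1 hwA₂ hwt₂ hwQ₂).1 hB
  have heq := hBsol.eqOn hwA₂.self (forall_integrators hwA₂ hwt₂ hwQ₂)
    (h.localLipschitz_dossCoeff hI hx hbL hbG) hsol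
  intro t ht
  exact (hzB t ht).symm.trans (congrArg (fun y => flow σ t y (x t)) (heq ht))

end Uniqueness

/-! ### The theorem -/

theorem mainTheorem1
    (T : ℕ → Finset ℝ) (hT : IsRefining T)
    (x Q A : ℝ → ℝ)
    (hx : ContinuousOn x (Icc 0 1)) (hx0 : x 0 = 0) (hQ : HasContinuousQuadVar T x Q)
    (hA : IsCBV A)
    (b : ℝ → ℝ → ℝ) (hb : ContinuousOn (fun q : ℝ × ℝ => b q.1 q.2) (Icc (0 : ℝ) 1 ×ˢ univ))
    (hbLip : LocalLipschitzCond b) (hbGrowth : LinearGrowthCond b)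
    (I : Set ℝ) (hIopen : IsOpen I) (hIint : I.OrdConnected) (hI : Icc (0 : ℝ) 1 ⊆ I)
    (σ : ℝ → ℝ → ℝ) (hσ : ContDiffOn ℝ 2 (fun q : ℝ × ℝ => σ q.1 q.2) (I ×ˢ univ))
    (hσbdd : ∃ K : ℝ, ∀ t ∈ I, ∀ ξ : ℝ,
      |deriv (fun r => σ r ξ) t| ≤ K ∧ |deriv (fun y => σ t y) ξ| ≤ K) :
    ∃ φ : ℝ → ℝ → ℝ → ℝ,
      -- the flow is well defined: `φ τ ξ` is the unique global solution of its equation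
      (∀ τ ∈ I, ∀ ξ : ℝ, IsFlowLine σ τ ξ (φ τ ξ) ∧ ∀ u, IsFlowLine σ τ ξ u → u = φ τ ξ) ∧
      ContDiffOn ℝ 2 (fun q : ℝ × ℝ × ℝ => φ q.1 q.2.1 q.2.2) (I ×ˢ univ) ∧
      ContDiffOn ℝ 2 (fun q : ℝ × ℝ × ℝ => partialT φ q.1 q.2.1 q.2.2) (I ×ˢ univ) ∧
      ∀ z₀ : ℝ, ∃ B : ℝ → ℝ,
        (IsCBV B ∧ IsDossSussmannSolution x Q A b φ z₀ B ∧
          ∀ B', IsDossSussmannSolution x Q A b φ z₀ B' → EqOn B' B (Icc 0 1)) ∧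
        (IsItoSolution T x A σ b z₀ (fun t => φ t (B t) (x t)) ∧
          ∀ z, IsItoSolution T x A σ b z₀ z → EqOn z (fun t => φ t (B t) (x t)) (Icc 0 1)) := by
  obtain ⟨K, hK⟩ := hσbdd
  have h : FlowCoeff I σ K := ⟨hIopen, hσ,
    (abs_nonneg _).trans (hK 0 (hI ⟨le_rfl, zero_le_one⟩) 0).1,
    fun t ht ξ => (hK t ht ξ).1, fun t ht ξ => (hK t ht ξ).2⟩
  have ht : Controls (fun t => t) (fun t => t) :=
    controls_self_of_monotoneOn (monotone_id.monotoneOn _)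
  -- A single control for all three integrators: time, quadratic variation and the variation of `A`
  -- added together.
  have hwt : Controls (fun t => t + Q t + cumVariation A t) (fun t => t) :=
    (ht.add_right hQ.controls).add_right hA.controls
  have hwQ : Controls (fun t => t + Q t + cumVariation A t) Q :=
    (hQ.controls.add_left ht).add_right hA.controls
  have hwA : Controls (fun t => t + Q t + cumVariation A t) A :=
    hA.controls.add_left (ht.add_right hQ.controls)
  have hctrl := forall_integrators hwA hwt hwQ
  have hcoeff := h.continuousOn_dossCoeff hI hx hb
  have hlip := h.localLipschitz_dossCoeff hI hx hbLip hbGrowth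
  refine ⟨flow σ, fun τ hτ ξ => ⟨h.isFlowLine hτ ξ, fun _ hu => h.eq_flow hτ hu⟩,
    h.contDiffOn_flow, h.contDiffOn_partialT, fun z₀ => ?_⟩
  obtain ⟨B, hB⟩ := exists_solvesStieltjes hwA.self hctrl
    (forall_integrators (P := fun f => ContinuousOn f (Icc 0 1)) hA.1 continuousOn_id hQ.1)
    hcoeff hlip (h.linearGrowth_dossCoeff hI hx hbGrowth) z₀
  have hiff : ∀ B', IsDossSussmannSolution x Q A b (flow σ) z₀ B' ↔
      SolvesStieltjes _ ![A, fun t => t, Q] (dossCoeff σ b x) z₀ B' := fun _ =>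
    h.isDossSussmannSolution_iff hI hx hb hA.1 hQ.1 hwA hwt hwQ
  obtain ⟨M, hM⟩ := hB.isCBV hwA.self hctrl hcoeff
  exact ⟨B, ⟨⟨hB.1, hM.boundedVariationOn⟩, (hiff B).2 hB, fun B' hB' =>
      hB.eqOn hwA.self hctrl hlip ((hiff B').1 hB')⟩,
    h.isItoSolution hI hT hx hx0 hQ hb hA.1 hwA hwt hwQ hB, fun z hz =>
      h.eqOn_of_isItoSolution hI hT hx hx0 hQ hb hbLip hbGrowth hA.1 hwA hwt hwQ ((hiff B).2 hB) hz⟩
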